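/- **Theorem 2.1.** Let $(M,\omega,J)$ be a Kähler manifold of complex dimension $m$: a complex manifold with complex structure $J$ and a symplectic form $\omega$ such that $\omega(J-,J-)=\omega(-,-)$ and $\omega(J-,-)$ is positive definite. Let $f_1,\dots,f_n,g_1,\dots,g_n$ be smooth real functions on $M$ with Hamiltonian vector fields $X_1,\dots,X_n,Y_1,\dots,Y_n$ (convention $-i_X\omega=df$). Assume that all $X_i,Y_i$ are Killing for the metric $\omega(J-,-)$ and commute with each other. Let $\alpha\in\mathbb R^{2n}$ be a regular value of $\Phi=(f_1,\dots,f_n,g_1,\dots,g_n)\colon M\to\mathbb R^{2n}$ such that $N:=\Phi^{-1}(\alpha)$ is nonempty, and assume that the Hamiltonians are in involution along $N$, i.e. $\omega(X_i,X_j)=\omega(X_i,Y_j)=\omega(Y_i,Y_j)=0$ at every point of $N$, for all $i,j$. Put $Z_i:=X_i-JY_i$ and $W_i:=JX_i+Y_i$. Then $2n\le m$ and the following hold. 1. On some open neighbourhood of $N$ the vector fields $Z_i,W_i$ span the tangent distribution of a holomorphic foliation $\widetilde{\mathcal F}$ with leaves of complex dimension $n$, and $\widetilde{\mathcal F}$ is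 transverse to $N$: $T_pM=T_pN\oplus T_p\widetilde{\mathcal F}$ for all $p\in N$. 2. $N$ is a smoothly embedded submanifold of $M$ and carries a complex structure $J_N$, given by a holomorphic atlas of complex dimension $m-n$, such that the transverse coordinates of suitable holomorphic foliation charts of $\widetilde{\mathcal F}$ covering a neighbourhood of $N$ restrict to local biholomorphisms from $N$ to $\mathbb C^{m-n}$. It satisfies $J_Nv-Jv\in T_p\widetilde{\mathcal F}$ for all $p\in N$, $v\in T_pN$, that is, $J_N=\bar i^{-1}\circ\pi\circ J\circ i$, where $i\colon TN\to TM|_N$ is the inclusion, $\pi\colon TM|_N\to TM|_N/T\widetilde{\mathcal F}|_N$ is the projection and $\bar i=\pi\circ i$. 3. The $X_i,Y_i$ are tangent to $N$ and span the tangent distribution of a foliation $\mathcal F$ of $N$, which is holomorphic on $(N,J_N)$ with leaves of complex dimension $n$. 4. $\omega|_N$ is transverse Kähler with respect to $\mathcal F$: it is closed, $\omega|_N(-,-)=\omega|_N(J_N-,J_N-)$, and for $v\in TN$ one has $\omega(J_Nv,v)\ge 0$, with equality if and only if $v\in T\mathcal F$. -/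

import Mathlib

open scoped Manifold ContDiff Topology

/-- The complex coordinate space `ℂᵏ`. It is a separate type so that its only real normed space
structure is the restriction of scalars of the complex one. -/
def CSpace (k : ℕ) : Type := EuclideanSpace ℂ (Fin k)

noncomputable instance (k : ℕ) : NormedAddCommGroup (CSpace k) :=
  inferInstanceAs (NormedAddCommGroup (EuclideanSpace ℂ (Fin k)))

noncomputable instance (k : ℕ) : NormedSpace ℂ (CSpace k) :=
  inferInstanceAs (NormedSpace ℂ (EuclideanSpace ℂ (Fin k)))

instance (k : ℕ) : FiniteDimensional ℂ (CSpace k) :=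
  inferInstanceAs (FiniteDimensional ℂ (EuclideanSpace ℂ (Fin k)))

section ComplexManifold

variable {E : Type*} [NormedAddCommGroup E] [NormedSpace ℂ E]
  {M : Type*} [TopologicalSpace M] [ChartedSpace E M]

/-- A complex manifold is a real smooth manifold, with the same charts. -/
instance realManifoldOfComplex [h : IsManifold 𝓘(ℂ, E) ∞ M] : IsManifold 𝓘(ℝ, E) ∞ M := by
  refine isManifold_of_contDiffOn _ _ _ fun e e' he he' => ?_
  have h1 := (contDiffGroupoid ∞ 𝓘(ℂ, E)).compatible he he'
  rw [contDiffGroupoid, mem_groupoid_of_pregroupoid] at h1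
  have h3 := h1.1
  simp only [contDiffPregroupoid] at h3
  exact ContDiffOn.restrict_scalars ℝ h3

variable (E) in
/-- The real tangent space `T_pM` of the complex manifold `M`. -/
abbrev RTangent (p : M) : Type _ := TangentSpace 𝓘(ℝ, E) p

variable (E M) in
/-- A (not necessarily continuous) vector field on `M`. -/
abbrev VField : Type _ := ∀ p : M, RTangent E p

variable (E M) in
/-- A (not necessarily continuous) real differential `2`-form on `M`. -/
abbrev TwoForm : Type _ := ∀ p : M, (RTangent E p) [⋀^Fin 2]→L[ℝ] ℝ

variable (E) in
/-- The complex structure `J` on `T_pM`. A holomorphic chart around `p` identifies `T_pM` with the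
complex vector space `E`, and `J` is multiplication by `√-1` there; it does not depend on the chart
because the derivatives of the transition maps are complex linear. -/
noncomputable def cJ (p : M) : RTangent E p →L[ℝ] RTangent E p :=
  (Complex.I • ContinuousLinearMap.id ℝ E : E →L[ℝ] E)

/-- The differential of a map between complex manifolds, as a real linear map. -/
noncomputable def rderiv {E' : Type*} [NormedAddCommGroup E'] [NormedSpace ℂ E']
    {M' : Type*} [TopologicalSpace M'] [ChartedSpace E' M'] (φ : M → M') (p : M) :
    RTangent E p →L[ℝ] RTangent E' (φ p) :=
  mfderiv 𝓘(ℝ, E) 𝓘(ℝ, E') φ p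

/-- A vector field is smooth at `p`. -/
def SmoothFieldAt [IsManifold 𝓘(ℂ, E) ∞ M] (X : VField E M) (p : M) : Prop :=
  ContMDiffAt 𝓘(ℝ, E) 𝓘(ℝ, E).tangent ∞ (fun q => (⟨q, X q⟩ : TangentBundle 𝓘(ℝ, E) M)) p

namespace TwoForm

/-- The coordinate expression of a `2`-form in the preferred chart at `x`, a `2`-form on the target
of that chart. -/
noncomputable def inChart (Ω : TwoForm E M) (x : M) : E → E [⋀^Fin 2]→L[ℝ] ℝ := fun y =>
  (Ω ((chartAt E x).symm y)).compContinuousLinearMap (rderiv (E := E) (chartAt E x).symm y)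

/-- The `2`-form is smooth: its coordinate expressions are. -/
def IsSmooth (Ω : TwoForm E M) : Prop :=
  ∀ x : M, ContDiffOn ℝ ∞ (Ω.inChart x) (chartAt E x).target

/-- `dΩ = 0`: the exterior derivatives of the coordinate expressions vanish. -/
def IsClosed (Ω : TwoForm E M) : Prop :=
  ∀ x : M, ∀ y ∈ (chartAt E x).target, extDeriv (Ω.inChart x) y = 0

/-- The pullback of a `2`-form under a map. -/
noncomputable def pullback {E' : Type*} [NormedAddCommGroup E'] [NormedSpace ℂ E']
    {M' : Type*} [TopologicalSpace M'] [ChartedSpace E' M']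
    (Ω : TwoForm E' M') (φ : M → M') : TwoForm E M :=
  fun p => (Ω (φ p)).compContinuousLinearMap (rderiv φ p)

/-- `Ω` is a Kähler form on the complex manifold `M`: a symplectic form with
`Ω(J-,J-) = Ω(-,-)` and `Ω(J-,-)` positive definite. -/
structure IsKahler (Ω : TwoForm E M) : Prop where
  smooth : Ω.IsSmooth
  closed : Ω.IsClosed
  nondegenerate : ∀ (p : M) (v : RTangent E p), (∀ w, Ω p ![v, w] = 0) → v = 0
  invariant : ∀ (p : M) (v w : RTangent E p), Ω p ![cJ E p v, cJ E p w] = Ω p ![v, w]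
  pos : ∀ (p : M) (v : RTangent E p), v ≠ 0 → 0 < Ω p ![cJ E p v, v]

/-- `X` is the Hamiltonian vector field of `f`, with the convention `-i_X Ω = df`. -/
structure IsHamiltonian [IsManifold 𝓘(ℂ, E) ∞ M] (Ω : TwoForm E M) (f : M → ℝ)
    (X : VField E M) : Prop where
  smooth : ∀ p, SmoothFieldAt X p
  eq : ∀ (p : M) (v : RTangent E p), - Ω p ![X p, v] = mfderiv 𝓘(ℝ, E) 𝓘(ℝ, ℝ) f p v

/-- `X` is Killing: the Lie derivative `L_X g` of the metric `g = Ω(J-,-)` vanishes, that is,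
`X (g(U,V)) = g([X,U],V) + g(U,[X,V])` for all locally defined smooth vector fields `U`, `V`. -/
def IsKilling [IsManifold 𝓘(ℂ, E) ∞ M] (Ω : TwoForm E M) (X : VField E M) : Prop :=
  ∀ (p : M) (U V : VField E M), SmoothFieldAt U p → SmoothFieldAt V p →
    mfderiv 𝓘(ℝ, E) 𝓘(ℝ, ℝ) (fun q => Ω q ![cJ E q (U q), V q]) p (X p) =
      Ω p ![cJ E p (VectorField.mlieBracket 𝓘(ℝ, E) X U p), V p] +
      Ω p ![cJ E p (U p), VectorField.mlieBracket 𝓘(ℝ, E) X V p]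

/-- `Ω` is transverse Kähler with respect to the holomorphic foliation with tangent
distribution `D`. -/
structure IsTransverseKahler (Ω : TwoForm E M) (D : ∀ p : M, Submodule ℝ (RTangent E p)) :
    Prop where
  smooth : Ω.IsSmooth
  closed : Ω.IsClosed
  invariant : ∀ (p : M) (v w : RTangent E p), Ω p ![v, w] = Ω p ![cJ E p v, cJ E p w]
  nonneg : ∀ (p : M) (v : RTangent E p), 0 ≤ Ω p ![cJ E p v, v]
  eq_zero_iff : ∀ (p : M) (v : RTangent E p), Ω p ![cJ E p v, v] = 0 ↔ v ∈ D p

end TwoForm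

/-- Two vector fields commute. -/
def FieldsCommute (X Y : VField E M) : Prop :=
  ∀ p, VectorField.mlieBracket 𝓘(ℝ, E) X Y p = 0

variable (E) in
/-- A holomorphic foliation atlas on the subset `U` (in practice open) of a complex manifold, with
`q` transverse and `k` leafwise complex coordinates `(x, y) ∈ ℂ^q × ℂ^k`. -/
structure HolFoliationAtlas (q k : ℕ) (U : Set M) where
  /-- the foliation charts -/
  charts : Set (OpenPartialHomeomorph M (CSpace q × CSpace k))
  source_subset : ∀ φ ∈ charts, φ.source ⊆ U
  cover : ∀ p ∈ U, ∃ φ ∈ charts, p ∈ φ.source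
  target_prod : ∀ φ ∈ charts, ∃ (V : Set (CSpace q)) (W : Set (CSpace k)),
    IsOpen V ∧ IsOpen W ∧ φ.target = V ×ˢ W
  /-- the charts are biholomorphic onto their targets -/
  holomorphic : ∀ φ ∈ charts,
    ContMDiffOn 𝓘(ℂ, E) 𝓘(ℂ, CSpace q × CSpace k) ∞ φ φ.source
  holomorphic_symm : ∀ φ ∈ charts,
    ContMDiffOn 𝓘(ℂ, CSpace q × CSpace k) 𝓘(ℂ, E) ∞ φ.symm φ.target
  /-- the transition maps are locally of the form `(x, y) ↦ (g(x), h(x, y))` -/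
  transition : ∀ φ ∈ charts, ∀ ψ ∈ charts, ∀ p ∈ φ.source ∩ ψ.source,
    ∃ g : CSpace q → CSpace q, ∀ᶠ z in 𝓝 (φ p), (ψ (φ.symm z)).1 = g z.1

/-- `D` is the tangent distribution of the foliation: in every foliation chart `(x, y)` it is
spanned by the `∂/∂y` directions, i.e. it is the kernel of `dx`. -/
def HolFoliationAtlas.HasTangent {q k : ℕ} {U : Set M} (A : HolFoliationAtlas E q k U)
    (D : ∀ p : M, Submodule ℝ (RTangent E p)) : Prop :=
  ∀ φ ∈ A.charts, ∀ p ∈ φ.source, ∀ v : RTangent E p,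
    v ∈ D p ↔ rderiv (E' := CSpace q) (fun r : M => (φ r).1) p v = 0

/-- The distribution spanned by the vector fields `X_i` and `Y_i`. -/
noncomputable def spanFields {n : ℕ} (X Y : Fin n → VField E M) (p : M) : Submodule ℝ (RTangent E p) :=
  Submodule.span ℝ (Set.range (fun i => X i p) ∪ Set.range (fun i => Y i p))

/-- The part of a distribution `D` on `M'` that is tangent to `M`, for an embedding `ι : M → M'`:
the distribution `T_pM ∩ D_{ι(p)}` on `M`. -/
noncomputable def restrictDist {E' : Type*} [NormedAddCommGroup E'] [NormedSpace ℂ E']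
    {M' : Type*} [TopologicalSpace M'] [ChartedSpace E' M'] (ι : M → M')
    (D : ∀ q : M', Submodule ℝ (RTangent E' q)) (p : M) : Submodule ℝ (RTangent E p) :=
  (D (ι p)).comap (rderiv (E := E) ι p).toLinearMap

end ComplexManifold

/-- The level set `Φ⁻¹(α)`, with the subspace topology. -/
abbrev LevelSet {M T : Type*} (Φ : M → T) (α : T) : Type _ := {p : M // Φ p = α}

/-- The inclusion of a level set. -/
abbrev LevelSet.incl {M T : Type*} (Φ : M → T) (α : T) : LevelSet Φ α → M := Subtype.val

/-!
Killing Hamiltonian fields on a Kähler manifold preserve both `Ω` and the metric `Ω(J-,-)`, hence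
also `J`; so they are real parts of holomorphic fields (`fderiv_fieldInChart_I`). The fields `X_i`,
`Y_i` commute, so the holomorphic fields `X_i` and `Z_i = X_i - J Y_i` commute over `ℂ`. Along the
level set `N` of `Φ` the real span `T` of the `X_i`, `Y_i` is isotropic, whence `T ∩ JT = 0` and the
`X_i`, `Z_i` are linearly independent over `ℂ` (`KillingSystem.linearIndependent_complex`). By the
holomorphic Frobenius theorem for commuting fields (`exists_straightening`), near every point of `N`
there are holomorphic coordinates in which they are coordinate fields. These are foliation charts of
the foliation spanned by the `Z_i`, `W_i = J Z_i`, and the `X_i` are coordinate fields in the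
transverse directions (`KillingSystem.exists_adaptedChart`).

The tangent space of `N` is the `Ω`-orthogonal complement of `T`. A vector in the span of the `Z_i`,
`W_i` is of the form `t + Js` with `s`, `t ∈ T`, and it is `Ω`-orthogonal to `T` only if
`Ω(s, Js) = 0`, that is, if it vanishes (`KillingSystem.eq_zero_of_mfderiv_eq_zero`). So `N` is
transverse to the foliation, and by the inverse function theorem the transverse coordinates together
with `Φ` are coordinates of `M` (`KillingSystem.exists_transverseChart`). The transverse coordinates
therefore restrict to charts of `N`. Since they are functions of each other on overlaps
(`IsAdaptedChart.exists_transition`), the transition maps of these charts are holomorphic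
(`IsSliceChart.contDiffAt_transition`).

In terms of this structure, `J_N v = J(v + s) + t` with `s`, `t ∈ T`
(`KillingSystem.exists_rderiv_incl_cJ`). As `T` is `Ω`-orthogonal to `TN`, this gives
`Ω(J_N v, J_N w) = Ω(v, w)` and `Ω(J_N v, v) = Ω(J(v + s), v + s) ≥ 0`, with equality exactly for
`v ∈ T`. Finally `T` is, inside `TN`, the kernel of those transverse coordinates in which the `X_i`
have no component, so it is the tangent distribution of a holomorphic foliation of `N`
(`KillingSystem.exists_adaptedChart_levelSet`).

The Frobenius theorem is proved through the flow of `∑ y_i Z_i` with complex parameters `y`: the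
integral equation for its trajectories on `[0, 1]` is solved by the implicit function theorem in the
Banach space `C([0, 1], E)`, which makes the solution holomorphic in the initial point and in `y`
(`exists_smooth_flow`).
-/

set_option linter.unusedSectionVars false

/-! ### Superposition operators on spaces of continuous curves -/

section Superposition

universe u

variable {K : Type*} [TopologicalSpace K] [CompactSpace K]
  {E F : Type u} [NormedAddCommGroup E] [NormedSpace ℂ E] [NormedAddCommGroup F] [NormedSpace ℂ F]

open Classical in
/-- The superposition operator `γ ↦ Z ∘ γ` on continuous functions on a compact space, with value
`0` at those `γ` for which `Z ∘ γ` is not continuous. -/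
noncomputable def superposition (Z : E → F) (γ : C(K, E)) : C(K, F) :=
  if h : Continuous (Z ∘ γ) then ⟨Z ∘ γ, h⟩ else 0

lemma superposition_apply {Z : E → F} {S : Set E} (hZ : ContinuousOn Z S) {γ : C(K, E)}
    (hγ : ∀ t, γ t ∈ S) (t : K) : superposition Z γ t = Z (γ t) := by
  have h : Continuous (Z ∘ γ) := hZ.comp_continuous γ.continuous hγ
  simp [superposition, h]

/-- Pointwise application `(A, h) ↦ (t ↦ A t (h t))`, as a continuous linear map into the space of
operators. -/
noncomputable def pointwiseApply (K E F : Type*) [TopologicalSpace K] [CompactSpace K]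
    [NormedAddCommGroup E] [NormedSpace ℂ E] [NormedAddCommGroup F] [NormedSpace ℂ F] :
    C(K, E →L[ℂ] F) →L[ℂ] C(K, E) →L[ℂ] C(K, F) :=
  LinearMap.mkContinuous₂
    (LinearMap.mk₂ ℂ (fun (A : C(K, E →L[ℂ] F)) (h : C(K, E)) =>
      (⟨fun t => A t (h t), A.continuous.clm_apply h.continuous⟩ : C(K, F)))
      (fun _ _ _ => by ext; simp) (fun _ _ _ => by ext; simp)
      (fun _ _ _ => by ext; simp) (fun _ _ _ => by ext; simp)) 1
    (fun A h => by
      rw [ContinuousMap.norm_le _ (by positivity)]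
      intro t
      simp only [LinearMap.mk₂_apply, ContinuousMap.coe_mk, one_mul]
      exact (A t).le_opNorm_of_le (h.norm_coe_le_norm t) |>.trans
        (mul_le_mul_of_nonneg_right (A.norm_coe_le_norm t) (norm_nonneg _)))

@[simp] lemma pointwiseApply_apply (A : C(K, E →L[ℂ] F)) (h : C(K, E)) (t : K) :
    pointwiseApply K E F A h t = A t (h t) := rfl

lemma isOpen_setOf_forall_mem {S : Set E} (hS : IsOpen S) :
    IsOpen {γ : C(K, E) | ∀ t, γ t ∈ S} := by
  have h := ContinuousMap.isOpen_setOfPred_mapsTo (X := K) (Y := E) isCompact_univ hS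
  simpa [Set.MapsTo] using h

/-- A function continuous on an open set is uniformly continuous along a compact curve in it. -/
lemma exists_uniform_delta {Z : E → F} {S : Set E} (hS : IsOpen S) (hZ : ContinuousOn Z S)
    {γ : C(K, E)} (hγ : ∀ t, γ t ∈ S) {ε : ℝ} (hε : 0 < ε) :
    ∃ δ > 0, ∀ t, ∀ y, dist y (γ t) < δ → y ∈ S ∧ dist (Z y) (Z (γ t)) < ε := by
  have hc : IsCompact (Set.range γ) := isCompact_range γ.continuous
  have hsub : Set.range γ ⊆ S := by rintro _ ⟨t, rfl⟩; exact hγ t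
  obtain ⟨δ₁, h₁, hδ₁⟩ := hc.exists_thickening_subset_open hS hsub
  have h := hc.uniformContinuousAt_of_continuousAt Z
    (fun a ha => hZ.continuousAt (hS.mem_nhds (hsub ha))) (Metric.dist_mem_uniformity hε)
  obtain ⟨δ₂, h₂, hδ₂⟩ := Metric.mem_uniformity_dist.1 h
  refine ⟨min δ₁ δ₂, lt_min h₁ h₂, fun t y hy => ⟨hδ₁ ?_, ?_⟩⟩
  · exact Metric.mem_thickening_iff.2 ⟨γ t, ⟨t, rfl⟩, hy.trans_le (min_le_left _ _)⟩
  · have := hδ₂ (a := γ t) (b := y) (by rw [dist_comm]; exact hy.trans_le (min_le_right _ _)) ⟨t, rfl⟩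
    rw [dist_comm]; exact this

lemma continuousOn_superposition {Z : E → F} {S : Set E} (hS : IsOpen S) (hZ : ContinuousOn Z S) :
    ContinuousOn (superposition (K := K) Z) {γ | ∀ t, γ t ∈ S} := by
  intro γ hγ
  refine ContinuousAt.continuousWithinAt (Metric.continuousAt_iff.2 fun ε hε => ?_)
  obtain ⟨δ, hδ, h⟩ := exists_uniform_delta hS hZ hγ (half_pos hε)
  refine ⟨δ, hδ, fun {γ'} hd => ?_⟩
  have hγ' : ∀ t, dist (γ' t) (γ t) < δ := fun t => (ContinuousMap.dist_apply_le_dist t).trans_lt hd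
  refine lt_of_le_of_lt ((ContinuousMap.dist_le (half_pos hε).le).2 fun t => ?_) (half_lt_self hε)
  rw [superposition_apply hZ hγ, superposition_apply hZ (fun t => (h t _ (hγ' t)).1)]
  exact (h t _ (hγ' t)).2.le

lemma hasFDerivAt_superposition {Z : E → F} {S : Set E} (hS : IsOpen S) (hZ : ContDiffOn ℂ 1 Z S)
    {γ : C(K, E)} (hγ : ∀ t, γ t ∈ S) :
    HasFDerivAt (superposition (K := K) Z)
      (pointwiseApply K E F (superposition (fderiv ℂ Z) γ)) γ := by
  have hZ' : ContinuousOn (fderiv ℂ Z) S := hZ.continuousOn_fderiv_of_isOpen hS le_rfl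
  rw [hasFDerivAt_iff_isLittleO, Asymptotics.isLittleO_iff]
  intro ε hε
  obtain ⟨δ, hδ, h⟩ := exists_uniform_delta hS hZ' hγ hε
  filter_upwards [Metric.ball_mem_nhds γ hδ] with γ' hd
  have hγ' : ∀ t, dist (γ' t) (γ t) < δ := fun t => (ContinuousMap.dist_apply_le_dist t).trans_lt hd
  rw [ContinuousMap.norm_le _ (by positivity)]
  intro t
  simp only [ContinuousMap.sub_apply, pointwiseApply_apply]
  rw [superposition_apply hZ.continuousOn hγ, superposition_apply hZ' hγ,
    superposition_apply hZ.continuousOn (fun t => (h t _ (hγ' t)).1)]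
  have hmv := (convex_ball (γ t) δ).norm_image_sub_le_of_norm_hasFDerivWithin_le' (𝕜 := ℂ)
    (f := Z) (f' := fderiv ℂ Z) (φ := fderiv ℂ Z (γ t)) (C := ε) (x := γ t) (y := γ' t)
    (fun y hy => ((hZ.differentiableOn one_ne_zero).differentiableAt
      (hS.mem_nhds (h t y hy).1)).hasFDerivAt.hasFDerivWithinAt)
    (fun y hy => by rw [← dist_eq_norm]; exact (h t y hy).2.le)
    (Metric.mem_ball_self hδ) (hγ' t)
  refine hmv.trans (mul_le_mul_of_nonneg_left ?_ hε.le)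
  rw [← ContinuousMap.sub_apply]
  exact ContinuousMap.norm_coe_le_norm _ t

/-- The superposition operator of a smooth function is smooth: its derivative is again given by a
superposition operator, so one can induct on the order of differentiability. -/
lemma contDiffOn_superposition {S : Set E} (hS : IsOpen S) (k : ℕ) :
    ∀ {F : Type u} [NormedAddCommGroup F] [NormedSpace ℂ F] {Z : E → F}, ContDiffOn ℂ k Z S →
      ContDiffOn ℂ k (superposition (K := K) Z) {γ | ∀ t, γ t ∈ S} := by
  induction k with
  | zero =>
    intro F _ _ Z hZ
    simp only [CharP.cast_eq_zero, contDiffOn_zero] at hZ ⊢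
    exact continuousOn_superposition hS hZ
  | succ k ih =>
    intro F _ _ Z hZ
    have h1 : ContDiffOn ℂ 1 Z S := hZ.of_le (by exact_mod_cast Nat.le_add_left 1 k)
    have hO := isOpen_setOf_forall_mem (K := K) hS
    push_cast at hZ ⊢
    rw [contDiffOn_succ_iff_fderiv_of_isOpen hO]
    refine ⟨fun γ hγ => (hasFDerivAt_superposition hS h1 hγ).differentiableAt.differentiableWithinAt,
      by simp, ?_⟩
    have h2 := ih ((contDiffOn_succ_iff_fderiv_of_isOpen hS).1 hZ).2.2
    refine ((pointwiseApply K E F).contDiff.comp_contDiffOn h2).congr fun γ hγ => ?_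
    exact (hasFDerivAt_superposition hS h1 hγ).fderiv

lemma contDiffAt_superposition {Z : E → F} {S : Set E} (hS : IsOpen S) (hZ : ContDiffOn ℂ ∞ Z S)
    {γ : C(K, E)} (hγ : ∀ t, γ t ∈ S) : ContDiffAt ℂ ∞ (superposition (K := K) Z) γ := by
  rw [contDiffAt_infty]
  intro k
  exact (contDiffOn_superposition hS k (hZ.of_le (by exact_mod_cast le_top))).contDiffAt
    ((isOpen_setOf_forall_mem hS).mem_nhds hγ)

end Superposition

/-! ### The joint flow of commuting holomorphic vector fields -/

section Flow

open scoped unitInterval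

universe u

variable {E : Type u} [NormedAddCommGroup E] [NormedSpace ℂ E] [CompleteSpace E]

/-- Integration from `0`, as an operator on continuous curves `[0, 1] → E`. -/
noncomputable def volterra (E : Type*) [NormedAddCommGroup E] [NormedSpace ℂ E] [CompleteSpace E] :
    C(I, E) →L[ℂ] C(I, E) :=
  LinearMap.mkContinuous
    { toFun := fun h => ⟨fun t => ∫ s in (0 : ℝ)..t, Set.IccExtend zero_le_one h s, by
        have hc : Continuous (Set.IccExtend (zero_le_one (α := ℝ)) h) := h.continuous.Icc_extend'
        exact (intervalIntegral.continuous_primitive (fun a b => hc.intervalIntegrable a b)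
          0).comp continuous_subtype_val⟩
      map_add' := fun h h' => by
        ext t
        have hc : ∀ h : C(I, E), Continuous (Set.IccExtend (zero_le_one (α := ℝ)) h) :=
          fun h => h.continuous.Icc_extend'
        simp only [ContinuousMap.coe_mk, ContinuousMap.add_apply]
        rw [← intervalIntegral.integral_add ((hc h).intervalIntegrable _ _)
          ((hc h').intervalIntegrable _ _)]
        rfl
      map_smul' := fun c h => by
        ext t
        simp only [ContinuousMap.coe_mk, ContinuousMap.smul_apply, RingHom.id_apply]
        rw [← intervalIntegral.integral_smul]
        rfl } 1
    (fun h => by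
      rw [ContinuousMap.norm_le _ (by positivity), one_mul]
      intro t
      simp only [LinearMap.coe_mk, AddHom.coe_mk, ContinuousMap.coe_mk]
      refine (intervalIntegral.norm_integral_le_of_norm_le_const (C := ‖h‖)
        (fun s _ => h.norm_coe_le_norm _)).trans ?_
      rw [sub_zero, abs_of_nonneg t.2.1]
      exact mul_le_of_le_one_right (norm_nonneg _) t.2.2)

lemma volterra_apply (h : C(I, E)) (t : I) :
    volterra E h t = ∫ s in (0 : ℝ)..t, Set.IccExtend zero_le_one h s := rfl

/-- If `γ' = w`, then `t • f(γ(t))` is the primitive of `f(γ(t)) + t • Df(γ(t)) w(t)`. -/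
lemma smul_comp_eq_volterra {S : Set E} (hS : IsOpen S) {f : E → E} (hf : ContDiffOn ℂ 1 f S)
    {γ w : C(I, E)} (hγ : ∀ t, γ t ∈ S) {x : E} (hx : ∀ t, γ t = x + volterra E w t)
    {h g : C(I, E)} (hh : ∀ t, h t = (t : ℝ) • f (γ t))
    (hg : ∀ t, g t = f (γ t) + (t : ℝ) • fderiv ℂ f (γ t) (w t)) :
    h = volterra E g := by
  have hc : ∀ h : C(I, E), Continuous (Set.IccExtend (zero_le_one (α := ℝ)) h) :=
    fun h => h.continuous.Icc_extend'
  ext t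
  rw [volterra_apply]
  have hd : ∀ s ∈ Set.Ioo (0 : ℝ) t, HasDerivAt (Set.IccExtend (zero_le_one (α := ℝ)) h)
      (Set.IccExtend zero_le_one g s) s := by
    intro s hs
    have hsI : s ∈ Set.Icc (0 : ℝ) 1 := ⟨hs.1.le, hs.2.le.trans t.2.2⟩
    have hsI' : s ∈ Set.Ioo (0 : ℝ) 1 := ⟨hs.1, hs.2.trans_le t.2.2⟩
    set s' : I := ⟨s, hsI⟩
    have h1 : HasDerivAt (fun r : ℝ => x + ∫ τ in (0 : ℝ)..r, Set.IccExtend zero_le_one w τ)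
        (w s') s := by
      have := ((hc w).integral_hasStrictDerivAt 0 s).hasDerivAt.const_add x
      rwa [Set.IccExtend_of_mem _ _ hsI] at this
    have hxs : x + ∫ τ in (0 : ℝ)..s, Set.IccExtend zero_le_one w τ = γ s' := (hx s').symm
    have h2 : HasFDerivAt f ((fderiv ℂ f (γ s')).restrictScalars ℝ)
        (x + ∫ τ in (0 : ℝ)..s, Set.IccExtend zero_le_one w τ) := by
      rw [hxs]
      exact ((hf.differentiableOn one_ne_zero).differentiableAt
        (hS.mem_nhds (hγ s'))).hasFDerivAt.restrictScalars ℝ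
    have h3 := (hasDerivAt_id s).smul (h2.comp_hasDerivAt s h1)
    rw [Set.IccExtend_of_mem _ _ hsI, hg]
    refine (h3.congr_of_eventuallyEq ?_).congr_deriv ?_
    · filter_upwards [Ioo_mem_nhds hsI'.1 hsI'.2] with r hr
      rw [Set.IccExtend_of_mem _ _ (Set.Ioo_subset_Icc_self hr), hh]
      simp only [Pi.smul_apply', id, Function.comp]
      congr 2
      exact hx _
    · simp only [id, Function.comp, one_smul, ContinuousLinearMap.coe_restrictScalars']
      rw [hxs, add_comm]
  have := intervalIntegral.integral_eq_sub_of_hasDerivAt_of_le t.2.1 (hc h).continuousOn hd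
    ((hc g).intervalIntegrable _ _)
  have h0 : Set.IccExtend (zero_le_one (α := ℝ)) h 0 = 0 := by
    rw [Set.IccExtend_left]
    exact (hh _).trans (zero_smul ℝ _)
  rw [this, h0, sub_zero, Set.IccExtend_val]

variable {κ : Type*} [Fintype κ]

/-- The integral equation `γ = x + ∫ ∑ yᵢ Zᵢ(γ)`, written as the vanishing of a function of the
parameters `(x, y)` and the curve `γ`. -/
noncomputable def flowEq (Z : κ → E → E) (u : (E × (κ → ℂ)) × C(I, E)) : C(I, E) :=
  u.2 - ContinuousLinearMap.const ℂ I u.1.1 - ∑ i, u.1.2 i • volterra E (superposition (Z i) u.2)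

/-- The derivative of `flowEq` in the direction of the curve. -/
noncomputable def flowEqPartial (Z : κ → E → E) (u : (E × (κ → ℂ)) × C(I, E)) :
    C(I, E) →L[ℂ] C(I, E) :=
  ContinuousLinearMap.id ℂ _ - ∑ i, u.1.2 i •
    (volterra E ∘L pointwiseApply I E E (superposition (fderiv ℂ (Z i)) u.2))

/-- The derivative of `flowEq` at `((x, y), γ)`. -/
noncomputable def flowEqDeriv (Z : κ → E → E) (u : (E × (κ → ℂ)) × C(I, E)) :
    ((E × (κ → ℂ)) × C(I, E)) →L[ℂ] C(I, E) :=
  flowEqPartial Z u ∘L .snd ℂ _ _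
    - ContinuousLinearMap.const ℂ I ∘L .fst ℂ _ _ ∘L .fst ℂ _ _
    - ∑ i, ((ContinuousLinearMap.proj (R := ℂ) (φ := fun _ : κ => ℂ) i) ∘L
        .snd ℂ _ _ ∘L .fst ℂ _ _).smulRight (volterra E (superposition (Z i) u.2))

variable {Z : κ → E → E} {S : Set E}

lemma contDiffAt_flowEq (hS : IsOpen S) (hZ : ∀ i, ContDiffOn ℂ ∞ (Z i) S)
    {u : (E × (κ → ℂ)) × C(I, E)} (hu : ∀ t, u.2 t ∈ S) : ContDiffAt ℂ ∞ (flowEq Z) u := by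
  have h : ∀ i, ContDiffAt ℂ ∞ (fun u : (E × (κ → ℂ)) × C(I, E) =>
      volterra E (superposition (Z i) u.2)) u := fun i =>
    (volterra E).contDiff.contDiffAt.comp u
      ((contDiffAt_superposition hS (hZ i) hu).comp u contDiffAt_snd)
  have h2 : ∀ i, ContDiffAt ℂ ∞ (fun u : (E × (κ → ℂ)) × C(I, E) => u.1.2 i) u := fun i => by
    fun_prop
  refine ContDiffAt.sub (by fun_prop) (ContDiffAt.sum fun i _ => (h2 i).smul (h i))

lemma hasFDerivAt_flowEq (hS : IsOpen S) (hZ : ∀ i, ContDiffOn ℂ ∞ (Z i) S)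
    {u : (E × (κ → ℂ)) × C(I, E)} (hu : ∀ t, u.2 t ∈ S) :
    HasFDerivAt (flowEq Z) (flowEqDeriv Z u) u := by
  have h : ∀ i, HasFDerivAt (fun u : (E × (κ → ℂ)) × C(I, E) =>
      volterra E (superposition (Z i) u.2))
      (volterra E ∘L pointwiseApply I E E (superposition (fderiv ℂ (Z i)) u.2) ∘L .snd ℂ _ _) u :=
    fun i => (volterra E).hasFDerivAt.comp u
      ((hasFDerivAt_superposition hS ((hZ i).of_le (by simp)) hu).comp u hasFDerivAt_snd)
  have h2 : ∀ i, HasFDerivAt (fun u : (E × (κ → ℂ)) × C(I, E) => u.1.2 i)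
    ((ContinuousLinearMap.proj (R := ℂ) (φ := fun _ : κ => ℂ) i) ∘L
        .snd ℂ _ _ ∘L .fst ℂ _ _) u := fun i => ContinuousLinearMap.hasFDerivAt
          ((ContinuousLinearMap.proj (R := ℂ) (φ := fun _ : κ => ℂ) i) ∘L
        .snd ℂ E _ ∘L .fst ℂ _ C(I, E))
  have h3 := ((hasFDerivAt_snd (𝕜 := ℂ) (p := u)).sub ((ContinuousLinearMap.const ℂ I ∘L
    .fst ℂ E (κ → ℂ) ∘L .fst ℂ _ C(I, E)).hasFDerivAt)).sub
      (HasFDerivAt.fun_sum fun i (_ : i ∈ Finset.univ) => (h2 i).smul (h i))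
  refine h3.congr_fderiv ?_
  ext δ
  · simp [flowEqDeriv, flowEqPartial]
  · simp [flowEqDeriv, flowEqPartial]
  · simp [flowEqDeriv, flowEqPartial]

lemma isInvertible_flowEqPartial_zero {u : (E × (κ → ℂ)) × C(I, E)} (hu : u.1.2 = 0) :
    (flowEqPartial Z u).IsInvertible := by
  have : flowEqPartial Z u = ContinuousLinearMap.id ℂ _ := by
    ext δ t
    simp [flowEqPartial, hu]
  rw [this]
  exact ContinuousLinearMap.isInvertible_equiv (f := ContinuousLinearEquiv.refl ℂ _)

/-- Joint time-one flow of the vector fields: near any point `p` there is a solution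
`u = (x, y) ↦ ψ u` of the integral equation `ψ u = x + ∫ ∑ yᵢ Zᵢ(ψ u)`, smooth in `(x, y)`, at which
the linearised equation is nondegenerate. -/
lemma exists_smooth_flow (hS : IsOpen S) (hZ : ∀ i, ContDiffOn ℂ ∞ (Z i) S) {p : E} (hp : p ∈ S) :
    ∃ ψ : E × (κ → ℂ) → C(I, E), ψ (p, 0) = ContinuousLinearMap.const ℂ I p ∧
      ∀ᶠ u in 𝓝 ((p, 0) : E × (κ → ℂ)), ContDiffAt ℂ ∞ ψ u ∧ (∀ t, ψ u t ∈ S) ∧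
        flowEq Z (u, ψ u) = 0 ∧ (flowEqPartial Z (u, ψ u)).IsInvertible := by
  set u₀ : (E × (κ → ℂ)) × C(I, E) := ((p, 0), ContinuousLinearMap.const ℂ I p) with hu₀
  have hp' : ∀ t, u₀.2 t ∈ S := fun t => hp
  have key : ∀ u : (E × (κ → ℂ)) × C(I, E), (∀ t, u.2 t ∈ S) →
      fderiv ℂ (flowEq Z) u ∘L .inr ℂ _ _ = flowEqPartial Z u := by
    intro u hu
    rw [(hasFDerivAt_flowEq hS hZ hu).fderiv]
    ext δ
    simp [flowEqDeriv]
  have cd := contDiffAt_flowEq hS hZ hp'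
  have hinv : (fderiv ℂ (flowEq Z) u₀ ∘L .inr ℂ _ _).IsInvertible := by
    rw [key u₀ hp']; exact isInvertible_flowEqPartial_zero rfl
  have hn : (∞ : ℕ∞ω) ≠ 0 := by simp
  set ψ := cd.implicitFunction hn hinv with hψ
  have hψ₀ : ψ u₀.1 = u₀.2 := cd.implicitFunction_apply_self hn hinv
  have hzero : flowEq Z u₀ = 0 := by simp [flowEq, hu₀]
  have hψc : ContDiffAt ℂ ∞ ψ u₀.1 := cd.contDiffAt_implicitFunction hn hinv
  have hc1 : ∀ᶠ u in 𝓝 u₀.1, ContDiffAt ℂ 1 ψ u := (hψc.of_le (by simp)).eventually (by simp)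
  have hmem : ∀ᶠ u in 𝓝 u₀.1, ∀ t, ψ u t ∈ S :=
    hψc.continuousAt.eventually ((isOpen_setOf_forall_mem (K := I) hS).mem_nhds
      (by rw [hψ₀]; exact hp'))
  have heq : ∀ᶠ u in 𝓝 u₀.1, flowEq Z (u, ψ u) = 0 := by
    have := cd.eventually_apply_implicitFunction hn hinv
    rwa [hzero] at this
  -- invertibility of the partial derivative is an open condition
  have hcont : ContinuousAt (fun u => fderiv ℂ (flowEq Z) (u, ψ u) ∘L .inr ℂ _ _) u₀.1 := by
    have h1 : ContinuousAt (fderiv ℂ (flowEq Z)) (u₀.1, ψ u₀.1) := by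
      rw [hψ₀]; exact cd.continuousAt_fderiv hn
    exact ContinuousAt.clm_comp (ContinuousAt.comp (f := fun u => (u, ψ u)) h1
      (continuousAt_id.prodMk hψc.continuousAt)) continuousAt_const
  have hopen : ∀ᶠ u in 𝓝 u₀.1, (fderiv ℂ (flowEq Z) (u, ψ u) ∘L .inr ℂ _ _).IsInvertible := by
    have hnhds : Set.range ((↑) : (C(I, E) ≃L[ℂ] C(I, E)) → C(I, E) →L[ℂ] C(I, E)) ∈
        𝓝 (fderiv ℂ (flowEq Z) (u₀.1, ψ u₀.1) ∘L .inr ℂ _ _) := by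
      rw [hψ₀]
      obtain ⟨A, hA⟩ := hinv
      have hu : u₀ = (u₀.1, u₀.2) := rfl
      rw [← hu, ← hA]
      exact ContinuousLinearEquiv.nhds A
    exact hcont.eventually hnhds
  refine ⟨ψ, hψ₀, ?_⟩
  filter_upwards [hmem, hopen, heq.eventually_nhds, hc1] with u h1 h2 h3 h4
  refine ⟨?_, h1, h3.self_of_nhds, by rw [← key (u, ψ u) h1]; exact h2⟩
  -- near `u`, the function `ψ` is also the implicit function based at `(u, ψ u)`
  have cdu := contDiffAt_flowEq (u := (u, ψ u)) hS hZ h1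
  have huniq := cdu.eventually_apply_eq_iff_implicitFunction hn h2
  have htend : Filter.Tendsto (fun w => (w, ψ w)) (𝓝 u) (𝓝 (u, ψ u)) :=
    (continuousAt_id.prodMk h4.continuousAt)
  refine (cdu.contDiffAt_implicitFunction hn h2).congr_of_eventuallyEq ?_
  filter_upwards [htend.eventually huniq, h3] with w hw1 hw2
  exact (hw1.1 (hw2.trans h3.self_of_nhds.symm)).symm

/-- For commuting fields, the time-one flow satisfies `∂ψ(x,y)(1)/∂yᵢ = Zᵢ(ψ(x,y)(1))`: the curve
`t ↦ t Zᵢ(ψ t)` solves the linearised equation. -/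
lemma fderiv_flow_single (hS : IsOpen S) (hZ : ∀ i, ContDiffOn ℂ ∞ (Z i) S)
    (hcomm : ∀ i j, ∀ q ∈ S, fderiv ℂ (Z i) q (Z j q) = fderiv ℂ (Z j) q (Z i q))
    {ψ : E × (κ → ℂ) → C(I, E)} {u : E × (κ → ℂ)}
    (h : ∀ᶠ u in 𝓝 u, ContDiffAt ℂ ∞ ψ u ∧ (∀ t, ψ u t ∈ S) ∧
        flowEq Z (u, ψ u) = 0 ∧ (flowEqPartial Z (u, ψ u)).IsInvertible) [DecidableEq κ] (i : κ) :
    fderiv ℂ ψ u (0, Pi.single i 1) 1 = Z i (ψ u 1) := by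
  obtain ⟨hc, hmem, heq, hinv⟩ := h.self_of_nhds
  have hZ1 : ∀ i, ContDiffOn ℂ 1 (Z i) S := fun i => (hZ i).of_le (by simp)
  have hcont : ∀ i, Continuous fun t => Z i (ψ u t) := fun i =>
    (hZ i).continuousOn.comp_continuous (ψ u).continuous hmem
  have hDc : ∀ i, ContinuousOn (fderiv ℂ (Z i)) S :=
    fun i => (hZ1 i).continuousOn_fderiv_of_isOpen hS le_rfl
  have hDcont : ∀ i, Continuous fun t => fderiv ℂ (Z i) (ψ u t) := fun i =>
    (hDc i).comp_continuous (ψ u).continuous hmem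
  -- differentiate the equation
  have hd : HasFDerivAt (fun u => flowEq Z (u, ψ u))
      (flowEqDeriv Z (u, ψ u) ∘L ((ContinuousLinearMap.id ℂ _).prod (fderiv ℂ ψ u))) u :=
    HasFDerivAt.comp (f := fun u => (u, ψ u)) u (hasFDerivAt_flowEq (u := (u, ψ u)) hS hZ hmem)
      ((hasFDerivAt_id u).prodMk (hc.differentiableAt (by simp)).hasFDerivAt)
  have hd0 : HasFDerivAt (fun u => flowEq Z (u, ψ u)) 0 u :=
    (hasFDerivAt_const (𝕜 := ℂ) (0 : C(I, E)) u).congr_of_eventuallyEq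
      (h.mono fun w hw => hw.2.2.1)
  set e : E × (κ → ℂ) := (0, Pi.single i 1) with he
  set δ := fderiv ℂ ψ u e with hδ
  have hlin := DFunLike.congr_fun (hd.unique hd0) e
  set w : C(I, E) := ∑ j, u.2 j • superposition (Z j) (ψ u) with hw
  have hwt : ∀ t, w t = ∑ j, u.2 j • Z j (ψ u t) := fun t => by
    simp [hw, superposition_apply (hZ _).continuousOn hmem]
  set ζ : C(I, E) := ⟨fun t => (t : ℝ) • Z i (ψ u t), by
    exact continuous_subtype_val.smul (hcont i)⟩ with hζ
  set g : C(I, E) := ⟨fun t => Z i (ψ u t) + (t : ℝ) • fderiv ℂ (Z i) (ψ u t) (w t), by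
    have h1 := hcont i
    have h2 := (hDcont i).clm_apply w.continuous
    exact h1.add (continuous_subtype_val.smul h2)⟩ with hg
  have hx : ∀ t, ψ u t = u.1 + volterra E w t := by
    intro t
    have := DFunLike.congr_fun heq t
    simp only [flowEq, ContinuousMap.sub_apply, ContinuousMap.coe_zero, Pi.zero_apply] at this
    rw [sub_sub, sub_eq_zero] at this
    rw [this, hw]
    simp [map_sum, map_smul]
  have hζg : ζ = volterra E g := smul_comp_eq_volterra hS (hZ1 i) hmem hx (fun t => rfl)
    (fun t => rfl)
  have hgsum : g = superposition (Z i) (ψ u) + ∑ j, u.2 j •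
      pointwiseApply I E E (superposition (fderiv ℂ (Z j)) (ψ u)) ζ := by
    ext t
    simp only [hg, ContinuousMap.coe_mk, ContinuousMap.add_apply, ContinuousMap.sum_apply,
      ContinuousMap.smul_apply, pointwiseApply_apply,
      superposition_apply (hZ _).continuousOn hmem, superposition_apply (hDc _) hmem, hζ, hwt,
      map_sum, map_smul, Finset.smul_sum]
    congr 1
    refine Finset.sum_congr rfl fun j _ => ?_
    rw [hcomm i j _ (hmem t), ContinuousLinearMap.map_smul_of_tower, smul_comm]
  have hpart : flowEqPartial Z (u, ψ u) ζ = flowEqPartial Z (u, ψ u) δ := by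
    have h1 : flowEqPartial Z (u, ψ u) ζ = volterra E (superposition (Z i) (ψ u)) := by
      simp only [flowEqPartial, sub_apply, ContinuousLinearMap.id_apply,
        sum_apply, smul_apply,
        ContinuousLinearMap.comp_apply]
      conv_lhs => enter [1]; rw [hζg, hgsum]
      simp [map_add, map_sum, map_smul]
    have h2 : flowEqPartial Z (u, ψ u) δ = volterra E (superposition (Z i) (ψ u)) := by
      simp only [flowEqDeriv, ContinuousLinearMap.comp_apply, sub_apply,
        sum_apply, ContinuousLinearMap.smulRight_apply,
        ContinuousLinearMap.prod_apply, ContinuousLinearMap.coe_snd',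
        ContinuousLinearMap.coe_fst', zero_apply,
        ContinuousLinearMap.id_apply, ContinuousLinearMap.proj_apply] at hlin
      rw [sub_sub, sub_eq_zero] at hlin
      rw [hδ, hlin, he]
      simp [Pi.single_apply]
    rw [h1, h2]
  have hinj : Function.Injective (flowEqPartial Z (u, ψ u)) := by
    obtain ⟨A, hA⟩ := hinv
    rw [← hA]; exact A.injective
  rw [← hinj hpart]
  simp [hζ]

end Flow

/-! ### Straightening commuting vector fields -/

section Frobenius

open scoped unitInterval

universe u

variable {E : Type u} [NormedAddCommGroup E] [NormedSpace ℂ E] [FiniteDimensional ℂ E]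
  {κ : Type*} [Fintype κ]
  {F : Type*} [NormedAddCommGroup F] [NormedSpace ℂ F] [FiniteDimensional ℂ F]

/-- Linearly independent vectors extend to linear coordinates. -/
lemma exists_linear_coordinates {z : κ → E} (hz : LinearIndependent ℂ z)
    (hF : Module.finrank ℂ F + Fintype.card κ = Module.finrank ℂ E) :
    ∃ ι : F →L[ℂ] E, Function.Bijective (fun u : F × (κ → ℂ) => ι u.1 + ∑ i, u.2 i • z i) := by
  obtain ⟨C, hC⟩ := Submodule.exists_isCompl (Submodule.span ℂ (Set.range z))
  have h1 : Module.finrank ℂ (Submodule.span ℂ (Set.range z)) = Fintype.card κ := by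
    simpa using finrank_span_eq_card hz
  have h2 : Module.finrank ℂ F = Module.finrank ℂ C := by
    have := Submodule.finrank_add_eq_of_isCompl hC
    omega
  let e : F ≃ₗ[ℂ] C := LinearEquiv.ofFinrankEq F C h2
  refine ⟨LinearMap.toContinuousLinearMap (C.subtype ∘ₗ e.toLinearMap), ?_⟩
  let L : (F × (κ → ℂ)) →ₗ[ℂ] E :=
    (C.subtype ∘ₗ e.toLinearMap).coprod (Fintype.linearCombination ℂ z)
  have hL : ⇑L = (fun u : F × (κ → ℂ) =>
      LinearMap.toContinuousLinearMap (C.subtype ∘ₗ e.toLinearMap) u.1 + ∑ i, u.2 i • z i) := by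
    ext u
    simp [L, Fintype.linearCombination_apply]
  rw [← hL]
  have hinj : Function.Injective L := by
    rw [← LinearMap.ker_eq_bot, LinearMap.ker_eq_bot']
    rintro ⟨c, y⟩ hu
    simp only [L, LinearMap.coprod_apply, LinearMap.comp_apply, Fintype.linearCombination_apply,
      LinearEquiv.coe_coe, Submodule.subtype_apply] at hu
    have hmem : ∑ i, y i • z i ∈ Submodule.span ℂ (Set.range z) :=
      Submodule.sum_mem _ fun i _ => Submodule.smul_mem _ _ (Submodule.subset_span ⟨i, rfl⟩)
    have h0 : ((e c : C) : E) = 0 := by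
      refine Submodule.disjoint_def.1 hC.disjoint _ ?_ (e c).2
      rw [eq_neg_of_add_eq_zero_left hu]
      exact neg_mem hmem
    have hc : c = 0 := by simpa using h0
    have hy : ∀ i, y i = 0 := Fintype.linearIndependent_iff.1 hz y (by simpa [h0] using hu)
    ext1
    · exact hc
    · exact funext hy
  exact ⟨hinj, (LinearMap.injective_iff_surjective_of_finrank_eq_finrank (by simp [hF])).1 hinj⟩

/-- Holomorphic Frobenius theorem: commuting holomorphic vector fields that are linearly independent
at `p` are the last coordinate fields of a holomorphic coordinate system around `p`. -/
theorem exists_straightening [DecidableEq κ] {Z : κ → E → E} {S : Set E} (hS : IsOpen S)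
    (hZ : ∀ i, ContDiffOn ℂ ∞ (Z i) S)
    (hcomm : ∀ i j, ∀ q ∈ S, fderiv ℂ (Z i) q (Z j q) = fderiv ℂ (Z j) q (Z i q))
    {p : E} (hp : p ∈ S) (hlin : LinearIndependent ℂ (fun i => Z i p))
    (hF : Module.finrank ℂ F + Fintype.card κ = Module.finrank ℂ E) :
    ∃ θ : OpenPartialHomeomorph E (F × (κ → ℂ)), p ∈ θ.source ∧ θ.source ⊆ S ∧
      ContDiffOn ℂ ∞ θ θ.source ∧ ContDiffOn ℂ ∞ θ.symm θ.target ∧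
      ∀ q ∈ θ.source, ∀ i, fderiv ℂ θ q (Z i q) = (0, Pi.single i 1) := by
  have : CompleteSpace E := FiniteDimensional.complete ℂ E
  have : CompleteSpace F := FiniteDimensional.complete ℂ F
  obtain ⟨ψ, hψ₀, hψ⟩ := exists_smooth_flow hS hZ hp
  obtain ⟨ι, hι⟩ := exists_linear_coordinates hlin hF
  -- `(c, y) ↦ (p + ι c, y)` followed by the time-one flow parametrises a neighbourhood of `p`
  set j : F × (κ → ℂ) → E × (κ → ℂ) := fun u => (p + ι u.1, u.2) with hj
  have hj0 : j 0 = (p, 0) := by simp [hj]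
  have hjc : ContDiff ℂ ∞ j := by fun_prop
  set j' : (F × (κ → ℂ)) →L[ℂ] E × (κ → ℂ) := ι.prodMap (.id ℂ _) with hj'
  have hjd : ∀ u, HasFDerivAt j j' u := fun u =>
    ((ι.hasFDerivAt.comp u hasFDerivAt_fst).const_add p).prodMk hasFDerivAt_snd
  let ev : C(I, E) →L[ℂ] E := ContinuousMap.evalCLM ℂ 1
  set Ψ : F × (κ → ℂ) → E := fun u => ψ (j u) 1 with hΨ
  have hΨev : Ψ = ev ∘ ψ ∘ j := rfl
  have hev : ∀ᶠ u in 𝓝 (0 : F × (κ → ℂ)), ∀ᶠ w in 𝓝 (j u), ContDiffAt ℂ ∞ ψ w ∧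
      (∀ t, ψ w t ∈ S) ∧ flowEq Z (w, ψ w) = 0 ∧ (flowEqPartial Z (w, ψ w)).IsInvertible :=
    hjc.continuous.continuousAt.eventually (by rw [hj0]; exact hψ.eventually_nhds)
  have hΨc : ∀ᶠ u in 𝓝 (0 : F × (κ → ℂ)), ContDiffAt ℂ ∞ Ψ u := by
    filter_upwards [hev] with u hu
    exact ev.contDiff.contDiffAt.comp u (hu.self_of_nhds.1.comp u hjc.contDiffAt)
  have hΨd : ∀ᶠ u in 𝓝 (0 : F × (κ → ℂ)), ∀ i,
      fderiv ℂ Ψ u (0, Pi.single i 1) = Z i (Ψ u) := by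
    filter_upwards [hev] with u hu i
    have h1 : HasFDerivAt Ψ (ev ∘L fderiv ℂ ψ (j u) ∘L j') u :=
      ev.hasFDerivAt.comp u (((hu.self_of_nhds.1.differentiableAt (by simp)).hasFDerivAt).comp u
        (hjd u))
    rw [h1.fderiv]
    have h2 := fderiv_flow_single hS hZ hcomm hu i
    simpa [hj', ev] using h2
  have hΨ0 : Ψ 0 = p := by simp only [hΨ, hj0, hψ₀]; rfl
  -- the derivative at the origin
  have hD0 : ∀ u, fderiv ℂ Ψ 0 u = ι u.1 + ∑ i, u.2 i • Z i p := by
    have hfst : ∀ c : F, fderiv ℂ Ψ 0 (c, 0) = ι c := by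
      intro c
      have hu := hev.self_of_nhds
      rw [hj0] at hu
      obtain ⟨hc, hmem, -, -⟩ := hu.self_of_nhds
      have h1 : HasFDerivAt Ψ (ev ∘L fderiv ℂ ψ (j 0) ∘L j') 0 :=
        ev.hasFDerivAt.comp 0 ((by rw [hj0]; exact
          (hc.differentiableAt (by simp)).hasFDerivAt : HasFDerivAt ψ (fderiv ℂ ψ (j 0)) (j 0)).comp
          0 (hjd 0))
      rw [h1.fderiv]
      have hd : HasFDerivAt (fun u => flowEq Z (u, ψ u))
          (flowEqDeriv Z ((p, 0), ψ (p, 0)) ∘L ((ContinuousLinearMap.id ℂ _).prod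
            (fderiv ℂ ψ (p, 0)))) (p, 0) :=
        HasFDerivAt.comp (f := fun u => (u, ψ u)) (p, 0)
          (hasFDerivAt_flowEq (u := ((p, 0), ψ (p, 0))) hS hZ hmem)
          ((hasFDerivAt_id _).prodMk (hc.differentiableAt (by simp)).hasFDerivAt)
      have hd0 : HasFDerivAt (fun u => flowEq Z (u, ψ u)) 0 (p, 0) :=
        (hasFDerivAt_const (𝕜 := ℂ) (0 : C(I, E)) _).congr_of_eventuallyEq
          (hu.mono fun w hw => hw.2.2.1)
      have hlin := DFunLike.congr_fun (DFunLike.congr_fun (hd.unique hd0) (ι c, 0)) 1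
      simp only [hj0]
      simpa [flowEqDeriv, flowEqPartial, hj', ev, sub_eq_zero] using hlin
    intro u
    have hu : u = (u.1, 0) + ∑ i, u.2 i • ((0 : F), (Pi.single i 1 : κ → ℂ)) := by
      ext1
      · simp [Prod.fst_sum]
      · ext l
        simp [Prod.snd_sum, Finset.sum_apply, Pi.single_apply]
    conv_lhs => rw [hu]
    simp only [map_add, map_sum, map_smul, hfst, hΨd.self_of_nhds, hΨ0]
  have hΨc0 := hΨc.self_of_nhds
  have hbij : Function.Bijective (fderiv ℂ Ψ 0) := by
    have : ⇑(fderiv ℂ Ψ 0) = fun u : F × (κ → ℂ) => ι u.1 + ∑ i, u.2 i • Z i p := funext hD0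
    rw [this]; exact hι
  let A : (F × (κ → ℂ)) ≃L[ℂ] E :=
    (LinearEquiv.ofBijective (fderiv ℂ Ψ 0).toLinearMap hbij).toContinuousLinearEquiv
  have hA : HasFDerivAt Ψ (A : (F × (κ → ℂ)) →L[ℂ] E) 0 := by
    refine (hΨc0.differentiableAt (by simp)).hasFDerivAt.congr_fderiv ?_
    ext <;> rfl
  have hinv : ∀ᶠ u in 𝓝 (0 : F × (κ → ℂ)), (fderiv ℂ Ψ u).IsInvertible := by
    refine (hΨc0.continuousAt_fderiv (by simp)).eventually ?_
    rw [hA.fderiv]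
    exact ContinuousLinearEquiv.nhds A
  set Λ := hΨc0.toOpenPartialHomeomorph Ψ hA (by simp) with hΛ
  have hΛc : ⇑Λ = Ψ := rfl
  have hmemS : ∀ᶠ u in 𝓝 (0 : F × (κ → ℂ)), Ψ u ∈ S :=
    hev.mono fun u hu => hu.self_of_nhds.2.1 1
  obtain ⟨T, hT, hTo, hT0⟩ := eventually_nhds_iff.1 (hΨc.and (hΨd.and (hinv.and hmemS)))
  have hsrc : (0 : F × (κ → ℂ)) ∈ Λ.source :=
    hΨc0.mem_toOpenPartialHomeomorph_source hA (by simp)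
  set Λ' := Λ.restrOpen T hTo with hΛ'
  have hΛ'c : ⇑Λ' = Ψ := rfl
  have hΛ's : Λ'.source = Λ.source ∩ T := by simp [hΛ']
  have hsymm : ∀ q ∈ Λ'.target, ContDiffAt ℂ ∞ Λ'.symm q ∧
      ∀ i, fderiv ℂ Λ'.symm q (Z i q) = (0, Pi.single i 1) := by
    intro q hq
    have hu : Λ'.symm q ∈ T := (hΛ's ▸ Λ'.map_target hq).2
    obtain ⟨h1, h2, ⟨B, hB⟩, -⟩ := hT _ hu
    have hB' : HasFDerivAt Λ' (B : (F × (κ → ℂ)) →L[ℂ] E) (Λ'.symm q) := by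
      rw [hB]; exact (h1.differentiableAt (by simp)).hasFDerivAt
    refine ⟨Λ'.contDiffAt_symm hq hB' h1, fun i => ?_⟩
    rw [(Λ'.hasFDerivAt_symm hq hB').fderiv]
    have h3 := h2 i
    have h4 : Ψ (Λ'.symm q) = q := Λ'.right_inv hq
    rw [h4, ← hB] at h3
    rw [← h3]
    simp
  refine ⟨Λ'.symm, ?_, ?_, ?_, ?_, fun q hq i => (hsymm q hq).2 i⟩
  · have := Λ'.map_source (x := 0) (by rw [hΛ's]; exact ⟨hsrc, hT0⟩)
    rw [hΛ'c, hΨ0] at this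
    exact this
  · intro q hq
    have hu : Λ'.symm q ∈ T := (hΛ's ▸ Λ'.map_target hq).2
    have h4 : Ψ (Λ'.symm q) = q := Λ'.right_inv hq
    rw [← h4]
    exact (hT _ hu).2.2.2
  · exact fun q hq => (hsymm q hq).1.contDiffWithinAt
  · intro u hu
    have hu' : u ∈ Λ'.source := by simpa using hu
    rw [hΛ's] at hu'
    exact (hT _ hu'.2).1.contDiffWithinAt

end Frobenius

/-! ### The real manifold underlying a complex manifold -/

section RealUnderlying

variable {E : Type*} [NormedAddCommGroup E] [NormedSpace ℂ E]
  {M : Type*} [TopologicalSpace M] [ChartedSpace E M]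
  {E' : Type*} [NormedAddCommGroup E'] [NormedSpace ℂ E']
  {M' : Type*} [TopologicalSpace M'] [ChartedSpace E' M']
  {E'' : Type*} [NormedAddCommGroup E''] [NormedSpace ℂ E'']
  {M'' : Type*} [TopologicalSpace M''] [ChartedSpace E'' M'']

/-- Holomorphic maps are smooth as maps of real manifolds. -/
lemma ContMDiffAt.real_of_complex {f : M → M'} {p : M}
    (hf : ContMDiffAt 𝓘(ℂ, E) 𝓘(ℂ, E') ∞ f p) : ContMDiffAt 𝓘(ℝ, E) 𝓘(ℝ, E') ∞ f p := by
  rw [contMDiffAt_iff] at hf ⊢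
  exact ⟨hf.1, hf.2.restrict_scalars ℝ⟩

lemma MDifferentiableAt.hasMFDerivAt_real {f : M → M'} {p : M}
    (hf : MDifferentiableAt 𝓘(ℂ, E) 𝓘(ℂ, E') f p) :
    HasMFDerivAt 𝓘(ℝ, E) 𝓘(ℝ, E') f p
      ((mfderiv 𝓘(ℂ, E) 𝓘(ℂ, E') f p : E →L[ℂ] E').restrictScalars ℝ : E →L[ℝ] E') := by
  have h := hf.hasMFDerivAt
  exact ⟨h.1, h.2.restrictScalars ℝ⟩

lemma rderiv_eq_restrictScalars {f : M → M'} {p : M}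
    (hf : MDifferentiableAt 𝓘(ℂ, E) 𝓘(ℂ, E') f p) :
    rderiv (E := E) (E' := E') f p =
      ((mfderiv 𝓘(ℂ, E) 𝓘(ℂ, E') f p : E →L[ℂ] E').restrictScalars ℝ : E →L[ℝ] E') :=
  hf.hasMFDerivAt_real.mfderiv

/-- The differential of a holomorphic map commutes with the complex structures. -/
lemma rderiv_cJ {f : M → M'} {p : M}
    (hf : MDifferentiableAt 𝓘(ℂ, E) 𝓘(ℂ, E') f p) (v : RTangent E p) :
    rderiv (E' := E') f p (cJ E p v) = cJ E' (f p) (rderiv (E' := E') f p v) := by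
  rw [rderiv_eq_restrictScalars hf]
  exact (mfderiv 𝓘(ℂ, E) 𝓘(ℂ, E') f p : E →L[ℂ] E').map_smul Complex.I v

@[simp] lemma cJ_cJ (p : M) (v : RTangent E p) : cJ E p (cJ E p v) = -v := by
  have h : ∀ w : E, Complex.I • Complex.I • w = -w := fun w => by
    rw [smul_smul, Complex.I_mul_I, neg_one_smul]
  exact h v

lemma rderiv_comp {g : M' → M''} {f : M → M'} {p : M}
    (hg : MDifferentiableAt 𝓘(ℝ, E') 𝓘(ℝ, E'') g (f p))
    (hf : MDifferentiableAt 𝓘(ℝ, E) 𝓘(ℝ, E') f p) (v : RTangent E p) :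
    rderiv (E' := E'') (g ∘ f) p v = rderiv (E' := E'') g (f p) (rderiv (E' := E') f p v) := by
  rw [rderiv, mfderiv_comp p hg hf]
  rfl

lemma rderiv_eq_fderiv (f : E → E') (p : E) :
    rderiv (E := E) (E' := E') f p = fderiv ℝ f p := by
  rw [rderiv, mfderiv_eq_fderiv]

variable [IsManifold 𝓘(ℂ, E) ∞ M]

lemma contMDiffAt_chartAt_complex {p₀ q : M} (hq : q ∈ (chartAt E p₀).source) :
    ContMDiffAt 𝓘(ℂ, E) 𝓘(ℂ, E) ∞ (chartAt E p₀) q :=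
  (contMDiffOn_chart (I := 𝓘(ℂ, E)) (x := p₀)).contMDiffAt ((chartAt E p₀).open_source.mem_nhds hq)

lemma contMDiffAt_chartAt_symm_complex {p₀ : M} {y : E} (hy : y ∈ (chartAt E p₀).target) :
    ContMDiffAt 𝓘(ℂ, E) 𝓘(ℂ, E) ∞ (chartAt E p₀).symm y :=
  (contMDiffOn_chart_symm (I := 𝓘(ℂ, E)) (x := p₀)).contMDiffAt
    ((chartAt E p₀).open_target.mem_nhds hy)

lemma chartAt_mdifferentiable_real (p₀ : M) :
    (chartAt E p₀).MDifferentiable 𝓘(ℝ, E) 𝓘(ℝ, E) :=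
  ⟨fun q hq => ((contMDiffAt_chartAt_complex hq).real_of_complex.mdifferentiableAt
      (by simp)).mdifferentiableWithinAt,
    fun y hy => ((contMDiffAt_chartAt_symm_complex hy).real_of_complex.mdifferentiableAt
      (by simp)).mdifferentiableWithinAt⟩

/-- The coordinate expression of a vector field in the preferred chart at `p₀`. -/
noncomputable def fieldInChart (X : VField E M) (p₀ : M) (y : E) : E :=
  rderiv (E' := E) (chartAt E p₀) ((chartAt E p₀).symm y) (X ((chartAt E p₀).symm y))

lemma rderiv_chart_rderiv_symm {p₀ : M} {y : E} (hy : y ∈ (chartAt E p₀).target) (v : E) :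
    rderiv (E' := E) (chartAt E p₀) ((chartAt E p₀).symm y)
      (rderiv (E := E) (E' := E) (chartAt E p₀).symm y v) = v :=
  DFunLike.congr_fun ((chartAt_mdifferentiable_real p₀).comp_symm_deriv hy) v

lemma rderiv_symm_rderiv_chart {p₀ : M} {y : E} (hy : y ∈ (chartAt E p₀).target)
    (v : RTangent E ((chartAt E p₀).symm y)) :
    rderiv (E := E) (E' := E) (chartAt E p₀).symm y
      (rderiv (E' := E) (chartAt E p₀) ((chartAt E p₀).symm y) v) = v := by
  have h := (chartAt_mdifferentiable_real p₀).symm_comp_deriv ((chartAt E p₀).map_target hy)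
  rw [(chartAt E p₀).right_inv hy] at h
  exact DFunLike.congr_fun h v

lemma rderiv_symm_fieldInChart {X : VField E M} {p₀ : M} {y : E} (hy : y ∈ (chartAt E p₀).target) :
    rderiv (E := E) (E' := E) (chartAt E p₀).symm y (fieldInChart (E := E) (M := M) X p₀ y) =
      X ((chartAt E p₀).symm y) := rderiv_symm_rderiv_chart hy _

lemma isInvertible_rderiv_symm {p₀ : M} {y : E} (hy : y ∈ (chartAt E p₀).target) :
    (mfderiv 𝓘(ℝ, E) 𝓘(ℝ, E) (chartAt E p₀).symm y).IsInvertible :=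
  ContinuousLinearMap.IsInvertible.of_inverse
    (g := mfderiv 𝓘(ℝ, E) 𝓘(ℝ, E) (chartAt E p₀) ((chartAt E p₀).symm y))
    (ContinuousLinearMap.ext fun v => rderiv_symm_rderiv_chart hy v)
    (ContinuousLinearMap.ext fun v => rderiv_chart_rderiv_symm hy v)

lemma inverse_rderiv_symm {p₀ : M} {y : E} (hy : y ∈ (chartAt E p₀).target)
    (v : RTangent E ((chartAt E p₀).symm y)) :
    (mfderiv 𝓘(ℝ, E) 𝓘(ℝ, E) (chartAt E p₀).symm y).inverse v =
      rderiv (E' := E) (chartAt E p₀) ((chartAt E p₀).symm y) v := by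
  have h : (mfderiv 𝓘(ℝ, E) 𝓘(ℝ, E) (chartAt E p₀).symm y).inverse =
      mfderiv 𝓘(ℝ, E) 𝓘(ℝ, E) (chartAt E p₀) ((chartAt E p₀).symm y) :=
    ContinuousLinearMap.inverse_eq
      (ContinuousLinearMap.ext fun v => rderiv_symm_rderiv_chart hy v)
      (ContinuousLinearMap.ext fun v => rderiv_chart_rderiv_symm hy v)
  rw [h]; rfl

lemma mpullback_eq_fieldInChart (X : VField E M) {p₀ : M} {y : E}
    (hy : y ∈ (chartAt E p₀).target) :
    VectorField.mpullback 𝓘(ℝ, E) 𝓘(ℝ, E) (chartAt E p₀).symm X y = fieldInChart X p₀ y :=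
  inverse_rderiv_symm hy _

end RealUnderlying

/-! ### Real smooth maps with complex linear derivative -/

section ComplexSmooth

lemma minSmoothness_two_le_infty : minSmoothness ℝ 2 ≤ (∞ : ℕ∞ω) := by
  rw [minSmoothness_of_isRCLikeNormedField]
  exact WithTop.coe_le_coe.2 (le_top : (2 : ℕ∞) ≤ ⊤)

variable {E : Type*} [NormedAddCommGroup E] [NormedSpace ℂ E] [FiniteDimensional ℂ E]
  {F : Type*} [NormedAddCommGroup F] [NormedSpace ℂ F]

lemma complex_smul_eq (c : ℂ) (v : F) : c • v = c.re • v + c.im • Complex.I • v := by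
  conv_lhs => rw [← Complex.re_add_im c]
  rw [add_smul, mul_smul, Complex.coe_smul, Complex.coe_smul]

lemma differentiableAt_complex_of_real {f : E → F} {x : E} (hf : DifferentiableAt ℝ f x)
    (hI : ∀ v, fderiv ℝ f x (Complex.I • v) = Complex.I • fderiv ℝ f x v) :
    DifferentiableAt ℂ f x ∧ ∀ v, fderiv ℂ f x v = fderiv ℝ f x v := by
  let L : E →L[ℂ] F :=
    { toFun := fderiv ℝ f x
      map_add' := map_add _
      map_smul' := fun c v => by
        rw [complex_smul_eq c v, map_add, map_smul, map_smul, hI, RingHom.id_apply,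
          complex_smul_eq c (fderiv ℝ f x v)]
      cont := (fderiv ℝ f x).continuous }
  have h : HasFDerivAt f L x := hasFDerivAt_of_restrictScalars ℝ hf.hasFDerivAt rfl
  exact ⟨h.differentiableAt, fun v => by rw [h.fderiv]; rfl⟩

/-- A real smooth map with complex linear derivative is complex smooth. By the symmetry of the second
derivative, the directional derivatives again have complex linear derivative, so one can induct. -/
lemma contDiffOn_complex_of_real {S : Set E} (hS : IsOpen S) {f : E → F}
    (hf : ContDiffOn ℝ ∞ f S)
    (hI : ∀ x ∈ S, ∀ v, fderiv ℝ f x (Complex.I • v) = Complex.I • fderiv ℝ f x v) :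
    ContDiffOn ℂ ∞ f S := by
  rw [contDiffOn_infty]
  intro k
  induction k generalizing f with
  | zero =>
    rw [Nat.cast_zero, contDiffOn_zero]
    exact hf.continuousOn
  | succ k ih =>
    have hd : ∀ x ∈ S, DifferentiableAt ℝ f x := fun x hx =>
      (hf.differentiableOn (by simp)).differentiableAt (hS.mem_nhds hx)
    push_cast
    rw [contDiffOn_succ_iff_fderiv_apply hS.uniqueDiffOn]
    refine ⟨fun x hx =>
      (differentiableAt_complex_of_real (hd x hx) (hI x hx)).1.differentiableWithinAt, by simp,
      fun v => ?_⟩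
    have hf' : ContDiffOn ℝ ∞ (fderiv ℝ f) S := ((contDiffOn_infty_iff_fderiv_of_isOpen hS).1 hf).2
    have hd' : ∀ x ∈ S, DifferentiableAt ℝ (fderiv ℝ f) x := fun x hx =>
      (hf'.differentiableOn (by simp)).differentiableAt (hS.mem_nhds hx)
    have happ : ∀ v, ∀ x ∈ S, ∀ w,
        fderiv ℝ (fun x => fderiv ℝ f x v) x w = fderiv ℝ (fderiv ℝ f) x w v := by
      intro v x hx w
      rw [fderiv_clm_apply (hd' x hx) (differentiableAt_const v)]
      simp
    refine (ih (f := fun x => fderiv ℝ f x v) (hf'.clm_apply contDiffOn_const) ?_).congr ?_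
    · intro x hx w
      have hsymm : IsSymmSndFDerivAt ℝ f x :=
        (hf.contDiffAt (hS.mem_nhds hx)).isSymmSndFDerivAt minSmoothness_two_le_infty
      rw [happ v x hx, happ v x hx, hsymm.eq, hsymm.eq w v, ← happ _ x hx, ← happ _ x hx]
      have hev : (fun x => fderiv ℝ f x (Complex.I • w)) =ᶠ[𝓝 x]
          fun x => Complex.I • fderiv ℝ f x w := by
        filter_upwards [hS.mem_nhds hx] with y hy using hI y hy w
      rw [hev.fderiv_eq]
      have h2 : DifferentiableAt ℝ (fun x => fderiv ℝ f x w) x :=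
        (hd' x hx).clm_apply (differentiableAt_const w)
      rw [fderiv_fun_const_smul h2]
      rfl
    · intro x hx
      rw [fderivWithin_of_isOpen hS hx]
      exact (differentiableAt_complex_of_real (hd x hx) (hI x hx)).2 v

end ComplexSmooth

/-! ### Differential 2-forms on vector spaces -/

section TwoForms

variable {E : Type*} [NormedAddCommGroup E] [NormedSpace ℝ E]
  {F : Type*} [NormedAddCommGroup F] [NormedSpace ℝ F]
  {G : Type*} [NormedAddCommGroup G] [NormedSpace ℝ G]

/-- An alternating `2`-form as a bilinear form. -/
noncomputable def toBilin (E : Type*) [NormedAddCommGroup E] [NormedSpace ℝ E] :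
    (E [⋀^Fin 2]→L[ℝ] ℝ) →L[ℝ] E →L[ℝ] E →L[ℝ] ℝ :=
  (ContinuousLinearMap.compL ℝ E (E [⋀^Fin 1]→L[ℝ] ℝ) (E →L[ℝ] ℝ)
    ((ContinuousAlternatingMap.ofSubsingletonLIE (𝕜 := ℝ) (E := E) (F := ℝ)
      (i := (0 : Fin 1))).symm.toContinuousLinearEquiv :
      (E [⋀^Fin 1]→L[ℝ] ℝ) →L[ℝ] (E →L[ℝ] ℝ))) ∘L
  (ContinuousAlternatingMap.curryLeftLI (𝕜 := ℝ) (E := E) (F := ℝ) (n := 1)).toContinuousLinearMap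

lemma contDiff_toBilin {n : ℕ∞ω} :
    ContDiff ℝ n (fun η : E [⋀^Fin 2]→L[ℝ] ℝ => toBilin E η) := by
  fun_prop

lemma hasFDerivAt_toBilin (η : E [⋀^Fin 2]→L[ℝ] ℝ) :
    HasFDerivAt (fun η : E [⋀^Fin 2]→L[ℝ] ℝ => toBilin E η) (toBilin E) η :=
  ContinuousLinearMap.hasFDerivAt (F := E →L[ℝ] E →L[ℝ] ℝ) (toBilin E)

lemma contDiff_flip {n : ℕ∞ω} :
    ContDiff ℝ n (fun B : E →L[ℝ] F →L[ℝ] G => ContinuousLinearMap.flip B) := by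
  let L : (E →L[ℝ] F →L[ℝ] G) →L[ℝ] (F →L[ℝ] E →L[ℝ] G) :=
    ((ContinuousLinearMap.flipₗᵢ ℝ E F G).toContinuousLinearEquiv :)
  have : ContDiff ℝ n (fun B => L B) := by fun_prop
  exact this

lemma toBilin_apply (η : E [⋀^Fin 2]→L[ℝ] ℝ) (u v : E) : toBilin E η u v = η ![u, v] := by
  change η (Matrix.vecCons u fun _ => v) = _
  congr 1
  ext i; fin_cases i <;> rfl

/-- The antisymmetrisation `B(u,v) - B(v,u)` of a bilinear form. -/
noncomputable def antisymmetrize (E : Type*) [NormedAddCommGroup E] [NormedSpace ℝ E] :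
    (E →L[ℝ] E →L[ℝ] ℝ) →L[ℝ] E [⋀^Fin 2]→L[ℝ] ℝ :=
  ContinuousAlternatingMap.alternatizeUncurryFinCLM (n := 1) ℝ E ℝ ∘L
  (ContinuousLinearMap.compL ℝ E (E →L[ℝ] ℝ) (E [⋀^Fin 1]→L[ℝ] ℝ)
    ((ContinuousAlternatingMap.ofSubsingletonLIE (𝕜 := ℝ) (E := E) (F := ℝ)
      (i := (0 : Fin 1))).toContinuousLinearEquiv :
       (E →L[ℝ] ℝ) →L[ℝ] (E [⋀^Fin 1]→L[ℝ] ℝ)))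

lemma contDiff_antisymmetrize {n : ℕ∞ω} :
    ContDiff ℝ n (fun B : E →L[ℝ] E →L[ℝ] ℝ => antisymmetrize E B) := by
  fun_prop

lemma antisymmetrize_apply (B : E →L[ℝ] E →L[ℝ] ℝ) (v : Fin 2 → E) :
    antisymmetrize E B v = B (v 0) (v 1) - B (v 1) (v 0) := by
  simp [antisymmetrize, ContinuousAlternatingMap.alternatizeUncurryFin_apply, Fin.sum_univ_two,
    sub_eq_add_neg, Fin.removeNth]

lemma two_form_swap (η : E [⋀^Fin 2]→L[ℝ] ℝ) (u v : E) : η ![u, v] = - η ![v, u] := by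
  have h : η (![u, v] ∘ Equiv.swap (0 : Fin 2) 1) = - η ![u, v] :=
    η.map_swap ![u, v] (i := 0) (j := 1) (by decide)
  have h2 : (![u, v] ∘ Equiv.swap (0 : Fin 2) 1) = ![v, u] := by ext i; fin_cases i <;> rfl
  rw [h2] at h
  rw [h, neg_neg]

/-- Pulling back `2`-forms is smooth in the form and in the linear map. -/
lemma ContDiffAt.compContinuousLinearMap_two {η : G → F [⋀^Fin 2]→L[ℝ] ℝ} {A : G → E →L[ℝ] F}
    {x : G} {n : ℕ∞ω} (hη : ContDiffAt ℝ n η x) (hA : ContDiffAt ℝ n A x) :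
    ContDiffAt ℝ n (fun y => (η y).compContinuousLinearMap (A y)) x := by
  -- bilinear forms are pulled back by linear operations, and `η` is half the antisymmetrisation
  -- of its own bilinear form
  have key : (fun y => (η y).compContinuousLinearMap (A y)) = fun y => (1 / 2 : ℝ) •
      antisymmetrize E ((ContinuousLinearMap.flip
        ((ContinuousLinearMap.flip (toBilin F (η y) ∘L A y)) ∘L A y))) := by
    ext y v
    simp only [ContinuousAlternatingMap.compContinuousLinearMap_apply,
      ContinuousAlternatingMap.smul_apply, antisymmetrize_apply, ContinuousLinearMap.flip_apply,
      ContinuousLinearMap.comp_apply, toBilin_apply]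
    rw [two_form_swap (η y) (A y (v 1))]
    have : (A y ∘ v) = ![A y (v 0), A y (v 1)] := by ext i; fin_cases i <;> rfl
    rw [this, smul_eq_mul]; ring
  rw [key]
  have h0 : ContDiffAt ℝ n (fun y => toBilin F (η y)) x :=
    contDiff_toBilin.contDiffAt.comp x hη
  have h1 : ContDiffAt ℝ n (fun y => toBilin F (η y) ∘L A y) x := h0.clm_comp hA
  have h2 : ContDiffAt ℝ n (fun y => ContinuousLinearMap.flip (toBilin F (η y) ∘L A y)) x :=
    contDiff_flip.contDiffAt.comp x h1
  have h3 : ContDiffAt ℝ n (fun y => ContinuousLinearMap.flip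
      (ContinuousLinearMap.flip (toBilin F (η y) ∘L A y) ∘L A y)) x :=
    contDiff_flip.contDiffAt.comp x
      (h2.clm_comp hA)
  exact ContDiffAt.const_smul (1 / 2 : ℝ) (contDiff_antisymmetrize.contDiffAt.comp x h3)

lemma two_form_zero_right (η : E [⋀^Fin 2]→L[ℝ] ℝ) (u : E) : η ![u, 0] = 0 := by
  rw [← toBilin_apply, map_zero]

lemma fderiv_two_form_apply {η : E → E [⋀^Fin 2]→L[ℝ] ℝ} {a b : E → E} {y : E}
    (hη : DifferentiableAt ℝ η y) (ha : DifferentiableAt ℝ a y) (hb : DifferentiableAt ℝ b y)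
    (w : E) :
    fderiv ℝ (fun z => η z ![a z, b z]) y w =
      fderiv ℝ η y w ![a y, b y] + η y ![fderiv ℝ a y w, b y] + η y ![a y, fderiv ℝ b y w] := by
  have h0 : HasFDerivAt (fun z => toBilin E (η z)) (toBilin E ∘L fderiv ℝ η y) y :=
    HasFDerivAt.comp (g := fun ξ => toBilin E ξ) (f := η) y (hasFDerivAt_toBilin (η y)) hη.hasFDerivAt
  have h1 : HasFDerivAt (fun z => toBilin E (η z) (a z)) _ y := h0.clm_apply ha.hasFDerivAt
  have h := h1.clm_apply hb.hasFDerivAt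
  have : (fun z => η z ![a z, b z]) = fun z => toBilin E (η z) (a z) (b z) := by
    ext z; simp [toBilin_apply]
  rw [this, h.fderiv]
  simp [toBilin_apply]
  ring

lemma extDeriv_two_form_apply {η : E → E [⋀^Fin 2]→L[ℝ] ℝ} {y : E}
    (hη : DifferentiableAt ℝ η y) (a b c : E) :
    extDeriv η y ![a, b, c] =
      fderiv ℝ η y a ![b, c] - fderiv ℝ η y b ![a, c] + fderiv ℝ η y c ![a, b] := by
  rw [extDeriv_apply hη, Fin.sum_univ_three]
  have h0 : (0 : Fin 3).removeNth ![a, b, c] = ![b, c] := by ext i; fin_cases i <;> rfl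
  have h1 : (1 : Fin 3).removeNth ![a, b, c] = ![a, c] := by ext i; fin_cases i <;> rfl
  have h2 : (2 : Fin 3).removeNth ![a, b, c] = ![a, b] := by ext i; fin_cases i <;> rfl
  rw [h0, h1, h2]
  simp only [fderiv_continuousAlternatingMap_apply_const_apply hη]
  simp
  ring

/-- A Hamiltonian field preserves the symplectic form: `L_X η = 0`, because `dη = 0` and the second
derivative of the Hamiltonian is symmetric. -/
lemma lie_form_eq_zero {η : E → E [⋀^Fin 2]→L[ℝ] ℝ} {S : Set E} (hS : IsOpen S)
    {X : E → E} {h : E → ℝ} {y : E} (hy : y ∈ S) (hη : DifferentiableAt ℝ η y)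
    (hclosed : extDeriv η y = 0) (hX : DifferentiableAt ℝ X y) (hh : ContDiffOn ℝ ∞ h S)
    (heq : ∀ z ∈ S, ∀ v, - η z ![X z, v] = fderiv ℝ h z v) (u v : E) :
    fderiv ℝ η y (X y) ![u, v] + η y ![fderiv ℝ X y u, v] + η y ![u, fderiv ℝ X y v] = 0 := by
  have hh' : DifferentiableAt ℝ (fderiv ℝ h) y :=
    ((((contDiffOn_infty_iff_fderiv_of_isOpen hS).1 hh).2).differentiableOn
      (by simp)).differentiableAt (hS.mem_nhds hy)
  have hsymm : IsSymmSndFDerivAt ℝ h y :=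
    (hh.contDiffAt (hS.mem_nhds hy)).isSymmSndFDerivAt minSmoothness_two_le_infty
  have key : ∀ v w, fderiv ℝ (fderiv ℝ h) y w v =
      -(fderiv ℝ η y w ![X y, v] + η y ![fderiv ℝ X y w, v]) := by
    intro v w
    have h1 : fderiv ℝ (fun z => fderiv ℝ h z v) y w = fderiv ℝ (fderiv ℝ h) y w v := by
      rw [fderiv_clm_apply hh' (differentiableAt_const v)]
      simp
    have h2 : (fun z => fderiv ℝ h z v) =ᶠ[𝓝 y] fun z => -(η z ![X z, v]) := by
      filter_upwards [hS.mem_nhds hy] with z hz using (heq z hz v).symm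
    rw [← h1, h2.fderiv_eq, fderiv_fun_neg, neg_apply,
      fderiv_two_form_apply hη hX (differentiableAt_const v)]
    simp [two_form_zero_right]
  have hs := hsymm u v
  rw [key, key] at hs
  have hd := extDeriv_two_form_apply hη (X y) u v
  rw [hclosed] at hd
  have hsw := two_form_swap (η y) u (fderiv ℝ X y v)
  have h0 : (0 : E [⋀^Fin 3]→L[ℝ] ℝ) ![X y, u, v] = 0 := rfl
  have hd' := h0.symm.trans hd
  linarith

end TwoForms

/-! ### Killing Hamiltonian vector fields are holomorphic -/

section FieldsInCharts

variable {E : Type*} [NormedAddCommGroup E] [NormedSpace ℂ E] [FiniteDimensional ℂ E]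
  {M : Type*} [TopologicalSpace M] [ChartedSpace E M] [IsManifold 𝓘(ℂ, E) ∞ M]

lemma TwoForm.inChart_apply (Ω : TwoForm E M) (p₀ : M) (z : E) (u v : E) :
    Ω.inChart p₀ z ![u, v] = Ω ((chartAt E p₀).symm z)
      ![rderiv (E := E) (E' := E) (chartAt E p₀).symm z u,
        rderiv (E := E) (E' := E) (chartAt E p₀).symm z v] := by
  change Ω ((chartAt E p₀).symm z) _ = _
  congr 1
  ext i; fin_cases i <;> rfl

lemma rderiv_symm_cJ {p₀ : M} {y : E} (hy : y ∈ (chartAt E p₀).target) (v : E) :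
    rderiv (E := E) (E' := E) (chartAt E p₀).symm y (Complex.I • v : E) =
      cJ E _ (rderiv (E := E) (E' := E) (chartAt E p₀).symm y v) :=
  rderiv_cJ ((contMDiffAt_chartAt_symm_complex hy).mdifferentiableAt (by simp)) v

lemma rderiv_chart_cJ {p₀ q : M} (hq : q ∈ (chartAt E p₀).source) (v : RTangent E q) :
    rderiv (E := E) (E' := E) (chartAt E p₀) q (cJ E q v) =
      cJ E _ (rderiv (E := E) (E' := E) (chartAt E p₀) q v) :=
  rderiv_cJ ((contMDiffAt_chartAt_complex hq).mdifferentiableAt (by simp)) v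

lemma contDiffOn_fieldInChart {X : VField E M} (hX : ∀ p, SmoothFieldAt X p) (p₀ : M) :
    ContDiffOn ℝ ∞ (fieldInChart X p₀) (chartAt E p₀).target := by
  intro y hy
  have : CompleteSpace E := FiniteDimensional.complete ℂ E
  have h := ContMDiffAt.mpullback_vectorField_preimage (m := ∞) (n := ∞)
    (f := (chartAt E p₀).symm) (x₀ := y) (hX _)
    (contMDiffAt_chartAt_symm_complex hy).real_of_complex (isInvertible_rderiv_symm hy) (by simp)
  have h2 := contMDiffAt_vectorSpace_iff_contDiffAt.1 h
  refine (h2.congr_of_eventuallyEq ?_).contDiffWithinAt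
  filter_upwards [(chartAt E p₀).open_target.mem_nhds hy] with z hz
  exact (mpullback_eq_fieldInChart X hz).symm

lemma mlieBracket_vectorSpace (V W : E → E) (x : E) :
    VectorField.mlieBracket 𝓘(ℝ, E) V W x = fderiv ℝ W x (V x) - fderiv ℝ V x (W x) :=
  (congrFun (VectorField.mlieBracketWithin_univ (I := 𝓘(ℝ, E)) (V := V) (W := W)) x).symm.trans
    ((congrFun (VectorField.mlieBracketWithin_eq_lieBracketWithin (V := V) (W := W)) x).trans
      (congrFun (VectorField.lieBracketWithin_univ (𝕜 := ℝ) (V := V) (W := W)) x))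

lemma fieldInChart_mlieBracket {X Y : VField E M} (p₀ : M)
    {y : E} (hy : y ∈ (chartAt E p₀).target)
    (hX : SmoothFieldAt X ((chartAt E p₀).symm y)) (hY : SmoothFieldAt Y ((chartAt E p₀).symm y)) :
    fieldInChart (VectorField.mlieBracket 𝓘(ℝ, E) X Y) p₀ y =
      fderiv ℝ (fieldInChart Y p₀) y (fieldInChart X p₀ y) -
      fderiv ℝ (fieldInChart X p₀) y (fieldInChart Y p₀ y) := by
  have : CompleteSpace E := FiniteDimensional.complete ℂ E
  have : IsManifold 𝓘(ℝ, E) (minSmoothness ℝ 2) M :=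
    IsManifold.of_le minSmoothness_two_le_infty
  rw [← mpullback_eq_fieldInChart _ hy, VectorField.mpullback_mlieBracket (n := ∞)
    (hX.mdifferentiableAt (by simp)) (hY.mdifferentiableAt (by simp))
    (contMDiffAt_chartAt_symm_complex hy).real_of_complex minSmoothness_two_le_infty]
  have hev : ∀ X : VField E M, VectorField.mpullback 𝓘(ℝ, E) 𝓘(ℝ, E) (chartAt E p₀).symm X
      =ᶠ[𝓝 y] fieldInChart X p₀ := fun X => by
    filter_upwards [(chartAt E p₀).open_target.mem_nhds hy] with z hz
    exact mpullback_eq_fieldInChart X hz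
  exact ((hev X).mlieBracket_vectorField_eq (hev Y)).trans (mlieBracket_vectorSpace _ _ y)

/-- A vector field with constant coefficients in the chart at `p₀`. -/
noncomputable def chartConstField (p₀ : M) (u : E) : VField E M :=
  VectorField.mpullback 𝓘(ℝ, E) 𝓘(ℝ, E) (chartAt E p₀) (fun _ => u)

lemma isInvertible_rderiv_chart {p₀ q : M} (hq : q ∈ (chartAt E p₀).source) :
    (mfderiv 𝓘(ℝ, E) 𝓘(ℝ, E) (chartAt E p₀) q).IsInvertible :=
  ⟨(chartAt_mdifferentiable_real p₀).mfderiv hq, rfl⟩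

lemma chartConstField_smooth (p₀ : M) (u : E) {q : M} (hq : q ∈ (chartAt E p₀).source) :
    SmoothFieldAt (chartConstField p₀ u) q := by
  have : CompleteSpace E := FiniteDimensional.complete ℂ E
  refine ContMDiffAt.mpullback_vectorField_preimage (m := ∞) (n := ∞) (V := fun _ => u)
    (contMDiffAt_vectorSpace_iff_contDiffAt.2 contDiffAt_const)
    (contMDiffAt_chartAt_complex hq).real_of_complex (isInvertible_rderiv_chart hq) (by simp)

lemma fieldInChart_chartConstField (p₀ : M) (u : E) {y : E} (hy : y ∈ (chartAt E p₀).target) :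
    fieldInChart (chartConstField p₀ u) p₀ y = u := by
  obtain ⟨A, hA⟩ := isInvertible_rderiv_chart ((chartAt E p₀).map_target hy)
  have h : chartConstField p₀ u ((chartAt E p₀).symm y) = A.symm u := by
    change (mfderiv 𝓘(ℝ, E) 𝓘(ℝ, E) (chartAt E p₀) ((chartAt E p₀).symm y)).inverse _ = _
    rw [← hA, ContinuousLinearMap.inverse_equiv]
    rfl
  rw [fieldInChart, h, rderiv, ← hA]
  exact A.apply_symm_apply u

lemma chartConstField_apply (p₀ : M) (u : E) {y : E} (hy : y ∈ (chartAt E p₀).target) :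
    chartConstField p₀ u ((chartAt E p₀).symm y) =
      rderiv (E := E) (E' := E) (chartAt E p₀).symm y u := by
  rw [← rderiv_symm_fieldInChart (X := chartConstField p₀ u) hy, fieldInChart_chartConstField p₀ u hy]

/-- The Killing equation in coordinates, obtained by testing it on vector fields with constant
coefficients. -/
lemma IsKilling.inChart {Ω : TwoForm E M} (hΩ : Ω.IsSmooth) {X : VField E M}
    (hX : ∀ p, SmoothFieldAt X p) (hK : Ω.IsKilling X) (p₀ : M) {y : E}
    (hy : y ∈ (chartAt E p₀).target) (u v : E) :
    fderiv ℝ (Ω.inChart p₀) y (fieldInChart X p₀ y) ![Complex.I • u, v] +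
      Ω.inChart p₀ y ![Complex.I • fderiv ℝ (fieldInChart X p₀) y u, v] +
      Ω.inChart p₀ y ![Complex.I • u, fderiv ℝ (fieldInChart X p₀) y v] = 0 := by
  set e := chartAt E p₀ with he
  have hq : e.symm y ∈ e.source := e.map_target hy
  have hsm := fun u => chartConstField_smooth (E := E) p₀ u (q := e.symm y)
  have h := hK (e.symm y) (chartConstField p₀ u) (chartConstField p₀ v) (hsm u hq) (hsm v hq)
  have hbr : ∀ u, VectorField.mlieBracket 𝓘(ℝ, E) X (chartConstField p₀ u) (e.symm y) =
      rderiv (E := E) (E' := E) e.symm y (-(fderiv ℝ (fieldInChart X p₀) y u) : E) := by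
    intro u
    rw [← rderiv_symm_fieldInChart (X := VectorField.mlieBracket 𝓘(ℝ, E) X (chartConstField p₀ u))
      hy, fieldInChart_mlieBracket p₀ hy (hX _) (hsm u hq), fieldInChart_chartConstField p₀ u hy]
    have : fieldInChart (chartConstField p₀ u) p₀ =ᶠ[𝓝 y] fun _ => u := by
      filter_upwards [e.open_target.mem_nhds hy] with z hz
      exact fieldInChart_chartConstField p₀ u hz
    rw [this.fderiv_eq]
    simp
    rfl
  have hΩd : DifferentiableAt ℝ (Ω.inChart p₀) y :=
    ((hΩ p₀).differentiableOn (by simp)).differentiableAt (e.open_target.mem_nhds hy)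
  have hF : (fun q => Ω q ![cJ E q (chartConstField p₀ u q), chartConstField p₀ v q])
      =ᶠ[𝓝 (e.symm y)] (fun z => Ω.inChart p₀ z ![Complex.I • u, v]) ∘ e := by
    filter_upwards [e.open_source.mem_nhds hq] with q hq'
    have hz : e q ∈ e.target := e.map_source hq'
    have hu := chartConstField_apply p₀ u hz
    have hv := chartConstField_apply p₀ v hz
    rw [Function.comp, TwoForm.inChart_apply, rderiv_symm_cJ hz, ← hu, ← hv, ← he, e.left_inv hq']
  have hd : DifferentiableAt ℝ (fun z => Ω.inChart p₀ z ![Complex.I • u, v]) y :=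
    hΩd.continuousAlternatingMap_apply_const _
  have hdm : mfderiv 𝓘(ℝ, E) 𝓘(ℝ, ℝ)
      (fun q => Ω q ![cJ E q (chartConstField p₀ u q), chartConstField p₀ v q]) (e.symm y)
        (X (e.symm y)) =
      fderiv ℝ (Ω.inChart p₀) y (fieldInChart X p₀ y) ![Complex.I • u, v] := by
    rw [hF.mfderiv_eq, mfderiv_comp (I' := 𝓘(ℝ, E)) (e.symm y)
      (by rw [e.right_inv hy]; exact hd.mdifferentiableAt)
      ((chartAt_mdifferentiable_real p₀).mdifferentiableAt hq)]
    rw [mfderiv_eq_fderiv, e.right_inv hy]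
    exact fderiv_continuousAlternatingMap_apply_const_apply hΩd _ _
  rw [hdm, hbr, hbr, chartConstField_apply p₀ u hy, chartConstField_apply p₀ v hy,
    ← rderiv_symm_cJ hy, ← rderiv_symm_cJ hy] at h
  have h1 := TwoForm.inChart_apply Ω p₀ y (Complex.I • -(fderiv ℝ (fieldInChart X p₀) y u)) v
  have h2 := TwoForm.inChart_apply Ω p₀ y (Complex.I • u) (-(fderiv ℝ (fieldInChart X p₀) y v))
  rw [← he] at h1 h2
  rw [← h1, ← h2] at h
  rw [h]
  simp only [← toBilin_apply, smul_neg, map_neg, neg_apply]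
  ring

/-- A Killing Hamiltonian vector field on a Kähler manifold preserves the complex structure: it is
holomorphic in coordinates. Indeed `L_X` annihilates both the symplectic form `Ω` and the metric
`Ω(J-,-)`, hence also `J`. -/
lemma fderiv_fieldInChart_I {Ω : TwoForm E M} (hΩ : Ω.IsKahler) {f : M → ℝ}
    (hf : ContMDiff 𝓘(ℝ, E) 𝓘(ℝ, ℝ) ∞ f) {X : VField E M}
    (hX : Ω.IsHamiltonian f X) (hK : Ω.IsKilling X) (p₀ : M) {y : E}
    (hy : y ∈ (chartAt E p₀).target) (u : E) :
    fderiv ℝ (fieldInChart X p₀) y (Complex.I • u) =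
      Complex.I • fderiv ℝ (fieldInChart X p₀) y u := by
  set e := chartAt E p₀ with he
  have hS := e.open_target
  have hΩd : DifferentiableAt ℝ (Ω.inChart p₀) y :=
    ((hΩ.smooth p₀).differentiableOn (by simp)).differentiableAt (hS.mem_nhds hy)
  have hXd : DifferentiableAt ℝ (fieldInChart X p₀) y :=
    ((contDiffOn_fieldInChart hX.smooth p₀).differentiableOn (by simp)).differentiableAt
      (hS.mem_nhds hy)
  have hfe : ContDiffOn ℝ ∞ (f ∘ e.symm) e.target := fun z hz => by
    have h : ContMDiffAt 𝓘(ℝ, E) 𝓘(ℝ, ℝ) ∞ (f ∘ e.symm) z := (hf _).comp z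
      (contMDiffAt_chartAt_symm_complex hz).real_of_complex
    exact (contMDiffAt_iff_contDiffAt.1 h).contDiffWithinAt
  have heq : ∀ z ∈ e.target, ∀ v,
      - Ω.inChart p₀ z ![fieldInChart X p₀ z, v] = fderiv ℝ (f ∘ e.symm) z v := by
    intro z hz v
    have h2 : fderiv ℝ (f ∘ e.symm) z v = mfderiv 𝓘(ℝ, E) 𝓘(ℝ, ℝ) f (e.symm z)
        (rderiv (E := E) (E' := E) e.symm z v) := by
      rw [← mfderiv_eq_fderiv, mfderiv_comp (I' := 𝓘(ℝ, E)) z ((hf _).mdifferentiableAt (by simp))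
        ((contMDiffAt_chartAt_symm_complex hz).real_of_complex.mdifferentiableAt (by simp))]
      rfl
    rw [TwoForm.inChart_apply, rderiv_symm_fieldInChart hz, h2, ← hX.eq]
  have hlie := fun u v => lie_form_eq_zero hS hy hΩd (hΩ.closed p₀ y hy) hXd hfe heq u v
  -- comparing `L_X Ω = 0` at `(Ju, v)` with the Killing equation at `(u, v)` leaves `(L_X J) u`
  have hkil := fun u v => IsKilling.inChart hΩ.smooth hX.smooth hK p₀ hy u v
  have hzero : ∀ v, Ω.inChart p₀ y ![fderiv ℝ (fieldInChart X p₀) y (Complex.I • u) -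
      Complex.I • fderiv ℝ (fieldInChart X p₀) y u, v] = 0 := by
    intro v
    have h1 := hlie (Complex.I • u) v
    have h2 := hkil u v
    rw [← toBilin_apply, map_sub, sub_apply, toBilin_apply, toBilin_apply]
    linarith
  have hnd := hΩ.nondegenerate (e.symm y) (rderiv (E := E) (E' := E) e.symm y
    (fderiv ℝ (fieldInChart X p₀) y (Complex.I • u) -
      Complex.I • fderiv ℝ (fieldInChart X p₀) y u : E)) (fun w => by
        have := (TwoForm.inChart_apply Ω p₀ y _ _).symm.trans
          (hzero (rderiv (E' := E) e (e.symm y) w))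
        rwa [rderiv_symm_rderiv_chart hy] at this)
  have h0 := rderiv_chart_rderiv_symm hy (fderiv ℝ (fieldInChart X p₀) y (Complex.I • u) -
      Complex.I • fderiv ℝ (fieldInChart X p₀) y u : E)
  rw [← he, hnd, map_zero] at h0
  exact (sub_eq_zero.1 h0.symm)

end FieldsInCharts

/-! ### Foliation charts adapted to a distribution -/

section AdaptedCharts

variable {E : Type*} [NormedAddCommGroup E] [NormedSpace ℂ E]
  {M : Type*} [TopologicalSpace M] [ChartedSpace E M] {q k : ℕ}

/-- A foliation chart adapted to the distribution `D`: a holomorphic coordinate system `(x, y)` with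
values in a product set, in which `D` is the kernel of `dx`. -/
structure IsAdaptedChart (D : ∀ p : M, Submodule ℝ (RTangent E p))
    (φ : OpenPartialHomeomorph M (CSpace q × CSpace k)) : Prop where
  target_prod : ∃ (V : Set (CSpace q)) (W : Set (CSpace k)),
    IsOpen V ∧ IsOpen W ∧ φ.target = V ×ˢ W
  holomorphic : ContMDiffOn 𝓘(ℂ, E) 𝓘(ℂ, CSpace q × CSpace k) ∞ φ φ.source
  holomorphic_symm : ContMDiffOn 𝓘(ℂ, CSpace q × CSpace k) 𝓘(ℂ, E) ∞ φ.symm φ.target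
  mem_iff : ∀ p ∈ φ.source, ∀ v : RTangent E p,
    v ∈ D p ↔ rderiv (E' := CSpace q) (fun r : M => (φ r).1) p v = 0

namespace IsAdaptedChart

variable {D : ∀ p : M, Submodule ℝ (RTangent E p)}
  {φ ψ : OpenPartialHomeomorph M (CSpace q × CSpace k)}

lemma contMDiffAt (h : IsAdaptedChart D φ) {p : M} (hp : p ∈ φ.source) :
    ContMDiffAt 𝓘(ℂ, E) 𝓘(ℂ, CSpace q × CSpace k) ∞ φ p :=
  h.holomorphic.contMDiffAt (φ.open_source.mem_nhds hp)

lemma contMDiffAt_symm (h : IsAdaptedChart D φ) {z : CSpace q × CSpace k} (hz : z ∈ φ.target) :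
    ContMDiffAt 𝓘(ℂ, CSpace q × CSpace k) 𝓘(ℂ, E) ∞ φ.symm z :=
  h.holomorphic_symm.contMDiffAt (φ.open_target.mem_nhds hz)

lemma contMDiffAt_fst (h : IsAdaptedChart D φ) {p : M} (hp : p ∈ φ.source) :
    ContMDiffAt 𝓘(ℂ, E) 𝓘(ℂ, CSpace q) ∞ (fun r => (φ r).1) p :=
  ContMDiffAt.comp (g := Prod.fst) (f := φ) (I' := 𝓘(ℂ, CSpace q × CSpace k)) p
    contDiff_fst.contMDiff.contMDiffAt (h.contMDiffAt hp)

lemma mem_iff_complex (h : IsAdaptedChart D φ) {p : M} (hp : p ∈ φ.source) (v : RTangent E p) :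
    v ∈ D p ↔ mfderiv 𝓘(ℂ, E) 𝓘(ℂ, CSpace q) (fun r : M => (φ r).1) p v = 0 := by
  rw [h.mem_iff p hp, rderiv_eq_restrictScalars ((h.contMDiffAt_fst hp).mdifferentiableAt (by simp))]
  rfl

/-- The transverse coordinates `x` of one adapted chart are locally holomorphic functions of those
of another one, because they are constant along the leaves. -/
lemma exists_transition (hφ : IsAdaptedChart D φ) (hψ : IsAdaptedChart D ψ) {p : M}
    (hp : p ∈ φ.source ∩ ψ.source) :
    ∃ g : CSpace q → CSpace q, ContDiffAt ℂ ∞ g (φ p).1 ∧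
      ∀ᶠ z in 𝓝 (φ p), (ψ (φ.symm z)).1 = g z.1 := by
  set h : CSpace q × CSpace k → CSpace q := fun z => (ψ (φ.symm z)).1 with hh
  have hz0 : φ p ∈ φ.target := φ.map_source hp.1
  have hO : φ.target ∩ φ.symm ⁻¹' ψ.source ∈ 𝓝 (φ p) :=
    (φ.symm.isOpen_inter_preimage ψ.open_source).mem_nhds ⟨hz0, by
      simpa [φ.left_inv hp.1] using hp.2⟩
  have hcd : ∀ z ∈ φ.target ∩ φ.symm ⁻¹' ψ.source, ContDiffAt ℂ ∞ h z := fun z hz => by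
    have := ContMDiffAt.comp (g := fun r => (ψ r).1) (f := φ.symm) z
      (hψ.contMDiffAt_fst hz.2) (hφ.contMDiffAt_symm hz.1)
    exact contMDiffAt_iff_contDiffAt.1 this
  have hker : ∀ z ∈ φ.target ∩ φ.symm ⁻¹' ψ.source, ∀ b : CSpace k, fderiv ℂ h z (0, b) = 0 := by
    intro z hz b
    have hsymm := (hφ.contMDiffAt_symm hz.1).mdifferentiableAt (by simp)
    have hsrc : φ.symm z ∈ φ.source := φ.map_target hz.1
    have h1 : fderiv ℂ h z (0, b) = mfderiv 𝓘(ℂ, E) 𝓘(ℂ, CSpace q) (fun r : M => (ψ r).1)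
        (φ.symm z) (mfderiv 𝓘(ℂ, CSpace q × CSpace k) 𝓘(ℂ, E) φ.symm z (0, b)) := by
      rw [← mfderiv_eq_fderiv]
      exact DFunLike.congr_fun (mfderiv_comp (I' := 𝓘(ℂ, E)) (g := fun r => (ψ r).1) z
        ((hψ.contMDiffAt_fst hz.2).mdifferentiableAt (by simp)) hsymm) (0, b)
    have h2 : fderiv ℂ (Prod.fst : CSpace q × CSpace k → CSpace q) z (0, b) =
        mfderiv 𝓘(ℂ, E) 𝓘(ℂ, CSpace q) (fun r : M => (φ r).1)
        (φ.symm z) (mfderiv 𝓘(ℂ, CSpace q × CSpace k) 𝓘(ℂ, E) φ.symm z (0, b)) := by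
      have hev : (Prod.fst : CSpace q × CSpace k → CSpace q) =ᶠ[𝓝 z]
          (fun r => (φ r).1) ∘ φ.symm := by
        filter_upwards [φ.open_target.mem_nhds hz.1] with w hw
        simp [φ.right_inv hw]
      rw [hev.fderiv_eq, ← mfderiv_eq_fderiv]
      exact DFunLike.congr_fun (mfderiv_comp (I' := 𝓘(ℂ, E)) (g := fun r => (φ r).1) z
        ((hφ.contMDiffAt_fst hsrc).mdifferentiableAt (by simp)) hsymm) (0, b)
    rw [fderiv_fst] at h2
    rw [h1]
    exact (hψ.mem_iff_complex hz.2 _).1 ((hφ.mem_iff_complex hsrc _).2 h2.symm)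
  obtain ⟨r, hr, hball⟩ := Metric.mem_nhds_iff.1 hO
  refine ⟨fun x => h (x, (φ p).2), ?_, ?_⟩
  · exact ContDiffAt.comp (g := h) (f := fun x => (x, (φ p).2)) (φ p).1
      (hcd _ (hball (Metric.mem_ball_self hr))) (by fun_prop)
  · filter_upwards [Metric.ball_mem_nhds (φ p) hr] with z hz
    have hz' : z.1 ∈ Metric.ball (φ p).1 r ∧ z.2 ∈ Metric.ball (φ p).2 r := by
      rw [Metric.mem_ball, Prod.dist_eq, max_lt_iff] at hz
      exact hz
    have hin : ∀ y ∈ Metric.ball (φ p).2 r, (z.1, y) ∈ φ.target ∩ φ.symm ⁻¹' ψ.source := by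
      intro y hy
      refine hball ?_
      rw [Metric.mem_ball, Prod.dist_eq, max_lt_iff]
      exact ⟨hz'.1, hy⟩
    have hd : ∀ y ∈ Metric.ball (φ p).2 r, HasFDerivAt (fun y => h (z.1, y)) (0 : CSpace k →L[ℂ] CSpace q) y := by
      intro y hy
      have h1 := ((hcd _ (hin y hy)).differentiableAt (by simp)).hasFDerivAt.comp y
        (hasFDerivAt_prodMk_right z.1 y)
      refine h1.congr_fderiv ?_
      ext b
      simp [hker _ (hin y hy) b]
    have := (convex_ball (φ p).2 r).is_const_of_fderivWithin_eq_zero (𝕜 := ℂ)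
      (f := fun y => h (z.1, y)) (fun y hy => (hd y hy).differentiableAt.differentiableWithinAt)
      (fun y hy => by
        rw [fderivWithin_of_isOpen Metric.isOpen_ball hy]; exact (hd y hy).fderiv)
      hz'.2 (Metric.mem_ball_self hr)
    exact this

end IsAdaptedChart

/-- The foliation atlas consisting of all charts adapted to a distribution. -/
def HolFoliationAtlas.ofDistribution (q k : ℕ) (D : ∀ p : M, Submodule ℝ (RTangent E p)) (U : Set M)
    (hU : ∀ p ∈ U, ∃ φ : OpenPartialHomeomorph M (CSpace q × CSpace k),
      IsAdaptedChart D φ ∧ φ.source ⊆ U ∧ p ∈ φ.source) : HolFoliationAtlas E q k U where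
  charts := {φ | IsAdaptedChart D φ ∧ φ.source ⊆ U}
  source_subset _ h := h.2
  cover p hp := by
    obtain ⟨φ, h1, h2, h3⟩ := hU p hp
    exact ⟨φ, ⟨h1, h2⟩, h3⟩
  target_prod _ h := h.1.target_prod
  holomorphic _ h := h.1.holomorphic
  holomorphic_symm _ h := h.1.holomorphic_symm
  transition φ hφ ψ hψ p hp := by
    obtain ⟨g, -, hg⟩ := hφ.1.exists_transition hψ.1 hp
    exact ⟨g, hg⟩

lemma HolFoliationAtlas.ofDistribution_hasTangent {D : ∀ p : M, Submodule ℝ (RTangent E p)}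
    {U : Set M} (hU : ∀ p ∈ U, ∃ φ : OpenPartialHomeomorph M (CSpace q × CSpace k),
      IsAdaptedChart D φ ∧ φ.source ⊆ U ∧ p ∈ φ.source) :
    (HolFoliationAtlas.ofDistribution q k D U hU).HasTangent D :=
  fun _ h => h.1.mem_iff

/-- Any coordinate system can be restricted to one with values in a product set. -/
lemma OpenPartialHomeomorph.exists_restrict_prod {M A B : Type*} [TopologicalSpace M]
    [TopologicalSpace A] [TopologicalSpace B] (φ : OpenPartialHomeomorph M (A × B)) {p : M}
    (hp : p ∈ φ.source) :
    ∃ φ' : OpenPartialHomeomorph M (A × B), p ∈ φ'.source ∧ φ'.source ⊆ φ.source ∧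
      φ'.target ⊆ φ.target ∧ (φ' : M → A × B) = φ ∧ (φ'.symm : A × B → M) = φ.symm ∧
      ∃ (V : Set A) (W : Set B), IsOpen V ∧ IsOpen W ∧ φ'.target = V ×ˢ W := by
  obtain ⟨V, W, hV, hpV, hW, hpW, hVW⟩ := mem_nhds_prod_iff'.1
    (φ.open_target.mem_nhds (φ.map_source hp))
  refine ⟨(φ.symm.restrOpen (V ×ˢ W) (hV.prod hW)).symm, ?_, ?_, ?_, rfl, rfl, V, W, hV, hW, ?_⟩
  · simpa [hp] using ⟨hpV, hpW⟩
  · intro x hx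
    simp at hx
    exact hx.1
  · intro x hx
    simp at hx
    exact hx.1
  · ext x
    simp only [OpenPartialHomeomorph.symm_target, OpenPartialHomeomorph.restrOpen_source,
      OpenPartialHomeomorph.symm_source]
    exact ⟨fun h => h.2, fun h => ⟨hVW h, h⟩⟩

end AdaptedCharts

/-! ### Commuting Killing Hamiltonian fields along a level set -/

section Setup

variable {E : Type*} [NormedAddCommGroup E] [NormedSpace ℂ E] [FiniteDimensional ℂ E]
  {M : Type*} [TopologicalSpace M] [ChartedSpace E M] [IsManifold 𝓘(ℂ, E) ∞ M]

/-- Commuting Killing Hamiltonian vector fields `X_i`, `Y_i` on a Kähler manifold, in involution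
along a regular level set of their Hamiltonians. -/
structure KillingSystem (Ω : TwoForm E M) {n : ℕ} (f g : Fin n → M → ℝ) (X Y : Fin n → VField E M)
    (Φ : M → (Fin n → ℝ) × (Fin n → ℝ)) (α : (Fin n → ℝ) × (Fin n → ℝ)) : Prop where
  kahler : Ω.IsKahler
  smooth_f : ∀ i, ContMDiff 𝓘(ℝ, E) 𝓘(ℝ, ℝ) ∞ (f i)
  smooth_g : ∀ i, ContMDiff 𝓘(ℝ, E) 𝓘(ℝ, ℝ) ∞ (g i)
  hamX : ∀ i, Ω.IsHamiltonian (f i) (X i)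
  hamY : ∀ i, Ω.IsHamiltonian (g i) (Y i)
  killX : ∀ i, Ω.IsKilling (X i)
  killY : ∀ i, Ω.IsKilling (Y i)
  commXX : ∀ i j, FieldsCommute (X i) (X j)
  commXY : ∀ i j, FieldsCommute (X i) (Y j)
  commYY : ∀ i j, FieldsCommute (Y i) (Y j)
  eq_Φ : Φ = fun p => (fun i => f i p, fun i => g i p)
  regular : ∀ p, Φ p = α → Function.Surjective
      (mfderiv 𝓘(ℝ, E) 𝓘(ℝ, (Fin n → ℝ) × (Fin n → ℝ)) Φ p)
  involutive : ∀ p, Φ p = α → ∀ i j,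
      Ω p ![X i p, X j p] = 0 ∧ Ω p ![X i p, Y j p] = 0 ∧ Ω p ![Y i p, Y j p] = 0

/-- The fields `Z_i = X_i - J Y_i`. -/
noncomputable def fieldZ {n : ℕ} (X Y : Fin n → VField E M) (i : Fin n) : VField E M :=
  fun p => X i p - cJ E p (Y i p)

/-- The fields `W_i = J X_i + Y_i = J Z_i`. -/
noncomputable def fieldW {n : ℕ} (X Y : Fin n → VField E M) (i : Fin n) : VField E M :=
  fun p => cJ E p (X i p) + Y i p

lemma cJ_fieldZ {n : ℕ} (X Y : Fin n → VField E M) (i : Fin n) (p : M) :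
    cJ E p (fieldZ X Y i p) = fieldW X Y i p := by
  simp [fieldZ, fieldW, map_sub]

/-- `Ω_p` as a bilinear form on `T_pM`. -/
noncomputable def TwoForm.bilin (Ω : TwoForm E M) (p : M) :
    RTangent E p →L[ℝ] RTangent E p →L[ℝ] ℝ :=
  toBilin E (Ω p)

lemma TwoForm.bilin_apply (Ω : TwoForm E M) (p : M) (u v : RTangent E p) :
    Ω.bilin p u v = Ω p ![u, v] := toBilin_apply (E := E) (Ω p) u v

lemma TwoForm.bilin_swap (Ω : TwoForm E M) (p : M) (u v : RTangent E p) :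
    Ω.bilin p u v = - Ω.bilin p v u := by
  rw [bilin_apply, bilin_apply]
  exact two_form_swap (E := E) (Ω p) u v

namespace KillingSystem

variable {Ω : TwoForm E M} {n : ℕ} {f g : Fin n → M → ℝ} {X Y : Fin n → VField E M}
  {Φ : M → (Fin n → ℝ) × (Fin n → ℝ)} {α : (Fin n → ℝ) × (Fin n → ℝ)}
  (H : KillingSystem Ω f g X Y Φ α)

include H in
lemma smooth_Φ : ContMDiff 𝓘(ℝ, E) 𝓘(ℝ, (Fin n → ℝ) × (Fin n → ℝ)) ∞ Φ := by
  rw [H.eq_Φ]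
  exact (contMDiff_pi_space.2 H.smooth_f).prodMk_space (contMDiff_pi_space.2 H.smooth_g)

include H in
lemma mfderiv_fst_apply (p : M) (v : RTangent E p) (i : Fin n) :
    (mfderiv 𝓘(ℝ, E) 𝓘(ℝ, (Fin n → ℝ) × (Fin n → ℝ)) Φ p v : (Fin n → ℝ) × (Fin n → ℝ)).1 i =
      - Ω.bilin p (X i p) v := by
  let L : ((Fin n → ℝ) × (Fin n → ℝ)) →L[ℝ] ℝ :=
    ContinuousLinearMap.proj (R := ℝ) (φ := fun _ : Fin n => ℝ) i ∘L .fst ℝ _ _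
  have h1 : HasMFDerivAt 𝓘(ℝ, E) 𝓘(ℝ, ℝ) (L ∘ Φ) p
      (L ∘L mfderiv 𝓘(ℝ, E) 𝓘(ℝ, (Fin n → ℝ) × (Fin n → ℝ)) Φ p) :=
    HasMFDerivAt.comp p L.hasMFDerivAt ((H.smooth_Φ p).mdifferentiableAt (by simp)).hasMFDerivAt
  have h2 : L ∘ Φ = f i := by rw [H.eq_Φ]; rfl
  rw [h2] at h1
  rw [TwoForm.bilin_apply, (H.hamX i).eq p v, h1.mfderiv]
  rfl

include H in
lemma mfderiv_snd_apply (p : M) (v : RTangent E p) (i : Fin n) :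
    (mfderiv 𝓘(ℝ, E) 𝓘(ℝ, (Fin n → ℝ) × (Fin n → ℝ)) Φ p v : (Fin n → ℝ) × (Fin n → ℝ)).2 i =
      - Ω.bilin p (Y i p) v := by
  let L : ((Fin n → ℝ) × (Fin n → ℝ)) →L[ℝ] ℝ :=
    ContinuousLinearMap.proj (R := ℝ) (φ := fun _ : Fin n => ℝ) i ∘L .snd ℝ _ _
  have h1 : HasMFDerivAt 𝓘(ℝ, E) 𝓘(ℝ, ℝ) (L ∘ Φ) p
      (L ∘L mfderiv 𝓘(ℝ, E) 𝓘(ℝ, (Fin n → ℝ) × (Fin n → ℝ)) Φ p) :=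
    HasMFDerivAt.comp p L.hasMFDerivAt ((H.smooth_Φ p).mdifferentiableAt (by simp)).hasMFDerivAt
  have h2 : L ∘ Φ = g i := by rw [H.eq_Φ]; rfl
  rw [h2] at h1
  rw [TwoForm.bilin_apply, (H.hamY i).eq p v, h1.mfderiv]
  rfl

include H in
/-- The tangent space of the level set is the `Ω`-orthogonal complement of `span(X_i, Y_i)`. -/
lemma mfderiv_eq_zero_iff (p : M) (v : RTangent E p) :
    mfderiv 𝓘(ℝ, E) 𝓘(ℝ, (Fin n → ℝ) × (Fin n → ℝ)) Φ p v = 0 ↔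
      ∀ t ∈ spanFields X Y p, Ω.bilin p t v = 0 := by
  constructor
  · intro h t ht
    induction ht using Submodule.span_induction with
    | mem t ht =>
      rcases ht with ⟨i, rfl⟩ | ⟨i, rfl⟩
      · have := H.mfderiv_fst_apply p v i
        rw [h] at this
        exact neg_eq_zero.1 this.symm
      · have := H.mfderiv_snd_apply p v i
        rw [h] at this
        exact neg_eq_zero.1 this.symm
    | zero => simp
    | add s t _ _ hs ht => rw [map_add, add_apply, hs, ht, add_zero]
    | smul c t _ ht => rw [map_smul, smul_apply, ht, smul_zero]
  · intro h
    refine Prod.ext (funext fun i => ?_) (funext fun i => ?_)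
    · refine (H.mfderiv_fst_apply p v i).trans ?_
      rw [h _ (Submodule.subset_span (Or.inl ⟨i, rfl⟩)), neg_zero]
      rfl
    · refine (H.mfderiv_snd_apply p v i).trans ?_
      rw [h _ (Submodule.subset_span (Or.inr ⟨i, rfl⟩)), neg_zero]
      rfl

include H in
/-- `span(X_i, Y_i)` is isotropic along the level set. -/
lemma isotropic {p : M} (hp : Φ p = α) {s t : RTangent E p} (hs : s ∈ spanFields X Y p)
    (ht : t ∈ spanFields X Y p) : Ω.bilin p s t = 0 := by
  have hgen : ∀ i, ∀ t ∈ spanFields X Y p, Ω.bilin p (X i p) t = 0 ∧ Ω.bilin p (Y i p) t = 0 := by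
    intro i t ht
    induction ht using Submodule.span_induction with
    | mem t ht =>
      rcases ht with ⟨j, rfl⟩ | ⟨j, rfl⟩
      · refine ⟨?_, ?_⟩
        · rw [TwoForm.bilin_apply]; exact (H.involutive p hp i j).1
        · rw [TwoForm.bilin_swap, TwoForm.bilin_apply, (H.involutive p hp j i).2.1, neg_zero]
      · refine ⟨?_, ?_⟩
        · rw [TwoForm.bilin_apply]; exact (H.involutive p hp i j).2.1
        · rw [TwoForm.bilin_apply]; exact (H.involutive p hp i j).2.2
    | zero => simp
    | add s t _ _ hs ht => simp [hs, ht]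
    | smul c t _ ht => simp [ht]
  induction hs using Submodule.span_induction with
  | mem s hs =>
    rcases hs with ⟨i, rfl⟩ | ⟨i, rfl⟩
    · exact (hgen i t ht).1
    · exact (hgen i t ht).2
  | zero => simp
  | add s t _ _ hs ht => rw [map_add, add_apply, hs, ht, add_zero]
  | smul c t _ ht => rw [map_smul, smul_apply, ht, smul_zero]

include H in
lemma mfderiv_eq_zero_of_mem {p : M} (hp : Φ p = α) {v : RTangent E p}
    (hv : v ∈ spanFields X Y p) :
    mfderiv 𝓘(ℝ, E) 𝓘(ℝ, (Fin n → ℝ) × (Fin n → ℝ)) Φ p v = 0 :=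
  (H.mfderiv_eq_zero_iff p v).2 fun _ ht => H.isotropic hp ht hv

include H in
lemma bilin_cJ_cJ (p : M) (v w : RTangent E p) :
    Ω.bilin p (cJ E p v) (cJ E p w) = Ω.bilin p v w := by
  rw [TwoForm.bilin_apply, TwoForm.bilin_apply, H.kahler.invariant]

include H in
lemma eq_zero_of_bilin_cJ {p : M} {v : RTangent E p} (h : Ω.bilin p (cJ E p v) v = 0) : v = 0 := by
  by_contra hv
  have := H.kahler.pos p v hv
  rw [← TwoForm.bilin_apply, h] at this
  exact lt_irrefl _ this

include H in
/-- `T ∩ JT = 0` for the isotropic space `T = span(X_i, Y_i)`: if `u + Jw = 0`, then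
`Ω(Jw, w) = -Ω(u, w) = 0`. -/
lemma eq_zero_of_add_cJ {p : M} (hp : Φ p = α) {u w : RTangent E p} (hu : u ∈ spanFields X Y p)
    (hw : w ∈ spanFields X Y p) (h : u + cJ E p w = 0) : u = 0 ∧ w = 0 := by
  have hw0 : w = 0 := by
    refine H.eq_zero_of_bilin_cJ ?_
    rw [eq_neg_of_add_eq_zero_right h, map_neg, neg_apply, H.isotropic hp hu hw, neg_zero]
  refine ⟨?_, hw0⟩
  rw [hw0, map_zero, add_zero] at h
  exact h

include H in
/-- At a regular point, the `X_i`, `Y_i` are linearly independent, since they are dual to the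
linearly independent components of `dΦ`. -/
lemma linearIndependent_real {p : M} (hp : Φ p = α) (a b : Fin n → ℝ)
    (h : ∑ i, a i • X i p + ∑ i, b i • Y i p = 0) : a = 0 ∧ b = 0 := by
  have key : ∀ v : RTangent E p, ∑ i, a i * (-(mfderiv 𝓘(ℝ, E) 𝓘(ℝ, (Fin n → ℝ) × (Fin n → ℝ)) Φ p v :
      (Fin n → ℝ) × (Fin n → ℝ)).1 i) + ∑ i, b i * (-(mfderiv 𝓘(ℝ, E)
        𝓘(ℝ, (Fin n → ℝ) × (Fin n → ℝ)) Φ p v : (Fin n → ℝ) × (Fin n → ℝ)).2 i) = 0 := by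
    intro v
    have h1 : Ω.bilin p (∑ i, a i • X i p + ∑ i, b i • Y i p) v = 0 := by rw [h]; simp
    simp only [H.mfderiv_fst_apply, H.mfderiv_snd_apply, neg_neg]
    simpa [map_add, map_sum, map_smul] using h1
  constructor
  · ext i
    obtain ⟨v, hv⟩ := H.regular p hp ((Pi.single i 1, 0) : (Fin n → ℝ) × (Fin n → ℝ))
    have := key v
    rw [hv] at this
    simpa [Pi.single_apply] using this
  · ext i
    obtain ⟨v, hv⟩ := H.regular p hp ((0, Pi.single i 1) : (Fin n → ℝ) × (Fin n → ℝ))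
    have := key v
    rw [hv] at this
    simpa [Pi.single_apply] using this

end KillingSystem
end Setup

/-! ### Complex spans -/

section Spans

variable {E : Type*} [NormedAddCommGroup E] [NormedSpace ℂ E]

lemma I_smul_mem_span {κ : Type*} (z : κ → E) {t : E}
    (ht : t ∈ Submodule.span ℝ (Set.range z ∪ Set.range fun i => Complex.I • z i)) :
    Complex.I • t ∈ Submodule.span ℝ (Set.range z ∪ Set.range fun i => Complex.I • z i) := by
  induction ht using Submodule.span_induction with
  | mem t ht =>
    rcases ht with ⟨i, rfl⟩ | ⟨i, rfl⟩
    · exact Submodule.subset_span (Or.inr ⟨i, rfl⟩)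
    · dsimp only
      rw [smul_smul, Complex.I_mul_I, neg_one_smul]
      exact neg_mem (Submodule.subset_span (Or.inl ⟨i, rfl⟩))
  | zero => rw [smul_zero]; exact zero_mem _
  | add s t _ _ hs ht => rw [smul_add]; exact add_mem hs ht
  | smul c t _ ht => rw [smul_comm]; exact Submodule.smul_mem _ _ ht

lemma mem_span_complex_iff {κ : Type*} (z : κ → E) (v : E) :
    v ∈ Submodule.span ℂ (Set.range z) ↔
      v ∈ Submodule.span ℝ (Set.range z ∪ Set.range fun i => Complex.I • z i) := by
  constructor
  · intro hv
    induction hv using Submodule.span_induction with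
    | mem t ht => exact Submodule.subset_span (Or.inl ht)
    | zero => exact zero_mem _
    | add s t _ _ hs ht => exact add_mem hs ht
    | smul c t _ ht =>
      rw [complex_smul_eq]
      exact add_mem (Submodule.smul_mem _ _ ht) (Submodule.smul_mem _ _ (I_smul_mem_span z ht))
  · intro hv
    have h : Submodule.span ℝ (Set.range z ∪ Set.range fun i => Complex.I • z i) ≤
        (Submodule.span ℂ (Set.range z)).restrictScalars ℝ := by
      rw [Submodule.span_le]
      rintro _ (⟨i, rfl⟩ | ⟨i, rfl⟩)
      · exact Submodule.subset_span ⟨i, rfl⟩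
      · exact Submodule.smul_mem (Submodule.span ℂ (Set.range z)) _
          (Submodule.subset_span ⟨i, rfl⟩)
    exact h hv

/-- In linear coordinates in which the `z i` become the last coordinate vectors, their span is the
kernel of the first coordinates. -/
lemma mem_span_iff_of_coordinates {F : Type*} [AddCommGroup F] [Module ℂ F] {κ : Type*} [Fintype κ]
    [DecidableEq κ] {A : E →ₗ[ℂ] F × (κ → ℂ)} (hA : Function.Injective A) {z : κ → E}
    (hz : ∀ i, A (z i) = (0, Pi.single i 1)) (v : E) :
    v ∈ Submodule.span ℂ (Set.range z) ↔ (A v).1 = 0 := by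
  constructor
  · intro hv
    induction hv using Submodule.span_induction with
    | mem t ht => obtain ⟨i, rfl⟩ := ht; rw [hz]
    | zero => simp
    | add s t _ _ hs ht => simp [hs, ht]
    | smul c t _ ht => simp [ht]
  · intro hv
    have : v = ∑ i, (A v).2 i • z i := by
      apply hA
      rw [map_sum]
      simp only [map_smul, hz]
      ext1
      · simp [hv, Prod.fst_sum]
      · ext l
        simp [Prod.snd_sum, Finset.sum_apply, Pi.single_apply]
    rw [this]
    exact Submodule.sum_mem _ fun i _ => Submodule.smul_mem _ _ (Submodule.subset_span ⟨i, rfl⟩)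

variable [FiniteDimensional ℂ E]
  {M : Type*} [TopologicalSpace M] [ChartedSpace E M] [IsManifold 𝓘(ℂ, E) ∞ M] {n : ℕ}

/-- The tangent vector of a field at a point, in the complex vector space `E`. -/
abbrev vecAt {κ : Type*} (X : κ → VField E M) (p : M) : κ → E := fun i => X i p

/-- The `Z_i`, `W_i = J Z_i` span over `ℝ` what the `Z_i` span over `ℂ`. -/
lemma mem_spanFields_ZW (X Y : Fin n → VField E M) (p : M) (v : RTangent E p) :
    v ∈ spanFields (fieldZ X Y) (fieldW X Y) p ↔
      v ∈ Submodule.span ℂ (Set.range (vecAt (fieldZ X Y) p)) := by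
  have h := mem_span_complex_iff (vecAt (fieldZ X Y) p) v
  refine Iff.trans ?_ h.symm
  have hW : (fun i => Complex.I • vecAt (fieldZ X Y) p i) = fun i => fieldW X Y i p := by
    funext i
    exact cJ_fieldZ X Y i p
  rw [hW]
  exact Iff.rfl

/-- The `X_i`, `Y_i`, `Z_i`, `W_i` together span over `ℝ` what the `X_i`, `Z_i` span over `ℂ`. -/
lemma mem_sup_spanFields (X Y : Fin n → VField E M) (p : M) (v : RTangent E p) :
    v ∈ spanFields X Y p ⊔ spanFields (fieldZ X Y) (fieldW X Y) p ↔
      v ∈ Submodule.span ℂ (Set.range (Sum.elim (vecAt X p) (vecAt (fieldZ X Y) p))) := by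
  have hX : ∀ i, X i p ∈ spanFields X Y p := fun i => Submodule.subset_span (Or.inl ⟨i, rfl⟩)
  have hY : ∀ i, Y i p ∈ spanFields X Y p := fun i => Submodule.subset_span (Or.inr ⟨i, rfl⟩)
  have hZ : ∀ i, fieldZ X Y i p ∈ spanFields (fieldZ X Y) (fieldW X Y) p :=
    fun i => Submodule.subset_span (Or.inl ⟨i, rfl⟩)
  have hW : ∀ i, fieldW X Y i p ∈ spanFields (fieldZ X Y) (fieldW X Y) p :=
    fun i => Submodule.subset_span (Or.inr ⟨i, rfl⟩)
  have hJX : ∀ i, cJ E p (X i p) = - Y i p + fieldW X Y i p := fun i => by simp [fieldW]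
  constructor
  · intro hv
    have hXc : ∀ i, (X i p : E) ∈
        Submodule.span ℂ (Set.range (Sum.elim (vecAt X p) (vecAt (fieldZ X Y) p))) :=
      fun i => Submodule.subset_span ⟨Sum.inl i, rfl⟩
    have hZc : ∀ i, (fieldZ X Y i p : E) ∈
        Submodule.span ℂ (Set.range (Sum.elim (vecAt X p) (vecAt (fieldZ X Y) p))) :=
      fun i => Submodule.subset_span ⟨Sum.inr i, rfl⟩
    have hWc : ∀ i, (fieldW X Y i p : E) ∈
        Submodule.span ℂ (Set.range (Sum.elim (vecAt X p) (vecAt (fieldZ X Y) p))) := fun i => by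
      rw [← cJ_fieldZ]; exact Submodule.smul_mem _ Complex.I (hZc i)
    have haux : ∀ (S : Submodule ℂ E) (x y : E), x ∈ S → y ∈ S → x - Complex.I • y ∈ S :=
      fun S x y hx hy => sub_mem hx (S.smul_mem _ hy)
    have hYc : ∀ i, (Y i p : E) ∈
        Submodule.span ℂ (Set.range (Sum.elim (vecAt X p) (vecAt (fieldZ X Y) p))) := fun i => by
      have h : vecAt Y p i = vecAt (fieldW X Y) p i - Complex.I • vecAt X p i :=
        (add_sub_cancel_left _ _).symm
      change vecAt Y p i ∈ _
      rw [h]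
      exact haux _ _ _ (hWc i) (hXc i)
    have hle : spanFields X Y p ⊔ spanFields (fieldZ X Y) (fieldW X Y) p ≤
        (Submodule.span ℂ (Set.range (Sum.elim (vecAt X p)
          (vecAt (fieldZ X Y) p)))).restrictScalars ℝ := by
      refine sup_le (Submodule.span_le.2 ?_) (Submodule.span_le.2 ?_)
      · rintro _ (⟨i, rfl⟩ | ⟨i, rfl⟩)
        · exact hXc i
        · exact hYc i
      · rintro _ (⟨i, rfl⟩ | ⟨i, rfl⟩)
        · exact hZc i
        · exact hWc i
    exact hle hv
  · intro hv
    have hv' := (mem_span_complex_iff (E := E) _ v).1 hv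
    have hle : Submodule.span ℝ (Set.range (Sum.elim (vecAt X p) (vecAt (fieldZ X Y) p)) ∪
        Set.range fun i => Complex.I • Sum.elim (vecAt X p) (vecAt (fieldZ X Y) p) i) ≤
        (spanFields X Y p ⊔ spanFields (fieldZ X Y) (fieldW X Y) p : Submodule ℝ (RTangent E p)) := by
      refine Submodule.span_le.2 ?_
      rintro _ (⟨i | i, rfl⟩ | ⟨i | i, rfl⟩)
      · change X i p ∈ spanFields X Y p ⊔ spanFields (fieldZ X Y) (fieldW X Y) p
        exact Submodule.mem_sup_left (hX i)
      · change fieldZ X Y i p ∈ spanFields X Y p ⊔ spanFields (fieldZ X Y) (fieldW X Y) p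
        exact Submodule.mem_sup_right (hZ i)
      · have h := hJX i
        change cJ E p (X i p) ∈ spanFields X Y p ⊔ spanFields (fieldZ X Y) (fieldW X Y) p
        rw [h]
        exact add_mem (Submodule.mem_sup_left (neg_mem (hY i))) (Submodule.mem_sup_right (hW i))
      · have h := cJ_fieldZ X Y i p
        change cJ E p (fieldZ X Y i p) ∈ spanFields X Y p ⊔ spanFields (fieldZ X Y) (fieldW X Y) p
        rw [h]
        exact Submodule.mem_sup_right (hW i)
    exact hle hv'

namespace KillingSystem

variable {Ω : TwoForm E M} {f g : Fin n → M → ℝ} {X Y : Fin n → VField E M}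
  {Φ : M → (Fin n → ℝ) × (Fin n → ℝ)} {α : (Fin n → ℝ) × (Fin n → ℝ)}
  (H : KillingSystem Ω f g X Y Φ α)

include H in
/-- Along the level set, the `X_i`, `Z_i` are linearly independent over `ℂ`; equivalently so are the
`X_i`, `Y_i`, because `T ∩ JT = 0` for the real span `T` of the latter. -/
lemma linearIndependent_complex {p : M} (hp : Φ p = α) :
    LinearIndependent ℂ (Sum.elim (vecAt X p) (vecAt (fieldZ X Y) p)) := by
  rw [Fintype.linearIndependent_iff]
  intro c hc
  rw [Fintype.sum_sum_type] at hc
  simp only [Sum.elim_inl, Sum.elim_inr] at hc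
  -- `∑ a_i X_i + b_i Z_i = ∑ x_i X_i + y_i Y_i = u + J w` with `u`, `w` in the real span
  set x : Fin n → ℂ := fun i => c (Sum.inl i) + c (Sum.inr i) with hx
  set y : Fin n → ℂ := fun i => - Complex.I * c (Sum.inr i) with hy
  have hXY : ∀ i, vecAt (fieldZ X Y) p i = vecAt X p i - Complex.I • vecAt Y p i := fun i => rfl
  set u : E := ∑ i, (x i).re • vecAt X p i + ∑ i, (y i).re • vecAt Y p i with hu
  set w : E := ∑ i, (x i).im • vecAt X p i + ∑ i, (y i).im • vecAt Y p i with hw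
  have hsum : u + Complex.I • w = 0 := by
    have h1 : ∑ i, x i • vecAt X p i + ∑ i, y i • vecAt Y p i = 0 := by
      rw [← hc, ← Finset.sum_add_distrib, ← Finset.sum_add_distrib]
      refine Finset.sum_congr rfl fun i _ => ?_
      simp only [hx, hy, hXY]
      rw [smul_sub, smul_smul, add_smul, neg_mul, neg_smul, mul_comm Complex.I]
      abel
    rw [← h1, hu, hw, smul_add, Finset.smul_sum, Finset.smul_sum]
    simp only [complex_smul_eq (x _), complex_smul_eq (y _), Finset.sum_add_distrib]
    simp only [smul_comm Complex.I]
    abel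
  have hmem : ∀ a b : Fin n → ℝ,
      (∑ i, a i • X i p + ∑ i, b i • Y i p : RTangent E p) ∈ spanFields X Y p := fun a b =>
    add_mem (Submodule.sum_mem _ fun i _ => Submodule.smul_mem _ _
        (Submodule.subset_span (Or.inl ⟨i, rfl⟩)))
      (Submodule.sum_mem _ fun i _ => Submodule.smul_mem _ _
        (Submodule.subset_span (Or.inr ⟨i, rfl⟩)))
  obtain ⟨hu0, hw0⟩ := H.eq_zero_of_add_cJ hp (u := u) (w := w) (hmem _ _) (hmem _ _) hsum
  obtain ⟨h1, h2⟩ := H.linearIndependent_real hp _ _ hu0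
  obtain ⟨h3, h4⟩ := H.linearIndependent_real hp _ _ hw0
  have hx0 : ∀ i, x i = 0 := fun i => Complex.ext (congrFun h1 i) (congrFun h3 i)
  have hy0 : ∀ i, y i = 0 := fun i => Complex.ext (congrFun h2 i) (congrFun h4 i)
  have hr : ∀ i, c (Sum.inr i) = 0 := fun i => by simpa [hy] using hy0 i
  rintro (i | i)
  · simpa [hx, hr] using hx0 i
  · exact hr i

include H in
lemma two_mul_le {m : ℕ} (hm : Module.finrank ℂ E = m) {p : M} (hp : Φ p = α) : 2 * n ≤ m := by
  have := (H.linearIndependent_complex hp).fintype_card_le_finrank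
  simp only [Fintype.card_sum, Fintype.card_fin, hm] at this
  omega

end KillingSystem
end Spans

lemma finrank_CSpace (k : ℕ) : Module.finrank ℂ (CSpace k) = k :=
  finrank_euclideanSpace_fin (𝕜 := ℂ) (n := k)

/-! ### Existence of adapted charts -/

section StraightenOnManifold

variable {E : Type*} [NormedAddCommGroup E] [NormedSpace ℂ E] [FiniteDimensional ℂ E]
  {M : Type*} [TopologicalSpace M] [ChartedSpace E M] [IsManifold 𝓘(ℂ, E) ∞ M]

/-- Commuting, linearly independent holomorphic vector fields are coordinate fields. -/
lemma exists_straightening_manifold {κ : Type*} [Fintype κ] [DecidableEq κ]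
    {F : Type*} [NormedAddCommGroup F] [NormedSpace ℂ F] [FiniteDimensional ℂ F]
    {V : κ → VField E M} {p₀ : M}
    (hV : ∀ i, ContDiffOn ℂ ∞ (fieldInChart (V i) p₀) (chartAt E p₀).target)
    (hcomm : ∀ i j, ∀ y ∈ (chartAt E p₀).target,
      fderiv ℂ (fieldInChart (V i) p₀) y (fieldInChart (V j) p₀ y) =
        fderiv ℂ (fieldInChart (V j) p₀) y (fieldInChart (V i) p₀ y))
    (hlin : LinearIndependent ℂ (vecAt V p₀))
    (hF : Module.finrank ℂ F + Fintype.card κ = Module.finrank ℂ E) :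
    ∃ Ξ : OpenPartialHomeomorph M (F × (κ → ℂ)), p₀ ∈ Ξ.source ∧
      (∀ q ∈ Ξ.source, ContMDiffAt 𝓘(ℂ, E) 𝓘(ℂ, F × (κ → ℂ)) ∞ Ξ q) ∧
      (∀ z ∈ Ξ.target, ContMDiffAt 𝓘(ℂ, F × (κ → ℂ)) 𝓘(ℂ, E) ∞ Ξ.symm z) ∧
      (∀ q ∈ Ξ.source, Function.Injective (mfderiv 𝓘(ℂ, E) 𝓘(ℂ, F × (κ → ℂ)) Ξ q)) ∧
      ∀ q ∈ Ξ.source, ∀ i, mfderiv 𝓘(ℂ, E) 𝓘(ℂ, F × (κ → ℂ)) Ξ q (V i q) =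
        ((0, Pi.single i 1) : F × (κ → ℂ)) := by
  set e := chartAt E p₀ with he
  have hp₀ : p₀ ∈ e.source := mem_chart_source E p₀
  have hy₀ : e p₀ ∈ e.target := e.map_source hp₀
  have hec : ∀ q ∈ e.source, MDifferentiableAt 𝓘(ℂ, E) 𝓘(ℂ, E) e q := fun q hq =>
    (contMDiffAt_chartAt_complex hq).mdifferentiableAt (by simp)
  have hfield : ∀ i, ∀ q ∈ e.source, fieldInChart (V i) p₀ (e q) =
      mfderiv 𝓘(ℂ, E) 𝓘(ℂ, E) e q (V i q) := by
    intro i q hq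
    have h : ∀ q', q' = q → (rderiv (E' := E) e q' (V i q') : E) =
        mfderiv 𝓘(ℂ, E) 𝓘(ℂ, E) e q (V i q) := by
      rintro _ rfl
      rw [rderiv_eq_restrictScalars (hec _ hq)]
      rfl
    exact h _ (e.left_inv hq)
  have hlin' : LinearIndependent ℂ (fun i => fieldInChart (V i) p₀ (e p₀)) := by
    have hinj : Function.Injective (mfderiv 𝓘(ℂ, E) 𝓘(ℂ, E) e p₀ : E →L[ℂ] E) := by
      have h1 : Function.Injective (mfderiv 𝓘(ℝ, E) 𝓘(ℝ, E) e p₀) := by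
        obtain ⟨A, hA⟩ := isInvertible_rderiv_chart (p₀ := p₀) hp₀
        rw [← hA]
        exact A.injective
      have h2 := rderiv_eq_restrictScalars (hec _ hp₀)
      intro u v huv
      refine h1 ?_
      exact (DFunLike.congr_fun h2 u).trans (huv.trans (DFunLike.congr_fun h2 v).symm)
    have h3 := hlin.map' (mfderiv 𝓘(ℂ, E) 𝓘(ℂ, E) e p₀ : E →L[ℂ] E).toLinearMap
      (LinearMap.ker_eq_bot.2 hinj)
    have h4 : ∀ L : E →ₗ[ℂ] E, (∀ i, fieldInChart (V i) p₀ (e p₀) = L (vecAt V p₀ i)) →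
        (fun i => fieldInChart (V i) p₀ (e p₀)) = L ∘ vecAt V p₀ := fun L hL => funext hL
    rw [h4 (mfderiv 𝓘(ℂ, E) 𝓘(ℂ, E) e p₀ : E →L[ℂ] E).toLinearMap fun i => hfield i p₀ hp₀]
    exact h3
  obtain ⟨θ, hpθ, hθS, hθ, hθs, hθd⟩ := exists_straightening (F := F) e.open_target hV hcomm hy₀
    hlin' hF
  have hsrc : ∀ q ∈ (e.trans θ).source, q ∈ e.source ∧ e q ∈ θ.source := fun q hq => by
    simpa using hq
  have hsm : ∀ q ∈ (e.trans θ).source,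
      ContMDiffAt 𝓘(ℂ, E) 𝓘(ℂ, F × (κ → ℂ)) ∞ (e.trans θ) q := fun q hq =>
    ContMDiffAt.comp (g := θ) (f := e) (I' := 𝓘(ℂ, E)) q
      (hθ.contDiffAt (θ.open_source.mem_nhds (hsrc q hq).2)).contMDiffAt
      (contMDiffAt_chartAt_complex (hsrc q hq).1)
  have hsms : ∀ z ∈ (e.trans θ).target,
      ContMDiffAt 𝓘(ℂ, F × (κ → ℂ)) 𝓘(ℂ, E) ∞ (e.trans θ).symm z := fun z hz => by
    have hz' : z ∈ θ.target ∧ θ.symm z ∈ e.target := by simpa using hz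
    exact ContMDiffAt.comp (g := e.symm) (f := θ.symm) (I' := 𝓘(ℂ, E)) z
      (contMDiffAt_chartAt_symm_complex hz'.2)
      (hθs.contDiffAt (θ.open_target.mem_nhds hz'.1)).contMDiffAt
  refine ⟨e.trans θ, ?_, hsm, hsms, ?_, ?_⟩
  · simpa using ⟨hp₀, hpθ⟩
  · intro q hq
    have hdiff : (e.trans θ).MDifferentiable 𝓘(ℂ, E) 𝓘(ℂ, F × (κ → ℂ)) :=
      ⟨fun q hq => ((hsm q hq).mdifferentiableAt (by simp)).mdifferentiableWithinAt,
        fun z hz => ((hsms z hz).mdifferentiableAt (by simp)).mdifferentiableWithinAt⟩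
    exact (hdiff.mfderiv hq).injective
  · intro q hq i
    obtain ⟨h1, h2⟩ := hsrc q hq
    have h3 := mfderiv_comp (g := θ) (f := e) (I' := 𝓘(ℂ, E)) (I'' := 𝓘(ℂ, F × (κ → ℂ))) q
      ((hθ.contDiffAt (θ.open_source.mem_nhds h2)).contMDiffAt.mdifferentiableAt (by simp))
      (hec q h1)
    refine (DFunLike.congr_fun h3 (V i q)).trans ?_
    have h4 := hθd (e q) h2 i
    rw [hfield i q h1, ← mfderiv_eq_fderiv] at h4
    exact h4

end StraightenOnManifold

section AdaptedCharts

variable {E : Type*} [NormedAddCommGroup E] [NormedSpace ℂ E] [FiniteDimensional ℂ E]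
  {M : Type*} [TopologicalSpace M] [ChartedSpace E M] [IsManifold 𝓘(ℂ, E) ∞ M] {n : ℕ}

lemma fieldInChart_fieldZ (X Y : Fin n → VField E M) (i : Fin n) (p₀ : M) {y : E}
    (hy : y ∈ (chartAt E p₀).target) :
    fieldInChart (fieldZ X Y i) p₀ y =
      fieldInChart (X i) p₀ y - Complex.I • fieldInChart (Y i) p₀ y := by
  unfold fieldInChart
  refine (map_sub _ _ _).trans ?_
  exact congrArg (fun w : E => fieldInChart (X i) p₀ y - w)
    (rderiv_chart_cJ ((chartAt E p₀).map_target hy) _)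

namespace KillingSystem

variable {Ω : TwoForm E M} {f g : Fin n → M → ℝ} {X Y : Fin n → VField E M}
  {Φ : M → (Fin n → ℝ) × (Fin n → ℝ)} {α : (Fin n → ℝ) × (Fin n → ℝ)}
  (H : KillingSystem Ω f g X Y Φ α)

include H in
lemma contDiffOn_complex (p₀ : M) (i : Fin n ⊕ Fin n) :
    ContDiffOn ℂ ∞ (fieldInChart (Sum.elim X Y i) p₀) (chartAt E p₀).target := by
  rcases i with i | i
  · exact contDiffOn_complex_of_real (chartAt E p₀).open_target
      (contDiffOn_fieldInChart (H.hamX i).smooth p₀) fun y hy u =>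
        fderiv_fieldInChart_I H.kahler (H.smooth_f i) (H.hamX i) (H.killX i) p₀ hy u
  · exact contDiffOn_complex_of_real (chartAt E p₀).open_target
      (contDiffOn_fieldInChart (H.hamY i).smooth p₀) fun y hy u =>
        fderiv_fieldInChart_I H.kahler (H.smooth_g i) (H.hamY i) (H.killY i) p₀ hy u

include H in
lemma differentiableAt_complex (p₀ : M) (i : Fin n ⊕ Fin n) {y : E}
    (hy : y ∈ (chartAt E p₀).target) :
    DifferentiableAt ℂ (fieldInChart (Sum.elim X Y i) p₀) y :=
  ((H.contDiffOn_complex p₀ i).contDiffAt ((chartAt E p₀).open_target.mem_nhds hy)).differentiableAt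
    (by simp)

include H in
/-- The brackets of the `X_i`, `Y_i` vanish in coordinates. -/
lemma fderiv_comm (p₀ : M) (i j : Fin n ⊕ Fin n) {y : E} (hy : y ∈ (chartAt E p₀).target) :
    fderiv ℂ (fieldInChart (Sum.elim X Y i) p₀) y (fieldInChart (Sum.elim X Y j) p₀ y) =
      fderiv ℂ (fieldInChart (Sum.elim X Y j) p₀) y (fieldInChart (Sum.elim X Y i) p₀ y) := by
  have hsm : ∀ i : Fin n ⊕ Fin n, ∀ p, SmoothFieldAt (Sum.elim X Y i) p := by
    rintro (i | i)
    · exact (H.hamX i).smooth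
    · exact (H.hamY i).smooth
  have key : ∀ i j : Fin n ⊕ Fin n, FieldsCommute (Sum.elim X Y i) (Sum.elim X Y j) →
      fderiv ℂ (fieldInChart (Sum.elim X Y i) p₀) y (fieldInChart (Sum.elim X Y j) p₀ y) =
      fderiv ℂ (fieldInChart (Sum.elim X Y j) p₀) y (fieldInChart (Sum.elim X Y i) p₀ y) := by
    intro i j hij
    have h1 := fieldInChart_mlieBracket p₀ hy (hsm i _) (hsm j _)
    have h2 : fieldInChart (VectorField.mlieBracket 𝓘(ℝ, E) (Sum.elim X Y i) (Sum.elim X Y j)) p₀ y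
        = 0 := by
      unfold fieldInChart
      rw [hij]
      exact map_zero _
    rw [h2] at h1
    have h3 : ∀ i v, fderiv ℝ (fieldInChart (Sum.elim X Y i) p₀) y v =
        fderiv ℂ (fieldInChart (Sum.elim X Y i) p₀) y v := fun i v => by
      rw [(H.differentiableAt_complex p₀ i hy).fderiv_restrictScalars ℝ]
      rfl
    rw [h3, h3] at h1
    exact (sub_eq_zero.1 h1.symm).symm
  rcases i with i | i <;> rcases j with j | j
  · exact key _ _ (H.commXX i j)
  · exact key _ _ (H.commXY i j)
  · exact (key (.inl j) (.inr i) (H.commXY j i)).symm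
  · exact key _ _ (H.commYY i j)

include H in
/-- The fields `X_i`, `Z_i` are holomorphic and commute. -/
lemma holomorphic_commuting (p₀ : M) :
    (∀ i, ContDiffOn ℂ ∞ (fieldInChart (Sum.elim X (fieldZ X Y) i) p₀) (chartAt E p₀).target) ∧
    ∀ i j, ∀ y ∈ (chartAt E p₀).target,
      fderiv ℂ (fieldInChart (Sum.elim X (fieldZ X Y) i) p₀) y
        (fieldInChart (Sum.elim X (fieldZ X Y) j) p₀ y) =
      fderiv ℂ (fieldInChart (Sum.elim X (fieldZ X Y) j) p₀) y
        (fieldInChart (Sum.elim X (fieldZ X Y) i) p₀ y) := by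
  have hx : ∀ i, ContDiffOn ℂ ∞ (fieldInChart (X i) p₀) (chartAt E p₀).target :=
    fun i => H.contDiffOn_complex p₀ (.inl i)
  have hy : ∀ i, ContDiffOn ℂ ∞ (fieldInChart (Y i) p₀) (chartAt E p₀).target :=
    fun i => H.contDiffOn_complex p₀ (.inr i)
  refine ⟨?_, ?_⟩
  · rintro (i | i)
    · exact hx i
    · exact ((hx i).sub (contDiffOn_const.smul (hy i))).congr fun y h =>
        fieldInChart_fieldZ X Y i p₀ h
  · intro i j y h
    have hfd : ∀ i v, fderiv ℂ (fieldInChart (fieldZ X Y i) p₀) y v =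
        fderiv ℂ (fieldInChart (X i) p₀) y v -
          Complex.I • fderiv ℂ (fieldInChart (Y i) p₀) y v := by
      intro i v
      have hev : fieldInChart (fieldZ X Y i) p₀ =ᶠ[𝓝 y]
          fun y => fieldInChart (X i) p₀ y - Complex.I • fieldInChart (Y i) p₀ y := by
        filter_upwards [(chartAt E p₀).open_target.mem_nhds h] with z hz
        exact fieldInChart_fieldZ X Y i p₀ hz
      rw [hev.fderiv_eq]
      exact DFunLike.congr_fun ((H.differentiableAt_complex p₀ (.inl i) h).hasFDerivAt.sub
        ((H.differentiableAt_complex p₀ (.inr i) h).hasFDerivAt.const_smul Complex.I)).fderiv v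
    have c1 : ∀ i j, fderiv ℂ (fieldInChart (X i) p₀) y (fieldInChart (X j) p₀ y) =
        fderiv ℂ (fieldInChart (X j) p₀) y (fieldInChart (X i) p₀ y) :=
      fun i j => H.fderiv_comm p₀ (.inl i) (.inl j) h
    have c2 : ∀ i j, fderiv ℂ (fieldInChart (X i) p₀) y (fieldInChart (Y j) p₀ y) =
        fderiv ℂ (fieldInChart (Y j) p₀) y (fieldInChart (X i) p₀ y) :=
      fun i j => H.fderiv_comm p₀ (.inl i) (.inr j) h
    have c3 : ∀ i j, fderiv ℂ (fieldInChart (Y i) p₀) y (fieldInChart (Y j) p₀ y) =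
        fderiv ℂ (fieldInChart (Y j) p₀) y (fieldInChart (Y i) p₀ y) :=
      fun i j => H.fderiv_comm p₀ (.inr i) (.inr j) h
    rcases i with i | i <;> rcases j with j | j <;>
      simp only [Sum.elim_inl, Sum.elim_inr, hfd, fieldInChart_fieldZ X Y _ p₀ h, map_sub,
        map_smul, smul_sub]
    · exact c1 i j
    · rw [c1 i j, c2 i j]
    · rw [c1 i j, c2 j i]
    · rw [c1 i j, c2 i j, c2 j i, c3 i j]
      abel

include H in
/-- Near the level set there are foliation charts of the distribution spanned by the `Z_i`, `W_i`,
in which moreover the distribution spanned by the `X_i`, `Y_i`, `Z_i`, `W_i` is given by the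
vanishing of some of the transverse coordinates. -/
lemma exists_adaptedChart {q k : ℕ} (T : CSpace q ≃L[ℂ] CSpace k × CSpace n)
    (hk : k + 2 * n = Module.finrank ℂ E) {p₀ : M} (hp₀ : Φ p₀ = α) :
    ∃ φ : OpenPartialHomeomorph M (CSpace q × CSpace n), p₀ ∈ φ.source ∧
      IsAdaptedChart (spanFields (fieldZ X Y) (fieldW X Y)) φ ∧
      ∀ r ∈ φ.source, ∀ v : RTangent E r,
        v ∈ spanFields X Y r ⊔ spanFields (fieldZ X Y) (fieldW X Y) r ↔
          rderiv (E' := CSpace k) (fun r : M => (T (φ r).1).1) r v = 0 := by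
  obtain ⟨hV, hcomm⟩ := H.holomorphic_commuting p₀
  have hlin : LinearIndependent ℂ (vecAt (Sum.elim X (fieldZ X Y)) p₀) := by
    convert H.linearIndependent_complex hp₀ using 1
    funext i
    rcases i with i | i <;> rfl
  obtain ⟨Ξ, hpΞ, hΞ, hΞs, hinj, hΞd⟩ := exists_straightening_manifold (F := CSpace k) hV hcomm hlin
    (by simp only [finrank_CSpace, Fintype.card_sum, Fintype.card_fin]; omega)
  let S : (Fin n → ℂ) ≃L[ℂ] CSpace n := ContinuousLinearEquiv.ofFinrankEq (by
    rw [finrank_CSpace, Module.finrank_fin_fun])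
  let R : (Fin n ⊕ Fin n → ℂ) ≃L[ℂ] (Fin n → ℂ) × (Fin n → ℂ) :=
    (LinearEquiv.sumArrowLequivProdArrow (Fin n) (Fin n) ℂ ℂ).toContinuousLinearEquiv
  -- straightening gives coordinates `(c, (s, t))` with `X_i = ∂/∂s_i` and `Z_i = ∂/∂t_i`; they are
  -- regrouped as `((c, s), t)`
  let L : (CSpace k × (Fin n ⊕ Fin n → ℂ)) ≃L[ℂ] CSpace q × CSpace n :=
    (((ContinuousLinearEquiv.refl ℂ (CSpace k)).prodCongr (R.trans (S.prodCongr S))).trans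
      (ContinuousLinearEquiv.prodAssoc ℂ (CSpace k) (CSpace n) (CSpace n)).symm).trans
      (T.symm.prodCongr (ContinuousLinearEquiv.refl ℂ (CSpace n)))
  have hL1 : ∀ u, (L u).1 = T.symm (u.1, S fun i => u.2 (Sum.inl i)) := fun u => rfl
  obtain ⟨φ, hpφ, hφs, hφt, hφ, hφsymm, hprod⟩ :=
    (Ξ.trans L.toHomeomorph.toOpenPartialHomeomorph).exists_restrict_prod (p := p₀)
      (by simpa using hpΞ)
  have hφe : ∀ r, φ r = L (Ξ r) := fun r => congrFun hφ r
  have hsrc : ∀ r ∈ φ.source, r ∈ Ξ.source := fun r hr => by simpa using hφs hr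
  refine ⟨φ, hpφ, ⟨hprod, ?_, ?_, ?_⟩, ?_⟩
  · intro r hr
    have h : ContMDiffAt 𝓘(ℂ, E) 𝓘(ℂ, CSpace q × CSpace n) ∞ (L ∘ Ξ) r :=
      L.contDiff.contMDiff.contMDiffAt.comp r (hΞ r (hsrc r hr))
    rw [hφ]
    exact h.contMDiffWithinAt
  · intro z hz
    have hz' : L.symm z ∈ Ξ.target := by simpa using hφt hz
    have h : ContMDiffAt 𝓘(ℂ, CSpace q × CSpace n) 𝓘(ℂ, E) ∞ (Ξ.symm ∘ L.symm) z :=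
      (hΞs _ hz').comp z L.symm.contDiff.contMDiff.contMDiffAt
    rw [hφsymm]
    exact h.contMDiffWithinAt
  · intro r hr v
    let P : (CSpace k × (Fin n ⊕ Fin n → ℂ)) →L[ℂ] CSpace q := .fst ℂ (CSpace q) (CSpace n) ∘L
      (L : (CSpace k × (Fin n ⊕ Fin n → ℂ)) →L[ℂ] CSpace q × CSpace n)
    have h1 : HasMFDerivAt 𝓘(ℂ, E) 𝓘(ℂ, CSpace q) (fun r => (φ r).1) r
        (P ∘L mfderiv 𝓘(ℂ, E) 𝓘(ℂ, CSpace k × (Fin n ⊕ Fin n → ℂ)) Ξ r) := by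
      have := HasMFDerivAt.comp r P.hasMFDerivAt
        ((hΞ r (hsrc r hr)).mdifferentiableAt (by simp)).hasMFDerivAt
      refine this.congr_of_eventuallyEq (Filter.Eventually.of_forall fun r => ?_)
      exact congrArg Prod.fst (hφe r)
    rw [mem_spanFields_ZW, rderiv_eq_restrictScalars h1.mdifferentiableAt, h1.mfderiv]
    set A : E →L[ℂ] CSpace k × (Fin n ⊕ Fin n → ℂ) :=
      mfderiv 𝓘(ℂ, E) 𝓘(ℂ, CSpace k × (Fin n ⊕ Fin n → ℂ)) Ξ r with hA
    let Q : (CSpace k × (Fin n ⊕ Fin n → ℂ)) ≃ₗ[ℂ] (CSpace k × (Fin n → ℂ)) × (Fin n → ℂ) :=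
      ((LinearEquiv.refl ℂ (CSpace k)).prodCongr R.toLinearEquiv).trans
        (LinearEquiv.prodAssoc ℂ (CSpace k) (Fin n → ℂ) (Fin n → ℂ)).symm
    have h2 := mem_span_iff_of_coordinates (A := Q.toLinearMap ∘ₗ A.toLinearMap)
      (Q.injective.comp (hinj r (hsrc r hr))) (z := vecAt (fieldZ X Y) r) (fun i => by
        have h3 : A (vecAt (fieldZ X Y) r i) = (0, Pi.single (Sum.inr i) 1) :=
          hΞd r (hsrc r hr) (Sum.inr i)
        rw [LinearMap.comp_apply, ContinuousLinearMap.coe_coe, h3]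
        refine Prod.ext (Prod.ext rfl (funext fun j => ?_)) (funext fun j => ?_)
        · exact Pi.single_eq_of_ne (M := fun _ : Fin n ⊕ Fin n => ℂ) (i := Sum.inr i)
            (i' := Sum.inl j) Sum.inl_ne_inr 1
        · change (Pi.single (Sum.inr i) 1 : Fin n ⊕ Fin n → ℂ) (Sum.inr j) = (Pi.single i 1 : Fin n → ℂ) j
          simp only [Pi.single_apply, Sum.inr.injEq]) v
    refine h2.trans ?_
    change ((A v).1, fun i => (A v).2 (Sum.inl i)) = (0 : CSpace k × (Fin n → ℂ)) ↔
      T.symm ((A v).1, S fun i => (A v).2 (Sum.inl i)) = 0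
    rw [EmbeddingLike.map_eq_zero_iff, Prod.mk_eq_zero, Prod.mk_eq_zero,
      EmbeddingLike.map_eq_zero_iff]
  · intro r hr v
    have h1 : HasMFDerivAt 𝓘(ℂ, E) 𝓘(ℂ, CSpace k) (fun r => (T (φ r).1).1) r
        ((ContinuousLinearMap.fst ℂ (CSpace k) (Fin n ⊕ Fin n → ℂ)) ∘L
          mfderiv 𝓘(ℂ, E) 𝓘(ℂ, CSpace k × (Fin n ⊕ Fin n → ℂ)) Ξ r) := by
      have := HasMFDerivAt.comp r
        (ContinuousLinearMap.fst ℂ (CSpace k) (Fin n ⊕ Fin n → ℂ)).hasMFDerivAt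
        ((hΞ r (hsrc r hr)).mdifferentiableAt (by simp)).hasMFDerivAt
      refine this.congr_of_eventuallyEq (Filter.Eventually.of_forall fun r => ?_)
      change (T (φ r).1).1 = (Ξ r).1
      rw [hφe, hL1, T.apply_symm_apply]
    rw [mem_sup_spanFields, rderiv_eq_restrictScalars h1.mdifferentiableAt, h1.mfderiv]
    exact mem_span_iff_of_coordinates (E := E)
      (A := (mfderiv 𝓘(ℂ, E) 𝓘(ℂ, CSpace k × (Fin n ⊕ Fin n → ℂ)) Ξ r : E →L[ℂ] _).toLinearMap)
      (hinj r (hsrc r hr)) (fun i => by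
        rcases i with i | i
        · exact hΞd r (hsrc r hr) (Sum.inl i)
        · exact hΞd r (hsrc r hr) (Sum.inr i)) v

end KillingSystem
end AdaptedCharts

/-! ### Slice charts of the level set -/

section InverseFunction

/-- The inverse function theorem, with a smooth inverse on a whole neighbourhood. -/
lemma exists_smooth_local_inverse {E F : Type*} [NormedAddCommGroup E] [NormedSpace ℝ E]
    [FiniteDimensional ℝ E] [NormedAddCommGroup F] [NormedSpace ℝ F] [FiniteDimensional ℝ F]
    {G : E → F} {O : Set E} (hO : IsOpen O) (hG : ∀ y ∈ O, ContDiffAt ℝ ∞ G y) {y₀ : E}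
    (hy₀ : y₀ ∈ O) (hbij : Function.Bijective (fderiv ℝ G y₀)) :
    ∃ Λ : OpenPartialHomeomorph E F, y₀ ∈ Λ.source ∧ Λ.source ⊆ O ∧ (Λ : E → F) = G ∧
      ∀ z ∈ Λ.target, ContDiffAt ℝ ∞ Λ.symm z := by
  have : CompleteSpace E := FiniteDimensional.complete ℝ E
  have : CompleteSpace F := FiniteDimensional.complete ℝ F
  let A : E ≃L[ℝ] F :=
    (LinearEquiv.ofBijective (fderiv ℝ G y₀).toLinearMap hbij).toContinuousLinearEquiv
  have hG0 := hG y₀ hy₀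
  have hA : HasFDerivAt G (A : E →L[ℝ] F) y₀ := by
    refine (hG0.differentiableAt (by simp)).hasFDerivAt.congr_fderiv ?_
    ext; rfl
  have hinv : ∀ᶠ u in 𝓝 y₀, (fderiv ℝ G u).IsInvertible := by
    refine (hG0.continuousAt_fderiv (by simp)).eventually ?_
    rw [hA.fderiv]
    exact ContinuousLinearEquiv.nhds A
  obtain ⟨T, hT, hTo, hT0⟩ := eventually_nhds_iff.1 (hinv.and (hO.mem_nhds hy₀))
  set Λ := hG0.toOpenPartialHomeomorph G hA (by simp) with hΛ
  have hΛs : (Λ.restrOpen T hTo).source = Λ.source ∩ T := by simp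
  refine ⟨Λ.restrOpen T hTo, ?_, ?_, rfl, ?_⟩
  · rw [hΛs]
    exact ⟨hG0.mem_toOpenPartialHomeomorph_source hA (by simp), hT0⟩
  · rw [hΛs]
    exact fun y hy => (hT y hy.2).2
  · intro z hz
    have hu : (Λ.restrOpen T hTo).symm z ∈ T := (hΛs ▸ (Λ.restrOpen T hTo).map_target hz).2
    obtain ⟨⟨B, hB⟩, hyO⟩ := hT _ hu
    refine (Λ.restrOpen T hTo).contDiffAt_symm (f₀' := B) hz ?_ (hG _ hyO)
    rw [hB]
    exact ((hG _ hyO).differentiableAt (by simp)).hasFDerivAt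

end InverseFunction

section Slices

variable {M Q V : Type*} [TopologicalSpace M] [TopologicalSpace Q] [TopologicalSpace V]
  {Φ : M → V} {α : V}

open Classical in
/-- A coordinate system whose second component is `Φ` restricts to a coordinate system of the level
set of `Φ`. The point `p` is the junk value of the inverse outside of the target. -/
noncomputable def sliceChart (Ψ : OpenPartialHomeomorph M (Q × V))
    (hΨ : ∀ r ∈ Ψ.source, (Ψ r).2 = Φ r) (p : LevelSet Φ α) :
    OpenPartialHomeomorph (LevelSet Φ α) Q where
  toFun r := (Ψ r.1).1
  invFun x := if h : Φ (Ψ.symm (x, α)) = α then ⟨Ψ.symm (x, α), h⟩ else p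
  source := Subtype.val ⁻¹' Ψ.source
  target := {x | (x, α) ∈ Ψ.target}
  map_source' r hr := by
    have h : ((Ψ r.1).1, α) = Ψ r.1 := Prod.ext rfl ((hΨ _ hr).trans r.2).symm
    change ((Ψ r.1).1, α) ∈ Ψ.target
    rw [h]
    exact Ψ.map_source hr
  map_target' x hx := by
    have h : Φ (Ψ.symm (x, α)) = α := by
      rw [← hΨ _ (Ψ.map_target hx), Ψ.right_inv hx]
    rw [dif_pos h]
    exact Ψ.map_target hx
  left_inv' r hr := by
    have h : ((Ψ r.1).1, α) = Ψ r.1 := Prod.ext rfl ((hΨ _ hr).trans r.2).symm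
    have h2 : Ψ.symm ((Ψ r.1).1, α) = r.1 := by rw [h, Ψ.left_inv hr]
    have h3 : Φ (Ψ.symm ((Ψ r.1).1, α)) = α := by rw [h2]; exact r.2
    rw [dif_pos h3]
    exact Subtype.ext h2
  right_inv' x hx := by
    have h : Φ (Ψ.symm (x, α)) = α := by
      rw [← hΨ _ (Ψ.map_target hx), Ψ.right_inv hx]
    rw [dif_pos h]
    change (Ψ (Ψ.symm (x, α))).1 = x
    rw [Ψ.right_inv hx]
  open_source := Ψ.open_source.preimage continuous_subtype_val
  open_target := Ψ.open_target.preimage (by fun_prop : Continuous fun x : Q => (x, α))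
  continuousOn_toFun := continuous_fst.comp_continuousOn
    (Ψ.continuousOn.comp continuous_subtype_val.continuousOn fun _ h => h)
  continuousOn_invFun := by
    have hind : Topology.IsInducing (Subtype.val : LevelSet Φ α → M) := ⟨rfl⟩
    rw [hind.continuousOn_iff]
    have h1 : ContinuousOn (fun x : Q => Ψ.symm (x, α)) {x | (x, α) ∈ Ψ.target} :=
      Ψ.continuousOn_symm.comp (by fun_prop : Continuous fun x : Q => (x, α)).continuousOn
        fun _ h => h
    refine h1.congr fun x hx => ?_
    have h : Φ (Ψ.symm (x, α)) = α := by
      rw [← hΨ _ (Ψ.map_target hx), Ψ.right_inv hx]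
    simp only [Function.comp_apply, dif_pos h]

lemma sliceChart_symm_val (Ψ : OpenPartialHomeomorph M (Q × V))
    (hΨ : ∀ r ∈ Ψ.source, (Ψ r).2 = Φ r) (p : LevelSet Φ α) {x : Q} (hx : (x, α) ∈ Ψ.target) :
    ((sliceChart Ψ hΨ p).symm x).1 = Ψ.symm (x, α) := by
  have h : Φ (Ψ.symm (x, α)) = α := by
    rw [← hΨ _ (Ψ.map_target hx), Ψ.right_inv hx]
  exact congrArg Subtype.val (dif_pos h)

end Slices

section SliceCharts

variable {E : Type*} [NormedAddCommGroup E] [NormedSpace ℂ E] [FiniteDimensional ℂ E]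
  {M : Type*} [TopologicalSpace M] [ChartedSpace E M] [IsManifold 𝓘(ℂ, E) ∞ M] {n q : ℕ}

/-- A coordinate system of `M` consisting of the transverse coordinates of the foliation chart `φ`
and of the map `Φ`. -/
structure IsTransverseChart (Φ : M → (Fin n → ℝ) × (Fin n → ℝ))
    (φ : OpenPartialHomeomorph M (CSpace q × CSpace n))
    (Ψ : OpenPartialHomeomorph M (CSpace q × ((Fin n → ℝ) × (Fin n → ℝ)))) : Prop where
  source_subset : Ψ.source ⊆ φ.source
  eq : ∀ r ∈ Ψ.source, Ψ r = ((φ r).1, Φ r)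
  smooth : ∀ r ∈ Ψ.source,
    ContMDiffAt 𝓘(ℝ, E) 𝓘(ℝ, CSpace q × ((Fin n → ℝ) × (Fin n → ℝ))) ∞ Ψ r
  smooth_symm : ∀ z ∈ Ψ.target,
    ContMDiffAt 𝓘(ℝ, CSpace q × ((Fin n → ℝ) × (Fin n → ℝ))) 𝓘(ℝ, E) ∞ Ψ.symm z

/-- A coordinate system of the level set `Φ⁻¹(α)` given by the transverse coordinates of a foliation
chart adapted to the distribution `D`. -/
def IsSliceChart (D : ∀ p : M, Submodule ℝ (RTangent E p)) (Φ : M → (Fin n → ℝ) × (Fin n → ℝ))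
    (α : (Fin n → ℝ) × (Fin n → ℝ)) (c : OpenPartialHomeomorph (LevelSet Φ α) (CSpace q)) : Prop :=
  ∃ (φ : OpenPartialHomeomorph M (CSpace q × CSpace n))
    (Ψ : OpenPartialHomeomorph M (CSpace q × ((Fin n → ℝ) × (Fin n → ℝ)))),
    IsAdaptedChart D φ ∧ IsTransverseChart (E := E) Φ φ Ψ ∧
    c.source = Subtype.val ⁻¹' Ψ.source ∧ (∀ r ∈ c.source, c r = (φ r.1).1) ∧
    ∀ x ∈ c.target, (x, α) ∈ Ψ.target ∧ (c.symm x).1 = Ψ.symm (x, α)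

lemma IsTransverseChart.exists_sliceChart {D : ∀ p : M, Submodule ℝ (RTangent E p)}
    {Φ : M → (Fin n → ℝ) × (Fin n → ℝ)} {α : (Fin n → ℝ) × (Fin n → ℝ)}
    {φ : OpenPartialHomeomorph M (CSpace q × CSpace n)}
    {Ψ : OpenPartialHomeomorph M (CSpace q × ((Fin n → ℝ) × (Fin n → ℝ)))}
    (hφ : IsAdaptedChart D φ) (hΨ : IsTransverseChart (E := E) Φ φ Ψ)
    (p : LevelSet Φ α) (hp : p.1 ∈ Ψ.source) :
    ∃ c : OpenPartialHomeomorph (LevelSet Φ α) (CSpace q), IsSliceChart D Φ α c ∧ p ∈ c.source ∧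
      c.source ⊆ Subtype.val ⁻¹' φ.source ∧ ∀ r ∈ c.source, c r = (φ r.1).1 := by
  have h2 : ∀ r ∈ Ψ.source, (Ψ r).2 = Φ r := fun r hr => by rw [hΨ.eq r hr]
  have h1 : ∀ r ∈ (sliceChart Ψ h2 p).source, sliceChart Ψ h2 p r = (φ r.1).1 :=
    fun r hr => congrArg Prod.fst (hΨ.eq r.1 hr)
  exact ⟨sliceChart Ψ h2 p, ⟨φ, Ψ, hφ, hΨ, rfl, h1,
    fun x hx => ⟨hx, sliceChart_symm_val Ψ h2 p hx⟩⟩, hp, fun r hr => hΨ.source_subset hr, h1⟩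

/-- The transition maps between slice charts are holomorphic: they are transition maps of the
transverse coordinates of the foliation, although the level set itself is only a real submanifold. -/
lemma IsSliceChart.contDiffAt_transition {D : ∀ p : M, Submodule ℝ (RTangent E p)}
    {Φ : M → (Fin n → ℝ) × (Fin n → ℝ)} {α : (Fin n → ℝ) × (Fin n → ℝ)}
    {c c' : OpenPartialHomeomorph (LevelSet Φ α) (CSpace q)} (hc : IsSliceChart D Φ α c)
    (hc' : IsSliceChart D Φ α c') {x : CSpace q} (hx : x ∈ (c.symm.trans c').source) :
    ContDiffAt ℂ ∞ (c.symm.trans c') x := by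
  obtain ⟨φ, Ψ, hφ, hΨ, hs, he, -⟩ := hc
  obtain ⟨φ', Ψ', hφ', hΨ', hs', he', -⟩ := hc'
  have hx' : x ∈ c.target ∧ c.symm x ∈ c'.source := by simpa using hx
  have hr : c.symm x ∈ c.source := c.map_target hx'.1
  have hφr : ∀ r ∈ c.source, r.1 ∈ φ.source :=
    fun r hr => hΨ.source_subset (by rw [hs] at hr; exact hr)
  have hφr' : ∀ r ∈ c'.source, r.1 ∈ φ'.source :=
    fun r hr => hΨ'.source_subset (by rw [hs'] at hr; exact hr)
  obtain ⟨g, hg, hev⟩ := hφ.exists_transition hφ' ⟨hφr _ hr, hφr' _ hx'.2⟩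
  rw [← he _ hr, c.right_inv hx'.1] at hg
  refine hg.congr_of_eventuallyEq ?_
  have hcont : Filter.Tendsto (fun x => φ (c.symm x).1) (𝓝 x) (𝓝 (φ (c.symm x).1)) :=
    ((φ.continuousAt (hφr _ hr)).comp continuous_subtype_val.continuousAt).comp
      (c.continuousAt_symm hx'.1)
  filter_upwards [(c.symm.trans c').open_source.mem_nhds hx, hcont.eventually hev] with y hy hgy
  have hy' : y ∈ c.target ∧ c.symm y ∈ c'.source := by simpa using hy
  have hry : c.symm y ∈ c.source := c.map_target hy'.1
  rw [φ.left_inv (hφr _ hry), ← he _ hry, c.right_inv hy'.1] at hgy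
  rw [← hgy]
  exact he' _ hy'.2

namespace KillingSystem

variable {Ω : TwoForm E M} {f g : Fin n → M → ℝ} {X Y : Fin n → VField E M}
  {Φ : M → (Fin n → ℝ) × (Fin n → ℝ)} {α : (Fin n → ℝ) × (Fin n → ℝ)}
  (H : KillingSystem Ω f g X Y Φ α)

lemma exists_of_mem_spanFields {X Y : Fin n → VField E M} {p : M} {v : RTangent E p}
    (hv : v ∈ spanFields X Y p) :
    ∃ a b : Fin n → ℝ, v = ∑ i, a i • X i p + ∑ i, b i • Y i p := by
  rw [spanFields, Submodule.span_union, Submodule.mem_sup] at hv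
  obtain ⟨s, hs, t, ht, rfl⟩ := hv
  obtain ⟨a, rfl⟩ := (Submodule.mem_span_range_iff_exists_fun ℝ).1 hs
  obtain ⟨b, rfl⟩ := (Submodule.mem_span_range_iff_exists_fun ℝ).1 ht
  exact ⟨a, b, rfl⟩

lemma sum_mem_spanFields (X Y : Fin n → VField E M) (p : M) (a b : Fin n → ℝ) :
    ∑ i, a i • X i p + ∑ i, b i • Y i p ∈ spanFields X Y p :=
  add_mem (Submodule.sum_mem _ fun i _ => Submodule.smul_mem _ _
      (Submodule.subset_span (Or.inl ⟨i, rfl⟩)))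
    (Submodule.sum_mem _ fun i _ => Submodule.smul_mem _ _
      (Submodule.subset_span (Or.inr ⟨i, rfl⟩)))

/-- Every vector in the span of the `Z_i`, `W_i` is `t + Js` with `t`, `s` in the span of the
`X_i`, `Y_i`. -/
lemma exists_add_cJ {p : M} {v : RTangent E p}
    (hv : v ∈ spanFields (fieldZ X Y) (fieldW X Y) p) :
    ∃ a b : Fin n → ℝ, v = (∑ i, a i • X i p + ∑ i, b i • Y i p) +
      cJ E p (∑ i, b i • X i p + ∑ i, -a i • Y i p) := by
  obtain ⟨a, b, rfl⟩ := exists_of_mem_spanFields hv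
  refine ⟨a, b, ?_⟩
  simp only [fieldZ, fieldW, smul_sub, smul_add, Finset.sum_sub_distrib, Finset.sum_add_distrib,
    map_add, map_sum, map_smul, map_neg, neg_smul, Finset.sum_neg_distrib]
  abel

include H in
/-- The span of the `Z_i`, `W_i` is transverse to the level set: if `v = t + Js` is tangent to the
level set, then `0 = Ω(s, v) = Ω(s, Js)`, so that `s = 0`, and `s` determines `v`. -/
lemma eq_zero_of_mfderiv_eq_zero {p : M} (hp : Φ p = α) {v : RTangent E p}
    (hv : v ∈ spanFields (fieldZ X Y) (fieldW X Y) p)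
    (h0 : mfderiv 𝓘(ℝ, E) 𝓘(ℝ, (Fin n → ℝ) × (Fin n → ℝ)) Φ p v = 0) : v = 0 := by
  obtain ⟨a, b, hab⟩ := exists_add_cJ hv
  set t := ∑ i, a i • X i p + ∑ i, b i • Y i p with ht
  set s := ∑ i, b i • X i p + ∑ i, -a i • Y i p with hs
  have htm : t ∈ spanFields X Y p := sum_mem_spanFields X Y p a b
  have hsm : s ∈ spanFields X Y p := sum_mem_spanFields X Y p b fun i => -a i
  have h1 := (H.mfderiv_eq_zero_iff p v).1 h0 s hsm
  rw [hab, map_add, H.isotropic hp hsm htm, zero_add, TwoForm.bilin_swap, neg_eq_zero] at h1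
  have hs0 : s = 0 := H.eq_zero_of_bilin_cJ h1
  obtain ⟨hb, ha⟩ := H.linearIndependent_real hp b (fun i => -a i) hs0
  have ha' : ∀ i, a i = 0 := fun i => neg_eq_zero.1 (congrFun ha i)
  rw [hab, hs0, ht]
  simp [ha', hb]

include H in
/-- Along the level set, the transverse coordinates of a foliation chart together with `Φ` are
coordinates of `M`: their differentials have no common kernel, and the dimensions agree. -/
lemma exists_transverseChart (hq : q + n = Module.finrank ℂ E)
    {φ : OpenPartialHomeomorph M (CSpace q × CSpace n)}
    (hφ : IsAdaptedChart (spanFields (fieldZ X Y) (fieldW X Y)) φ) {p : M} (hp : Φ p = α)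
    (hpφ : p ∈ φ.source) :
    ∃ Ψ : OpenPartialHomeomorph M (CSpace q × ((Fin n → ℝ) × (Fin n → ℝ))),
      IsTransverseChart (E := E) Φ φ Ψ ∧ p ∈ Ψ.source := by
  set e := chartAt E p with he
  have hpe : p ∈ e.source := mem_chart_source E p
  have : FiniteDimensional ℝ E := FiniteDimensional.complexToReal E
  have : FiniteDimensional ℝ (CSpace q) := FiniteDimensional.complexToReal (CSpace q)
  set G : E → CSpace q × ((Fin n → ℝ) × (Fin n → ℝ)) :=
    fun y => ((φ (e.symm y)).1, Φ (e.symm y)) with hG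
  set O : Set E := e.target ∩ e.symm ⁻¹' φ.source with hO
  have hOo : IsOpen O := e.symm.isOpen_inter_preimage φ.open_source
  have hy₀ : e p ∈ O := ⟨e.map_source hpe, by
    change e.symm (e p) ∈ φ.source
    rw [e.left_inv hpe]; exact hpφ⟩
  have hG1 : ∀ r ∈ φ.source, ContMDiffAt 𝓘(ℝ, E) 𝓘(ℝ, CSpace q) ∞ (fun r => (φ r).1) r :=
    fun r hr => (hφ.contMDiffAt_fst hr).real_of_complex
  have hsym : ∀ y ∈ e.target, ContMDiffAt 𝓘(ℝ, E) 𝓘(ℝ, E) ∞ e.symm y :=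
    fun y hy => (contMDiffAt_chartAt_symm_complex hy).real_of_complex
  have hc1 : ∀ y ∈ O, ContMDiffAt 𝓘(ℝ, E) 𝓘(ℝ, CSpace q) ∞ ((fun r => (φ r).1) ∘ e.symm) y :=
    fun y hy => (hG1 _ hy.2).comp y (hsym y hy.1)
  have hc2 : ∀ y ∈ O, ContMDiffAt 𝓘(ℝ, E) 𝓘(ℝ, (Fin n → ℝ) × (Fin n → ℝ)) ∞ (Φ ∘ e.symm) y :=
    fun y hy => (H.smooth_Φ _).comp y (hsym y hy.1)
  have hGc : ∀ y ∈ O, ContDiffAt ℝ ∞ G y := fun y hy =>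
    (hc1 y hy).contDiffAt.prodMk (hc2 y hy).contDiffAt
  have hd : ∀ u, fderiv ℝ G (e p) u =
      (rderiv (E' := CSpace q) (fun r => (φ r).1) (e.symm (e p))
        (rderiv (E := E) (E' := E) e.symm (e p) u),
       mfderiv 𝓘(ℝ, E) 𝓘(ℝ, (Fin n → ℝ) × (Fin n → ℝ)) Φ (e.symm (e p))
        (rderiv (E := E) (E' := E) e.symm (e p) u)) := by
    intro u
    have h1 := mfderiv_comp (I' := 𝓘(ℝ, E)) (g := fun r => (φ r).1) (f := e.symm) (e p)
      ((hG1 _ hy₀.2).mdifferentiableAt (by simp)) ((hsym _ hy₀.1).mdifferentiableAt (by simp))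
    have h2 := mfderiv_comp (I' := 𝓘(ℝ, E)) (g := Φ) (f := e.symm) (e p)
      ((H.smooth_Φ _).mdifferentiableAt (by simp)) ((hsym _ hy₀.1).mdifferentiableAt (by simp))
    rw [mfderiv_eq_fderiv] at h1 h2
    have h3 := (((hc1 _ hy₀).contDiffAt.differentiableAt (by simp)).hasFDerivAt.prodMk
      ((hc2 _ hy₀).contDiffAt.differentiableAt (by simp)).hasFDerivAt).fderiv
    refine (DFunLike.congr_fun h3 u).trans ?_
    exact Prod.ext (DFunLike.congr_fun h1 u) (DFunLike.congr_fun h2 u)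
  have hinj : Function.Injective (fderiv ℝ G (e p)) := by
    rw [injective_iff_map_eq_zero]
    intro u hu
    rw [hd] at hu
    have h0 := H.eq_zero_of_mfderiv_eq_zero (by rw [e.left_inv hpe]; exact hp)
      ((hφ.mem_iff _ hy₀.2 _).2 (congrArg Prod.fst hu)) (congrArg Prod.snd hu)
    have h1 := rderiv_chart_rderiv_symm hy₀.1 u
    rw [← h1]
    exact (congrArg _ h0).trans (map_zero _)
  have hbij : Function.Bijective (fderiv ℝ G (e p)) := by
    refine ⟨hinj, (LinearMap.injective_iff_surjective_of_finrank_eq_finrank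
      (f := (fderiv ℝ G (e p)).toLinearMap) ?_).1 hinj⟩
    rw [Module.finrank_prod, Module.finrank_prod, Module.finrank_fin_fun,
      finrank_real_of_complex, finrank_real_of_complex, finrank_CSpace]
    omega
  obtain ⟨Λ, hΛ0, hΛs, hΛ, hΛsymm⟩ := exists_smooth_local_inverse hOo hGc hy₀ hbij
  have hsrc : ∀ r ∈ (e.trans Λ).source, r ∈ e.source ∧ e r ∈ Λ.source := fun r hr => by
    simpa using hr
  refine ⟨e.trans Λ, ⟨?_, ?_, ?_, ?_⟩, by simpa using ⟨hpe, hΛ0⟩⟩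
  · intro r hr
    obtain ⟨h1, h2⟩ := hsrc r hr
    have h3 := (hΛs h2).2
    rw [Set.mem_preimage, e.left_inv h1] at h3
    exact h3
  · intro r hr
    obtain ⟨h1, h2⟩ := hsrc r hr
    change Λ (e r) = _
    rw [hΛ, hG]
    simp only [e.left_inv h1]
  · intro r hr
    obtain ⟨h1, h2⟩ := hsrc r hr
    refine ContMDiffAt.comp (g := Λ) (f := e) (I' := 𝓘(ℝ, E)) r ?_
      (contMDiffAt_chartAt_complex h1).real_of_complex
    rw [hΛ]
    exact (hGc _ (hΛs h2)).contMDiffAt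
  · intro z hz
    have hz' : z ∈ Λ.target ∧ Λ.symm z ∈ e.target := by simpa using hz
    exact ContMDiffAt.comp (g := e.symm) (f := Λ.symm) (I' := 𝓘(ℝ, E)) z (hsym _ hz'.2)
      (hΛsymm z hz'.1).contMDiffAt

include H in
lemma exists_sliceChart (hq : q + n = Module.finrank ℂ E)
    {φ : OpenPartialHomeomorph M (CSpace q × CSpace n)}
    (hφ : IsAdaptedChart (spanFields (fieldZ X Y) (fieldW X Y)) φ) (p : LevelSet Φ α)
    (hpφ : p.1 ∈ φ.source) :
    ∃ c : OpenPartialHomeomorph (LevelSet Φ α) (CSpace q),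
      IsSliceChart (spanFields (fieldZ X Y) (fieldW X Y)) Φ α c ∧ p ∈ c.source ∧
      c.source ⊆ Subtype.val ⁻¹' φ.source ∧ ∀ r ∈ c.source, c r = (φ r.1).1 := by
  obtain ⟨Ψ, hΨ, hpΨ⟩ := H.exists_transverseChart hq hφ p.2 hpφ
  exact hΨ.exists_sliceChart hφ p hpΨ

end KillingSystem
end SliceCharts

/-! ### The complex manifold structure of the level set -/

section LevelSetManifold

variable {E : Type*} [NormedAddCommGroup E] [NormedSpace ℂ E] [FiniteDimensional ℂ E]
  {M : Type*} [TopologicalSpace M] [ChartedSpace E M] [IsManifold 𝓘(ℂ, E) ∞ M] {n q : ℕ}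

lemma mem_maximalAtlas_of_contMDiffAt {Θ : OpenPartialHomeomorph M E}
    (h1 : ∀ r ∈ Θ.source, ContMDiffAt 𝓘(ℝ, E) 𝓘(ℝ, E) ∞ Θ r)
    (h2 : ∀ y ∈ Θ.target, ContMDiffAt 𝓘(ℝ, E) 𝓘(ℝ, E) ∞ Θ.symm y) :
    Θ ∈ IsManifold.maximalAtlas 𝓘(ℝ, E) ∞ M := by
  refine (mem_maximalAtlas_iff (G := contDiffGroupoid ∞ 𝓘(ℝ, E))).2 fun e he => ?_
  have he' := IsManifold.subset_maximalAtlas (I := 𝓘(ℝ, E)) (n := ∞) he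
  have ha : ∀ y ∈ (Θ.symm.trans e).source, ContDiffAt ℝ ∞ (Θ.symm.trans e) y := by
    intro y hy
    have hy' : y ∈ Θ.target ∧ Θ.symm y ∈ e.source := by simpa using hy
    exact (ContMDiffAt.comp (g := e) (f := Θ.symm) (I' := 𝓘(ℝ, E)) y
      (contMDiffAt_of_mem_maximalAtlas he' hy'.2) (h2 y hy'.1)).contDiffAt
  have hb : ∀ y ∈ (e.symm.trans Θ).source, ContDiffAt ℝ ∞ (e.symm.trans Θ) y := by
    intro y hy
    have hy' : y ∈ e.target ∧ e.symm y ∈ Θ.source := by simpa using hy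
    exact (ContMDiffAt.comp (g := Θ) (f := e.symm) (I' := 𝓘(ℝ, E)) y
      (h1 _ hy'.2) (contMDiffAt_symm_of_mem_maximalAtlas he' hy'.1)).contDiffAt
  have hmem : ∀ c d : OpenPartialHomeomorph M E,
      (∀ y ∈ (c.symm.trans d).source, ContDiffAt ℝ ∞ (c.symm.trans d) y) →
      (∀ y ∈ (d.symm.trans c).source, ContDiffAt ℝ ∞ (d.symm.trans c) y) →
      c.symm.trans d ∈ contDiffGroupoid ∞ 𝓘(ℝ, E) := by
    intro c d hcd hdc
    rw [contDiffGroupoid, mem_groupoid_of_pregroupoid]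
    simp only [contDiffPregroupoid]
    refine ⟨fun y hy => ?_, fun y hy => ?_⟩
    · exact (hcd y hy.1).contDiffWithinAt
    · refine (hdc y ?_).contDiffWithinAt
      have : y ∈ (c.symm.trans d).target := hy.1
      simpa [and_comm] using this
  exact ⟨hmem _ _ ha hb, hmem _ _ hb ha⟩

variable {D : ∀ p : M, Submodule ℝ (RTangent E p)}
  {Φ : M → (Fin n → ℝ) × (Fin n → ℝ)} {α : (Fin n → ℝ) × (Fin n → ℝ)}
  [ChartedSpace (CSpace q) (LevelSet Φ α)]
  (hat : atlas (CSpace q) (LevelSet Φ α) = {c | IsSliceChart D Φ α c})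

include hat in
lemma isManifold_levelSet : IsManifold 𝓘(ℂ, CSpace q) ∞ (LevelSet Φ α) := by
  refine isManifold_of_contDiffOn _ _ _ fun c c' hc hc' => ?_
  rw [hat] at hc hc'
  intro x hx
  exact (hc.contDiffAt_transition hc' hx.1).contDiffWithinAt

variable [IsManifold 𝓘(ℂ, CSpace q) ∞ (LevelSet Φ α)]

include hat in
lemma IsSliceChart.contMDiffAt {c : OpenPartialHomeomorph (LevelSet Φ α) (CSpace q)}
    (hc : IsSliceChart D Φ α c) {r : LevelSet Φ α} (hr : r ∈ c.source) :
    ContMDiffAt 𝓘(ℂ, CSpace q) 𝓘(ℂ, CSpace q) ∞ c r :=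
  contMDiffAt_of_mem_maximalAtlas (IsManifold.subset_maximalAtlas (by rw [hat]; exact hc)) hr

include hat in
lemma IsSliceChart.contMDiffAt_symm {c : OpenPartialHomeomorph (LevelSet Φ α) (CSpace q)}
    (hc : IsSliceChart D Φ α c) {x : CSpace q} (hx : x ∈ c.target) :
    ContMDiffAt 𝓘(ℂ, CSpace q) 𝓘(ℂ, CSpace q) ∞ c.symm x :=
  contMDiffAt_symm_of_mem_maximalAtlas (IsManifold.subset_maximalAtlas (by rw [hat]; exact hc)) hx

include hat in
lemma isImmersion_incl (hq : q + n = Module.finrank ℂ E) :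
    Manifold.IsImmersion 𝓘(ℝ, CSpace q) 𝓘(ℝ, E) ∞ (LevelSet.incl Φ α) := by
  have : FiniteDimensional ℝ E := FiniteDimensional.complexToReal E
  have : FiniteDimensional ℝ (CSpace q) := FiniteDimensional.complexToReal (CSpace q)
  have hdim : Module.finrank ℝ (CSpace q × ((Fin n → ℝ) × (Fin n → ℝ))) = Module.finrank ℝ E := by
    rw [Module.finrank_prod, Module.finrank_prod, Module.finrank_fin_fun,
      finrank_real_of_complex, finrank_real_of_complex, finrank_CSpace]
    omega
  let L : (CSpace q × ((Fin n → ℝ) × (Fin n → ℝ))) ≃L[ℝ] E := ContinuousLinearEquiv.ofFinrankEq hdim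
  refine Manifold.IsImmersionOfComplement.isImmersion
    (F := (Fin n → ℝ) × (Fin n → ℝ)) fun p => ?_
  have hc := chart_mem_atlas (CSpace q) p
  have hp := mem_chart_source (CSpace q) p
  have hc' := hc
  rw [hat] at hc'
  set c := chartAt (CSpace q) p
  obtain ⟨φ, Ψ, -, hΨ, hs, -, ht⟩ := hc'
  -- the translation moves the slice `(x, α)` to the slice `(x, 0)`
  let τ : (CSpace q × ((Fin n → ℝ) × (Fin n → ℝ))) ≃ₜ E :=
    (Homeomorph.subRight ((0 : CSpace q), α)).trans L.toHomeomorph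
  have hτ : ContDiff ℝ ∞ τ := L.contDiff.comp (contDiff_id.sub contDiff_const)
  have hτs : ContDiff ℝ ∞ τ.symm := (contDiff_id.add contDiff_const).comp L.symm.contDiff
  have hmax : Ψ.trans τ.toOpenPartialHomeomorph ∈ IsManifold.maximalAtlas 𝓘(ℝ, E) ∞ M := by
    refine mem_maximalAtlas_of_contMDiffAt (fun r hr => ?_) fun y hy => ?_
    · have hr' : r ∈ Ψ.source := by simpa using hr
      exact ContMDiffAt.comp (g := τ) (f := Ψ) r hτ.contMDiff.contMDiffAt (hΨ.smooth r hr')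
    · have hy' : τ.symm y ∈ Ψ.target := by simpa using hy
      exact ContMDiffAt.comp (g := Ψ.symm) (f := τ.symm) y (hΨ.smooth_symm _ hy')
        hτs.contMDiff.contMDiffAt
  refine Manifold.IsImmersionAtOfComplement.mk_of_charts L c
    (Ψ.trans τ.toOpenPartialHomeomorph) hp ?_
    (IsManifold.subset_maximalAtlas hc) hmax ?_ ?_
  · rw [hs] at hp
    simpa using hp
  · intro r hr
    rw [hs] at hr
    simpa using hr
  · intro x hx
    have hx' : x ∈ c.target := by simpa using hx
    obtain ⟨h1, h2⟩ := ht x hx'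
    change τ (Ψ (c.symm x).1) = L (x, 0)
    rw [h2, Ψ.right_inv h1]
    change L ((x, α) - (0, α)) = _
    simp

include hat in
lemma isSmoothEmbedding_incl (hq : q + n = Module.finrank ℂ E) :
    Manifold.IsSmoothEmbedding 𝓘(ℝ, CSpace q) 𝓘(ℝ, E) ∞ (LevelSet.incl Φ α) :=
  ⟨isImmersion_incl hat hq, Topology.IsEmbedding.subtypeVal⟩

include hat in
lemma contMDiff_incl (hq : q + n = Module.finrank ℂ E) :
    ContMDiff 𝓘(ℝ, CSpace q) 𝓘(ℝ, E) ∞ (LevelSet.incl Φ α) :=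
  (isImmersion_incl hat hq).contMDiff

include hat in
lemma IsSliceChart.isLocalDiffeomorphAt {c : OpenPartialHomeomorph (LevelSet Φ α) (CSpace q)}
    (hc : IsSliceChart D Φ α c) {p : LevelSet Φ α} (hp : p ∈ c.source)
    {F : LevelSet Φ α → CSpace q} (hF : Set.EqOn F c c.source) :
    IsLocalDiffeomorphAt 𝓘(ℂ, CSpace q) 𝓘(ℂ, CSpace q) ∞ F p :=
  ⟨{ toPartialEquiv := c.toPartialEquiv
     open_source := c.open_source
     open_target := c.open_target
     contMDiffOn_toFun := fun _ hr => (hc.contMDiffAt hat hr).contMDiffWithinAt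
     contMDiffOn_invFun := fun _ hx => (hc.contMDiffAt_symm hat hx).contMDiffWithinAt }, hp, hF⟩

include hat in
/-- The differential of a slice chart is bijective. -/
lemma IsSliceChart.bijective_rderiv {c : OpenPartialHomeomorph (LevelSet Φ α) (CSpace q)}
    (hc : IsSliceChart D Φ α c) {p : LevelSet Φ α} (hp : p ∈ c.source) :
    Function.Bijective (rderiv (E := CSpace q) (E' := CSpace q) c p) := by
  have hd : c.MDifferentiable 𝓘(ℝ, CSpace q) 𝓘(ℝ, CSpace q) :=
    ⟨fun r hr => ((hc.contMDiffAt hat hr).real_of_complex.mdifferentiableAt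
      (by simp)).mdifferentiableWithinAt,
    fun x hx => ((hc.contMDiffAt_symm hat hx).real_of_complex.mdifferentiableAt
      (by simp)).mdifferentiableWithinAt⟩
  exact (hd.mfderiv hp).bijective

end LevelSetManifold

/-! ### Tangent spaces of the level set -/

section TangentSpaces

variable {E : Type*} [NormedAddCommGroup E] [NormedSpace ℂ E] [FiniteDimensional ℂ E]
  {M : Type*} [TopologicalSpace M] [ChartedSpace E M] [IsManifold 𝓘(ℂ, E) ∞ M] {n q : ℕ}
  {Φ : M → (Fin n → ℝ) × (Fin n → ℝ)} {α : (Fin n → ℝ) × (Fin n → ℝ)}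
  [ChartedSpace (CSpace q) (LevelSet Φ α)] [IsManifold 𝓘(ℂ, CSpace q) ∞ (LevelSet Φ α)]

section Distribution

variable {D : ∀ p : M, Submodule ℝ (RTangent E p)}
  (hat : atlas (CSpace q) (LevelSet Φ α) = {c | IsSliceChart D Φ α c})
  (hq : q + n = Module.finrank ℂ E)

include hat hq in
/-- Slice charts are the restrictions of the transverse coordinates. -/
lemma rderiv_fst_rderiv_incl {φ : OpenPartialHomeomorph M (CSpace q × CSpace n)}
    (hφ : IsAdaptedChart D φ) {c : OpenPartialHomeomorph (LevelSet Φ α) (CSpace q)}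
    (h : ∀ r ∈ c.source, c r = (φ r.1).1) {p : LevelSet Φ α} (hp : p ∈ c.source)
    (hpφ : p.1 ∈ φ.source) (v : RTangent (CSpace q) p) :
    rderiv (E := E) (E' := CSpace q) (fun r : M => (φ r).1) p.1
      (rderiv (E := CSpace q) (E' := E) (LevelSet.incl Φ α) p v) =
    rderiv (E := CSpace q) (E' := CSpace q) c p v := by
  have h1 := rderiv_comp (E := CSpace q) (E' := E) (E'' := CSpace q)
    (g := fun r : M => (φ r).1) (f := LevelSet.incl Φ α) (p := p)
    ((hφ.contMDiffAt_fst hpφ).real_of_complex.mdifferentiableAt (by simp))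
    ((contMDiff_incl hat hq p).mdifferentiableAt (by simp)) v
  have h2 : (fun r : M => (φ r).1) ∘ LevelSet.incl Φ α =ᶠ[𝓝 p] c := by
    filter_upwards [c.open_source.mem_nhds hp] with r hr
    exact (h r hr).symm
  have h3 : mfderiv 𝓘(ℝ, CSpace q) 𝓘(ℝ, CSpace q)
      ((fun r : M => (φ r).1) ∘ LevelSet.incl Φ α) p =
      mfderiv 𝓘(ℝ, CSpace q) 𝓘(ℝ, CSpace q) c p := h2.mfderiv_eq
  exact h1.symm.trans (DFunLike.congr_fun h3 v)

include hat in
lemma exists_slice_at (p : LevelSet Φ α) :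
    ∃ (c : OpenPartialHomeomorph (LevelSet Φ α) (CSpace q))
      (φ : OpenPartialHomeomorph M (CSpace q × CSpace n)), IsSliceChart D Φ α c ∧
      IsAdaptedChart D φ ∧ p ∈ c.source ∧ p.1 ∈ φ.source ∧ ∀ r ∈ c.source, c r = (φ r.1).1 := by
  have hc := chart_mem_atlas (CSpace q) p
  have hp := mem_chart_source (CSpace q) p
  rw [hat] at hc
  obtain ⟨φ, Ψ, hφ, hΨ, hs, h, -⟩ := id hc
  refine ⟨_, φ, hc, hφ, hp, ?_, h⟩
  rw [hs] at hp
  exact hΨ.source_subset hp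

include hat hq in
/-- The level set is transverse to the foliation. -/
lemma isCompl_range_rderiv_incl (p : LevelSet Φ α) :
    IsCompl (rderiv (E := CSpace q) (E' := E) (LevelSet.incl Φ α) p).range (D p.1) := by
  obtain ⟨c, φ, hc, hφ, hp, hpφ, h⟩ := exists_slice_at hat p
  have hd := rderiv_fst_rderiv_incl hat hq hφ h hp hpφ
  obtain ⟨hinj, hsurj⟩ := hc.bijective_rderiv hat hp
  constructor
  · rw [Submodule.disjoint_def]
    rintro _ ⟨v, rfl⟩ hv
    have h1 := (hφ.mem_iff _ hpφ _).1 hv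
    have h2 : v = 0 := hinj (((hd v).symm.trans h1).trans (map_zero _).symm)
    rw [h2]
    exact map_zero _
  · rw [codisjoint_iff, eq_top_iff]
    intro v _
    obtain ⟨x, hx⟩ := hsurj (rderiv (E := E) (E' := CSpace q) (fun r : M => (φ r).1) p.1 v)
    refine Submodule.mem_sup.2 ⟨_, ⟨x, rfl⟩, v - rderiv (E := CSpace q) (E' := E)
      (LevelSet.incl Φ α) p x, ?_, add_sub_cancel _ _⟩
    rw [hφ.mem_iff _ hpφ]
    refine (map_sub _ _ _).trans (sub_eq_zero.2 ?_)
    exact hx.symm.trans (hd x).symm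

include hat hq in
/-- The complex structure of the level set is `J` modulo the foliation. -/
lemma rderiv_incl_cJ_sub_mem (p : LevelSet Φ α) (v : RTangent (CSpace q) p) :
    rderiv (E := CSpace q) (E' := E) (LevelSet.incl Φ α) p (cJ (CSpace q) p v) -
      cJ E p.1 (rderiv (E := CSpace q) (E' := E) (LevelSet.incl Φ α) p v) ∈ D p.1 := by
  obtain ⟨c, φ, hc, hφ, hp, hpφ, h⟩ := exists_slice_at hat p
  have hd := rderiv_fst_rderiv_incl hat hq hφ h hp hpφ
  rw [hφ.mem_iff _ hpφ]
  refine (map_sub _ _ _).trans (sub_eq_zero.2 ?_)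
  refine (hd _).trans ?_
  have h1 := rderiv_cJ (E := CSpace q) (E' := CSpace q)
    ((hc.contMDiffAt hat hp).mdifferentiableAt (by simp)) v
  have h2 := rderiv_cJ (E := E) (E' := CSpace q)
    ((hφ.contMDiffAt_fst hpφ).mdifferentiableAt (by simp))
    (rderiv (E := CSpace q) (E' := E) (LevelSet.incl Φ α) p v)
  refine h1.trans (Eq.trans ?_ h2.symm)
  exact congrArg (fun w : CSpace q => Complex.I • w) (hd v).symm

end Distribution

namespace KillingSystem

variable {Ω : TwoForm E M} {f g : Fin n → M → ℝ} {X Y : Fin n → VField E M}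
  (H : KillingSystem Ω f g X Y Φ α)
  (hat : atlas (CSpace q) (LevelSet Φ α) =
    {c | IsSliceChart (spanFields (fieldZ X Y) (fieldW X Y)) Φ α c})
  (hq : q + n = Module.finrank ℂ E)

include H hat hq in
lemma mfderiv_rderiv_incl (p : LevelSet Φ α) (v : RTangent (CSpace q) p) :
    mfderiv 𝓘(ℝ, E) 𝓘(ℝ, (Fin n → ℝ) × (Fin n → ℝ)) Φ p.1
      (rderiv (E := CSpace q) (E' := E) (LevelSet.incl Φ α) p v) = 0 := by
  have h1 := mfderiv_comp (I := 𝓘(ℝ, CSpace q)) (I' := 𝓘(ℝ, E))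
    (I'' := 𝓘(ℝ, (Fin n → ℝ) × (Fin n → ℝ))) (g := Φ) (f := LevelSet.incl Φ α) p
    ((H.smooth_Φ _).mdifferentiableAt (by simp))
    ((contMDiff_incl hat hq p).mdifferentiableAt (by simp))
  have h2 : Φ ∘ LevelSet.incl Φ α = fun _ => α := funext fun r => r.2
  rw [h2, mfderiv_const] at h1
  exact (DFunLike.congr_fun h1 v).symm

include H hat hq in
/-- The tangent space of the level set is the kernel of `dΦ`. -/
lemma mem_range_rderiv_incl (p : LevelSet Φ α) (v : RTangent E p.1) :
    v ∈ (rderiv (E := CSpace q) (E' := E) (LevelSet.incl Φ α) p).range ↔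
      mfderiv 𝓘(ℝ, E) 𝓘(ℝ, (Fin n → ℝ) × (Fin n → ℝ)) Φ p.1 v = 0 := by
  constructor
  · rintro ⟨x, rfl⟩
    exact H.mfderiv_rderiv_incl hat hq p x
  · intro hv
    have hc := (isCompl_range_rderiv_incl hat hq p).codisjoint
    have hmem : v ∈ (rderiv (E := CSpace q) (E' := E) (LevelSet.incl Φ α) p).range ⊔
        spanFields (fieldZ X Y) (fieldW X Y) p.1 := by
      rw [codisjoint_iff.1 hc]; trivial
    obtain ⟨_, ⟨x, rfl⟩, d, hd, rfl⟩ := Submodule.mem_sup.1 hmem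
    have h0 := H.eq_zero_of_mfderiv_eq_zero p.2 hd (by
      have h1 := H.mfderiv_rderiv_incl hat hq p x
      have h2 := (map_add (mfderiv 𝓘(ℝ, E) 𝓘(ℝ, (Fin n → ℝ) × (Fin n → ℝ)) Φ p.1) _ _).symm.trans hv
      exact (zero_add _).symm.trans ((congrArg (· + _) h1.symm).trans h2))
    rw [h0, add_zero]
    exact ⟨x, rfl⟩

include H hat hq in
lemma spanFields_le_range (p : LevelSet Φ α) :
    spanFields X Y p.1 ≤ (rderiv (E := CSpace q) (E' := E) (LevelSet.incl Φ α) p).range :=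
  fun v hv => (H.mem_range_rderiv_incl hat hq p v).2 (H.mfderiv_eq_zero_of_mem p.2 hv)

include H hat hq in
/-- `J_N v = J(v + s) + t` with `s`, `t` in the span of the `X_i`, `Y_i`. -/
lemma exists_rderiv_incl_cJ (p : LevelSet Φ α) (v : RTangent (CSpace q) p) :
    ∃ s ∈ spanFields X Y p.1, ∃ t ∈ spanFields X Y p.1,
      rderiv (E := CSpace q) (E' := E) (LevelSet.incl Φ α) p (cJ (CSpace q) p v) =
        cJ E p.1 (rderiv (E := CSpace q) (E' := E) (LevelSet.incl Φ α) p v + s) + t := by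
  obtain ⟨a, b, h⟩ := exists_add_cJ (rderiv_incl_cJ_sub_mem hat hq p v)
  refine ⟨_, sum_mem_spanFields X Y p.1 b fun i => -a i, _, sum_mem_spanFields X Y p.1 a b, ?_⟩
  rw [map_add, add_assoc, add_comm (cJ E p.1 (_ + _)), ← h]
  abel

include H in
lemma bilin_eq_zero_of_mem {p : M} {s v : RTangent E p} (hs : s ∈ spanFields X Y p)
    (hv : mfderiv 𝓘(ℝ, E) 𝓘(ℝ, (Fin n → ℝ) × (Fin n → ℝ)) Φ p v = 0) :
    Ω.bilin p s v = 0 ∧ Ω.bilin p v s = 0 := by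
  have h := (H.mfderiv_eq_zero_iff p v).1 hv s hs
  exact ⟨h, by rw [TwoForm.bilin_swap, h, neg_zero]⟩

include H hat hq in
/-- `Ω` is `J_N`-invariant on the level set: `J_N v` and `Jv` differ by elements of `T` and `JT`,
where `T = span(X_i, Y_i)` is `Ω`-orthogonal to the tangent space of the level set. -/
lemma bilin_rderiv_incl_cJ_cJ (p : LevelSet Φ α) (v w : RTangent (CSpace q) p) :
    Ω.bilin p.1 (rderiv (E := CSpace q) (E' := E) (LevelSet.incl Φ α) p (cJ (CSpace q) p v))
      (rderiv (E := CSpace q) (E' := E) (LevelSet.incl Φ α) p (cJ (CSpace q) p w)) =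
    Ω.bilin p.1 (rderiv (E := CSpace q) (E' := E) (LevelSet.incl Φ α) p v)
      (rderiv (E := CSpace q) (E' := E) (LevelSet.incl Φ α) p w) := by
  obtain ⟨s, hs, t, ht, h⟩ := H.exists_rderiv_incl_cJ hat hq p v
  obtain ⟨s', hs', t', ht', h'⟩ := H.exists_rderiv_incl_cJ hat hq p w
  have hk := fun v => H.mfderiv_rderiv_incl hat hq p v
  have hJv := hk (cJ (CSpace q) p v)
  have hJw := hk (cJ (CSpace q) p w)
  have e1 : rderiv (E := CSpace q) (E' := E) (LevelSet.incl Φ α) p (cJ (CSpace q) p w) - t' =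
      cJ E p.1 (rderiv (E := CSpace q) (E' := E) (LevelSet.incl Φ α) p w + s') := by
    rw [h', add_sub_cancel_right]
  have e0 : rderiv (E := CSpace q) (E' := E) (LevelSet.incl Φ α) p (cJ (CSpace q) p v) - t =
      cJ E p.1 (rderiv (E := CSpace q) (E' := E) (LevelSet.incl Φ α) p v + s) := by
    rw [h, add_sub_cancel_right]
  have e2 := H.bilin_cJ_cJ p.1 (rderiv (E := CSpace q) (E' := E) (LevelSet.incl Φ α) p v + s)
    (rderiv (E := CSpace q) (E' := E) (LevelSet.incl Φ α) p w + s')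
  rw [← e0, ← e1] at e2
  simp only [map_sub, map_add, sub_apply, add_apply] at e2
  rw [(H.bilin_eq_zero_of_mem ht hJw).1, (H.bilin_eq_zero_of_mem ht' hJv).2,
    (H.bilin_eq_zero_of_mem hs (hk w)).1, (H.bilin_eq_zero_of_mem hs' (hk v)).2,
    H.isotropic p.2 hs hs', H.isotropic p.2 ht ht'] at e2
  simpa using e2

include H hat hq in
/-- `Ω(J_N v, v) = Ω(J(v + s), v + s)` with `s` in the span of the `X_i`, `Y_i`, so this is
nonnegative, and vanishes only for `v = -s`. -/
lemma bilin_rderiv_incl_cJ_self (p : LevelSet Φ α) (v : RTangent (CSpace q) p) :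
    0 ≤ Ω.bilin p.1
      (rderiv (E := CSpace q) (E' := E) (LevelSet.incl Φ α) p (cJ (CSpace q) p v))
      (rderiv (E := CSpace q) (E' := E) (LevelSet.incl Φ α) p v) ∧
    (Ω.bilin p.1
      (rderiv (E := CSpace q) (E' := E) (LevelSet.incl Φ α) p (cJ (CSpace q) p v))
      (rderiv (E := CSpace q) (E' := E) (LevelSet.incl Φ α) p v) = 0 ↔
      rderiv (E := CSpace q) (E' := E) (LevelSet.incl Φ α) p v ∈ spanFields X Y p.1) := by
  obtain ⟨s, hs, t, ht, h⟩ := H.exists_rderiv_incl_cJ hat hq p v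
  have hk := fun v => H.mfderiv_rderiv_incl hat hq p v
  set u := rderiv (E := CSpace q) (E' := E) (LevelSet.incl Φ α) p v with hu
  have e0 : rderiv (E := CSpace q) (E' := E) (LevelSet.incl Φ α) p (cJ (CSpace q) p v) - t =
      cJ E p.1 (u + s) := by
    rw [h, add_sub_cancel_right]
  have e1 : Ω.bilin p.1
      (rderiv (E := CSpace q) (E' := E) (LevelSet.incl Φ α) p (cJ (CSpace q) p v)) u =
      Ω.bilin p.1 (cJ E p.1 (u + s)) (u + s) := by
    rw [← e0]
    simp only [map_sub, map_add, sub_apply]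
    rw [(H.bilin_eq_zero_of_mem hs (hk (cJ (CSpace q) p v))).2,
      (H.bilin_eq_zero_of_mem ht (hk v)).1, H.isotropic p.2 ht hs]
    simp
  rw [e1]
  refine ⟨?_, fun h0 => ?_, fun hmem => ?_⟩
  · by_cases h0 : u + s = 0
    · rw [h0]; simp
    · rw [TwoForm.bilin_apply]
      exact (H.kahler.pos p.1 _ h0).le
  · have := H.eq_zero_of_bilin_cJ h0
    rw [eq_neg_of_add_eq_zero_left this]
    exact neg_mem hs
  · rw [← e1]
    exact (H.bilin_eq_zero_of_mem hmem (hk _)).2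

end KillingSystem
end TangentSpaces

/-! ### The restriction of the Kähler form -/

section Pullback

variable {E : Type*} [NormedAddCommGroup E] [NormedSpace ℂ E] [FiniteDimensional ℂ E]
  {M : Type*} [TopologicalSpace M] [ChartedSpace E M] [IsManifold 𝓘(ℂ, E) ∞ M]
  {E' : Type*} [NormedAddCommGroup E'] [NormedSpace ℂ E'] [FiniteDimensional ℂ E']
  {N : Type*} [TopologicalSpace N] [ChartedSpace E' N] [IsManifold 𝓘(ℂ, E') ∞ N]

lemma two_form_ext {W : Type*} [NormedAddCommGroup W] [NormedSpace ℝ W] {η θ : W [⋀^Fin 2]→L[ℝ] ℝ}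
    (h : ∀ u v, η ![u, v] = θ ![u, v]) : η = θ := by
  ext w
  have hw : w = ![w 0, w 1] := by ext i; fin_cases i <;> rfl
  rw [hw]
  exact h _ _

lemma TwoForm.pullback_apply (Ω : TwoForm E M) (ι : N → M) (p : N) (u v : RTangent E' p) :
    Ω.pullback (E := E') ι p ![u, v] =
      Ω (ι p) ![rderiv (E := E') (E' := E) ι p u, rderiv (E := E') (E' := E) ι p v] := by
  change Ω (ι p) _ = _
  congr 1
  ext i; fin_cases i <;> rfl

/-- The coordinate expression of a pullback is the pullback of the coordinate expression. -/
lemma TwoForm.eventually_inChart_pullback (Ω : TwoForm E M) {ι : N → M}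
    (hι : ContMDiff 𝓘(ℝ, E') 𝓘(ℝ, E) ∞ ι) (x : N) {y₀ : E'} (hy₀ : y₀ ∈ (chartAt E' x).target) :
    ∃ (p : M) (j : E' → E), ContDiffAt ℝ ∞ j y₀ ∧ ContDiffAt ℝ ∞ (fderiv ℝ j) y₀ ∧
      j y₀ ∈ (chartAt E p).target ∧
      (Ω.pullback (E := E') ι).inChart x =ᶠ[𝓝 y₀] fun y =>
        (Ω.inChart p (j y)).compContinuousLinearMap (fderiv ℝ j y) := by
  set c := chartAt E' x with hc
  set p := ι (c.symm y₀) with hp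
  set e := chartAt E p with he
  have hj : ∀ y ∈ c.target, ContMDiffAt 𝓘(ℝ, E') 𝓘(ℝ, E) ∞ (ι ∘ c.symm) y := fun y hy =>
    (hι _).comp y (contMDiffAt_chartAt_symm_complex hy).real_of_complex
  set O : Set E' := c.target ∩ (ι ∘ c.symm) ⁻¹' e.source with hO
  have hOo : IsOpen O :=
    (hι.continuous.comp_continuousOn c.continuousOn_symm).isOpen_inter_preimage c.open_target
      e.open_source
  have hy₀O : y₀ ∈ O := ⟨hy₀, mem_chart_source E p⟩
  have hcd : ∀ y ∈ O, ContDiffAt ℝ ∞ (e ∘ ι ∘ c.symm) y := fun y hy =>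
    (ContMDiffAt.comp (I' := 𝓘(ℝ, E)) (g := e) (f := ι ∘ c.symm) y
      (contMDiffAt_chartAt_complex hy.2).real_of_complex (hj y hy.1)).contDiffAt
  have hcd' : ContDiffOn ℝ ∞ (e ∘ ι ∘ c.symm) O := fun y hy => (hcd y hy).contDiffWithinAt
  refine ⟨p, e ∘ ι ∘ c.symm, hcd _ hy₀O,
    (hcd'.fderiv_of_isOpen hOo (m := ∞) (by simp)).contDiffAt (hOo.mem_nhds hy₀O),
    e.map_source hy₀O.2, ?_⟩
  filter_upwards [hOo.mem_nhds hy₀O] with y hy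
  refine two_form_ext fun u v => ?_
  rw [TwoForm.inChart_apply]
  refine (TwoForm.pullback_apply Ω ι _ _ _).trans ?_
  have hd : ∀ u : E', (rderiv (E := E') (E' := E) ι (c.symm y)
      (rderiv (E := E') (E' := E') c.symm y u) : E) =
      rderiv (E := E) (E' := E) e.symm ((e ∘ ι ∘ c.symm) y) (fderiv ℝ (e ∘ ι ∘ c.symm) y u) := by
    intro u
    have h1 := rderiv_comp (E := E') (E' := E') (E'' := E) (g := ι) (f := c.symm) (p := y)
      ((hι _).mdifferentiableAt (by simp))
      ((contMDiffAt_chartAt_symm_complex hy.1).real_of_complex.mdifferentiableAt (by simp)) u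
    have htgt : (e ∘ ι ∘ c.symm) y ∈ e.target := e.map_source hy.2
    have h2 := rderiv_comp (E := E') (E' := E) (E'' := E) (g := e.symm) (f := e ∘ ι ∘ c.symm)
      (p := y) ((contMDiffAt_chartAt_symm_complex htgt).real_of_complex.mdifferentiableAt (by simp))
      ((hcd y hy).contMDiffAt.mdifferentiableAt (by simp)) u
    rw [rderiv_eq_fderiv (e ∘ ι ∘ c.symm)] at h2
    have hev : ι ∘ c.symm =ᶠ[𝓝 y] e.symm ∘ (e ∘ ι ∘ c.symm) := by
      filter_upwards [hOo.mem_nhds hy] with z hz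
      exact (e.left_inv hz.2).symm
    have h3 : mfderiv 𝓘(ℝ, E') 𝓘(ℝ, E) (ι ∘ c.symm) y =
      mfderiv 𝓘(ℝ, E') 𝓘(ℝ, E) (e.symm ∘ (e ∘ ι ∘ c.symm)) y := hev.mfderiv_eq
    exact h1.symm.trans ((DFunLike.congr_fun h3 u).trans h2)
  -- all tangent spaces are `E`, so `Ω` can be compared at propositionally equal points
  let B : M → E → E → ℝ := fun P a b => Ω P ![a, b]
  have hP : ι (c.symm y) = e.symm ((e ∘ ι ∘ c.symm) y) := (e.left_inv hy.2).symm
  have : B (ι (c.symm y)) (rderiv (E := E') (E' := E) ι (c.symm y)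
      (rderiv (E := E') (E' := E') c.symm y u)) (rderiv (E := E') (E' := E) ι (c.symm y)
      (rderiv (E := E') (E' := E') c.symm y v)) = B (e.symm ((e ∘ ι ∘ c.symm) y))
      (rderiv (E := E) (E' := E) e.symm ((e ∘ ι ∘ c.symm) y) (fderiv ℝ (e ∘ ι ∘ c.symm) y u))
      (rderiv (E := E) (E' := E) e.symm ((e ∘ ι ∘ c.symm) y) (fderiv ℝ (e ∘ ι ∘ c.symm) y v)) :=
    congr (congr (congrArg B hP) (hd u)) (hd v)
  refine this.trans ((TwoForm.inChart_apply Ω p _ _ _).symm.trans ?_)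
  change Ω.inChart p ((e ∘ ι ∘ c.symm) y) _ = Ω.inChart p ((e ∘ ι ∘ c.symm) y) _
  congr 1
  ext i; fin_cases i <;> rfl

lemma TwoForm.IsSmooth.pullback {Ω : TwoForm E M} (hΩ : Ω.IsSmooth) {ι : N → M}
    (hι : ContMDiff 𝓘(ℝ, E') 𝓘(ℝ, E) ∞ ι) : (Ω.pullback (E := E') ι).IsSmooth := by
  intro x y hy
  obtain ⟨p, j, hj, hj', hmem, hev⟩ := Ω.eventually_inChart_pullback hι x hy
  have h1 := (hΩ p).contDiffAt ((chartAt E p).open_target.mem_nhds hmem)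
  have : FiniteDimensional ℝ E := FiniteDimensional.complexToReal E
  have : FiniteDimensional ℝ E' := FiniteDimensional.complexToReal E'
  exact ((ContDiffAt.compContinuousLinearMap_two (h1.comp y hj) hj').congr_of_eventuallyEq
    hev).contDiffWithinAt

lemma TwoForm.IsClosed.pullback {Ω : TwoForm E M} (hΩ : Ω.IsSmooth) (hΩ' : Ω.IsClosed) {ι : N → M}
    (hι : ContMDiff 𝓘(ℝ, E') 𝓘(ℝ, E) ∞ ι) : (Ω.pullback (E := E') ι).IsClosed := by
  intro x y hy
  obtain ⟨p, j, hj, hj', hmem, hev⟩ := Ω.eventually_inChart_pullback hι x hy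
  have h1 := (hΩ p).contDiffAt ((chartAt E p).open_target.mem_nhds hmem)
  rw [hev.extDeriv_eq, extDeriv_pullback (h1.differentiableAt (by simp)) hj
    minSmoothness_two_le_infty, hΩ' p _ hmem]
  rfl

end Pullback

/-! ### The foliation of the level set -/

section Foliation

variable {E : Type*} [NormedAddCommGroup E] [NormedSpace ℂ E] [FiniteDimensional ℂ E]
  {M : Type*} [TopologicalSpace M] [ChartedSpace E M] [IsManifold 𝓘(ℂ, E) ∞ M] {n q k : ℕ}
  {Φ : M → (Fin n → ℝ) × (Fin n → ℝ)} {α : (Fin n → ℝ) × (Fin n → ℝ)}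
  [ChartedSpace (CSpace q) (LevelSet Φ α)] [IsManifold 𝓘(ℂ, CSpace q) ∞ (LevelSet Φ α)]

namespace KillingSystem

variable {Ω : TwoForm E M} {f g : Fin n → M → ℝ} {X Y : Fin n → VField E M}
  (H : KillingSystem Ω f g X Y Φ α)
  (hat : atlas (CSpace q) (LevelSet Φ α) =
    {c | IsSliceChart (spanFields (fieldZ X Y) (fieldW X Y)) Φ α c})
  (hq : q + n = Module.finrank ℂ E)

include H hat hq in
lemma isTransverseKahler_pullback :
    (Ω.pullback (E := CSpace q) (LevelSet.incl Φ α)).IsTransverseKahler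
      (restrictDist (E := CSpace q) (LevelSet.incl Φ α) (spanFields X Y)) where
  smooth := H.kahler.smooth.pullback (contMDiff_incl hat hq)
  closed := TwoForm.IsClosed.pullback H.kahler.smooth H.kahler.closed (contMDiff_incl hat hq)
  invariant p v w := by
    rw [TwoForm.pullback_apply, TwoForm.pullback_apply, ← TwoForm.bilin_apply,
      ← TwoForm.bilin_apply, H.bilin_rderiv_incl_cJ_cJ hat hq]
  nonneg p v := by
    rw [TwoForm.pullback_apply, ← TwoForm.bilin_apply]
    exact (H.bilin_rderiv_incl_cJ_self hat hq p v).1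
  eq_zero_iff p v := by
    rw [TwoForm.pullback_apply, ← TwoForm.bilin_apply]
    exact (H.bilin_rderiv_incl_cJ_self hat hq p v).2

include H hat hq in
/-- A vector tangent to the level set lies in the span of the `X_i`, `Y_i`, `Z_i`, `W_i` only if it
lies in that of the `X_i`, `Y_i`, because the `Z_i`, `W_i` are transverse to the level set. -/
lemma rderiv_incl_mem_iff (p : LevelSet Φ α) (v : RTangent (CSpace q) p) :
    rderiv (E := CSpace q) (E' := E) (LevelSet.incl Φ α) p v ∈ spanFields X Y p.1 ⊔
        spanFields (fieldZ X Y) (fieldW X Y) p.1 ↔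
      rderiv (E := CSpace q) (E' := E) (LevelSet.incl Φ α) p v ∈ spanFields X Y p.1 := by
  refine ⟨fun h => ?_, fun h => Submodule.mem_sup_left h⟩
  obtain ⟨x, hx, d, hd, hxd⟩ := Submodule.mem_sup.1 h
  have hdr : d ∈ (rderiv (E := CSpace q) (E' := E) (LevelSet.incl Φ α) p).range := by
    rw [← eq_sub_iff_add_eq'] at hxd
    rw [hxd]
    exact sub_mem ⟨v, rfl⟩ (H.spanFields_le_range hat hq p hx)
  have h0 := Submodule.disjoint_def.1 (isCompl_range_rderiv_incl hat hq p).disjoint d hdr hd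
  rw [h0, add_zero] at hxd
  rw [← hxd]
  exact hx

include H hat hq in
/-- The foliation of the level set spanned by the `X_i`, `Y_i` has holomorphic charts: some of the
transverse coordinates of the foliation spanned by the `Z_i`, `W_i` are constant along it. -/
lemma exists_adaptedChart_levelSet (hk : k + 2 * n = Module.finrank ℂ E) (p : LevelSet Φ α) :
    ∃ χ : OpenPartialHomeomorph (LevelSet Φ α) (CSpace k × CSpace n),
      IsAdaptedChart (E := CSpace q)
        (restrictDist (E := CSpace q) (LevelSet.incl Φ α) (spanFields X Y)) χ ∧ p ∈ χ.source := by
  let T : CSpace q ≃L[ℂ] CSpace k × CSpace n := ContinuousLinearEquiv.ofFinrankEq (by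
    rw [Module.finrank_prod, finrank_CSpace, finrank_CSpace, finrank_CSpace]; omega)
  obtain ⟨φ, hpφ, hφ, hker⟩ := H.exists_adaptedChart T hk p.2
  obtain ⟨c, hc, hpc, hcs, hcφ⟩ := H.exists_sliceChart hq hφ p hpφ
  obtain ⟨χ, hpχ, hχs, hχt, hχ, hχsymm, hprod⟩ :=
    (c.trans T.toHomeomorph.toOpenPartialHomeomorph).exists_restrict_prod (p := p)
      (by simpa using hpc)
  have hsrc : ∀ r ∈ χ.source, r ∈ c.source := fun r hr => by simpa using hχs hr
  have hχe : ∀ r, χ r = T (c r) := fun r => congrFun hχ r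
  refine ⟨χ, ⟨hprod, ?_, ?_, ?_⟩, hpχ⟩
  · intro r hr
    have h : ContMDiffAt 𝓘(ℂ, CSpace q) 𝓘(ℂ, CSpace k × CSpace n) ∞ (T ∘ c) r :=
      T.contDiff.contMDiff.contMDiffAt.comp r (hc.contMDiffAt hat (hsrc r hr))
    rw [hχ]
    exact h.contMDiffWithinAt
  · intro z hz
    have hz' : T.symm z ∈ c.target := by simpa using hχt hz
    have h : ContMDiffAt 𝓘(ℂ, CSpace k × CSpace n) 𝓘(ℂ, CSpace q) ∞ (c.symm ∘ T.symm) z :=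
      (hc.contMDiffAt_symm hat hz').comp z T.symm.contDiff.contMDiff.contMDiffAt
    rw [hχsymm]
    exact h.contMDiffWithinAt
  · intro r hr v
    have hrφ : r.1 ∈ φ.source := hcs (hsrc r hr)
    change rderiv (E := CSpace q) (E' := E) (LevelSet.incl Φ α) r v ∈ spanFields X Y r.1 ↔ _
    rw [← H.rderiv_incl_mem_iff hat hq, hker r.1 hrφ]
    let P : CSpace q →L[ℂ] CSpace k := .fst ℂ (CSpace k) (CSpace n) ∘L
      (T : CSpace q →L[ℂ] CSpace k × CSpace n)
    have hsm : ContMDiffAt 𝓘(ℂ, E) 𝓘(ℂ, CSpace k) ∞ (P ∘ fun r => (φ r).1) r.1 :=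
      P.contDiff.contMDiff.contMDiffAt.comp r.1 (hφ.contMDiffAt_fst hrφ)
    have h1 := rderiv_comp (E := CSpace q) (E' := E) (E'' := CSpace k)
      (g := fun r : M => (T (φ r).1).1) (f := LevelSet.incl Φ α) (p := r)
      (hsm.real_of_complex.mdifferentiableAt (by simp))
      ((contMDiff_incl hat hq r).mdifferentiableAt (by simp)) v
    have hev : (fun r : M => (T (φ r).1).1) ∘ LevelSet.incl Φ α =ᶠ[𝓝 r] fun r => (χ r).1 := by
      filter_upwards [χ.open_source.mem_nhds hr] with s hs
      rw [hχe, hcφ s (hsrc s hs)]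
      rfl
    have h2 : mfderiv 𝓘(ℝ, CSpace q) 𝓘(ℝ, CSpace k)
        ((fun r : M => (T (φ r).1).1) ∘ LevelSet.incl Φ α) r =
        mfderiv 𝓘(ℝ, CSpace q) 𝓘(ℝ, CSpace k) (fun r => (χ r).1) r := hev.mfderiv_eq
    have h3 := h1.symm.trans (DFunLike.congr_fun h2 v)
    exact ⟨fun h => h3.symm.trans h, fun h => h3.trans h⟩

end KillingSystem
end Foliation

/-! ### Conclusion -/

section Conclusion

variable {E : Type*} [NormedAddCommGroup E] [NormedSpace ℂ E] [FiniteDimensional ℂ E]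
  {M : Type*} [TopologicalSpace M] [ChartedSpace E M] [IsManifold 𝓘(ℂ, E) ∞ M] {n q k : ℕ}
  {Φ : M → (Fin n → ℝ) × (Fin n → ℝ)} {α : (Fin n → ℝ) × (Fin n → ℝ)}
  {Ω : TwoForm E M} {f g : Fin n → M → ℝ} {X Y : Fin n → VField E M}

namespace KillingSystem

lemma exists_sliceChart_at (H : KillingSystem Ω f g X Y Φ α) (hq : q + n = Module.finrank ℂ E)
    (hk : k + 2 * n = Module.finrank ℂ E) (p : LevelSet Φ α) :
    ∃ c : OpenPartialHomeomorph (LevelSet Φ α) (CSpace q),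
      IsSliceChart (spanFields (fieldZ X Y) (fieldW X Y)) Φ α c ∧ p ∈ c.source := by
  let T : CSpace q ≃L[ℂ] CSpace k × CSpace n := ContinuousLinearEquiv.ofFinrankEq (by
    rw [Module.finrank_prod, finrank_CSpace, finrank_CSpace, finrank_CSpace]; omega)
  obtain ⟨φ, hpφ, hφ, -⟩ := H.exists_adaptedChart T hk p.2
  obtain ⟨c, hc, hpc, -⟩ := H.exists_sliceChart hq hφ p hpφ
  exact ⟨c, hc, hpc⟩

/-- The complex manifold structure of the level set. Its charts are the transverse coordinates of
the foliation spanned by the `Z_i`, `W_i`. -/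
noncomputable abbrev levelSetChartedSpace (H : KillingSystem Ω f g X Y Φ α)
    (hq : q + n = Module.finrank ℂ E) (hk : k + 2 * n = Module.finrank ℂ E) :
    ChartedSpace (CSpace q) (LevelSet Φ α) where
  atlas := {c | IsSliceChart (spanFields (fieldZ X Y) (fieldW X Y)) Φ α c}
  chartAt p := (H.exists_sliceChart_at hq hk p).choose
  mem_chart_source p := (H.exists_sliceChart_at hq hk p).choose_spec.2
  chart_mem_atlas p := (H.exists_sliceChart_at hq hk p).choose_spec.1

end KillingSystem
end Conclusion

theorem theorem2p1
    {E : Type*} [NormedAddCommGroup E] [NormedSpace ℂ E] [FiniteDimensional ℂ E]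
    {M : Type*} [TopologicalSpace M] [T2Space M] [SecondCountableTopology M]
    [ChartedSpace E M] [IsManifold 𝓘(ℂ, E) ∞ M]
    -- the Kähler manifold `(M, Ω, J)`, of complex dimension `m`
    (m : ℕ) (hm : Module.finrank ℂ E = m)
    (Ω : TwoForm E M) (hΩ : Ω.IsKahler)
    -- the functions and their commuting Killing Hamiltonian vector fields
    (n : ℕ) (f g : Fin n → M → ℝ)
    (hf : ∀ i, ContMDiff 𝓘(ℝ, E) 𝓘(ℝ, ℝ) ∞ (f i))
    (hg : ∀ i, ContMDiff 𝓘(ℝ, E) 𝓘(ℝ, ℝ) ∞ (g i))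
    (X Y : Fin n → VField E M)
    (hX : ∀ i, Ω.IsHamiltonian (f i) (X i)) (hY : ∀ i, Ω.IsHamiltonian (g i) (Y i))
    (hXK : ∀ i, Ω.IsKilling (X i)) (hYK : ∀ i, Ω.IsKilling (Y i))
    (hXX : ∀ i j, FieldsCommute (X i) (X j)) (hXY : ∀ i j, FieldsCommute (X i) (Y j))
    (hYY : ∀ i j, FieldsCommute (Y i) (Y j))
    -- the nonempty regular level set `N = Φ⁻¹(α)`
    (Φ : M → (Fin n → ℝ) × (Fin n → ℝ)) (hΦ : Φ = fun p => (fun i => f i p, fun i => g i p))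
    (α : (Fin n → ℝ) × (Fin n → ℝ))
    (hreg : ∀ p, Φ p = α → Function.Surjective
      (mfderiv 𝓘(ℝ, E) 𝓘(ℝ, (Fin n → ℝ) × (Fin n → ℝ)) Φ p))
    (hne : ∃ p, Φ p = α)
    -- the Hamiltonians are in involution along `N`
    (hinv : ∀ p, Φ p = α → ∀ i j,
      Ω p ![X i p, X j p] = 0 ∧ Ω p ![X i p, Y j p] = 0 ∧ Ω p ![Y i p, Y j p] = 0)
    -- the vector fields `Z_i = X_i - J Y_i` and `W_i = J X_i + Y_i`
    (Z W : Fin n → VField E M)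
    (hZ : ∀ i p, Z i p = X i p - cJ E p (Y i p))
    (hW : ∀ i p, W i p = cJ E p (X i p) + Y i p) :
    2 * n ≤ m ∧
    -- the `Z_i`, `W_i` generate a holomorphic foliation on a neighbourhood of `N`
    ∃ (U : Set M) (A : HolFoliationAtlas E (m - n) n U),
      IsOpen U ∧ {p | Φ p = α} ⊆ U ∧ A.HasTangent (spanFields Z W) ∧
    -- `N` is a complex manifold, smoothly embedded into `M` by the inclusion
    ∃ _ : ChartedSpace (CSpace (m - n)) (LevelSet Φ α),
      IsManifold 𝓘(ℂ, CSpace (m - n)) ∞ (LevelSet Φ α) ∧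
      Manifold.IsSmoothEmbedding 𝓘(ℝ, CSpace (m - n)) 𝓘(ℝ, E) ∞ (LevelSet.incl Φ α) ∧
      -- the foliation generated by the `Z_i`, `W_i` is transverse to `N`
      (∀ p : LevelSet Φ α,
        IsCompl (rderiv (E := CSpace (m - n)) (LevelSet.incl Φ α) p).range (spanFields Z W p.1)) ∧
      -- its transverse coordinates restrict to holomorphic coordinates of `N`
      (∀ φ ∈ A.charts, IsLocalDiffeomorphOn 𝓘(ℂ, CSpace (m - n)) 𝓘(ℂ, CSpace (m - n)) ∞
        (fun p : LevelSet Φ α => (φ p.1).1) {p | p.1 ∈ φ.source}) ∧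
      -- so the complex structure `J_N` of `N` is `J` modulo that foliation
      (∀ (p : LevelSet Φ α) (v : RTangent (CSpace (m - n)) p),
        rderiv (E := CSpace (m - n)) (LevelSet.incl Φ α) p (cJ (CSpace (m - n)) p v) -
          cJ E p.1 (rderiv (E := CSpace (m - n)) (LevelSet.incl Φ α) p v) ∈ spanFields Z W p.1) ∧
      -- the `X_i`, `Y_i` are tangent to `N` and generate a holomorphic foliation on `N`
      (∀ p : LevelSet Φ α, spanFields X Y p.1 ≤ (rderiv (E := CSpace (m - n)) (LevelSet.incl Φ α) p).range) ∧
      (∃ B : HolFoliationAtlas (CSpace (m - n)) (m - 2 * n) n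
          (Set.univ : Set (LevelSet Φ α)),
        B.HasTangent (restrictDist (E := CSpace (m - n)) (LevelSet.incl Φ α) (spanFields X Y))) ∧
      -- and the restriction of `Ω` to `N` is transverse Kähler with respect to it
      (Ω.pullback (E := CSpace (m - n)) (LevelSet.incl Φ α)).IsTransverseKahler
        (restrictDist (E := CSpace (m - n)) (LevelSet.incl Φ α) (spanFields X Y)) := by
  have H : KillingSystem Ω f g X Y Φ α :=
    ⟨hΩ, hf, hg, hX, hY, hXK, hYK, hXX, hXY, hYY, hΦ, hreg, hinv⟩
  obtain rfl : Z = fieldZ X Y := funext fun i => funext fun p => hZ i p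
  obtain rfl : W = fieldW X Y := funext fun i => funext fun p => hW i p
  obtain ⟨p₀, hp₀⟩ := hne
  have hmn : 2 * n ≤ m := H.two_mul_le hm hp₀
  have hq : m - n + n = Module.finrank ℂ E := by omega
  have hk : m - 2 * n + 2 * n = Module.finrank ℂ E := by omega
  let T : CSpace (m - n) ≃L[ℂ] CSpace (m - 2 * n) × CSpace n := ContinuousLinearEquiv.ofFinrankEq
    (by rw [Module.finrank_prod, finrank_CSpace, finrank_CSpace, finrank_CSpace]; omega)
  -- the largest open set on which the `Z_i`, `W_i` span a holomorphic foliation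
  set U : Set M := ⋃ φ ∈ {φ : OpenPartialHomeomorph M (CSpace (m - n) × CSpace n) |
    IsAdaptedChart (spanFields (fieldZ X Y) (fieldW X Y)) φ}, φ.source with hU
  have hcover : ∀ p ∈ U, ∃ φ : OpenPartialHomeomorph M (CSpace (m - n) × CSpace n),
      IsAdaptedChart (spanFields (fieldZ X Y) (fieldW X Y)) φ ∧ φ.source ⊆ U ∧ p ∈ φ.source := by
    intro p hp
    obtain ⟨φ, hφ, hpφ⟩ := Set.mem_iUnion₂.1 hp
    exact ⟨φ, hφ, Set.subset_biUnion_of_mem (u := fun φ : OpenPartialHomeomorph M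
      (CSpace (m - n) × CSpace n) => φ.source) hφ, hpφ⟩
  refine ⟨hmn, U, .ofDistribution _ _ (spanFields (fieldZ X Y) (fieldW X Y)) U hcover,
    isOpen_biUnion fun φ _ => φ.open_source, ?_,
    HolFoliationAtlas.ofDistribution_hasTangent hcover, ?_⟩
  · intro p hp
    obtain ⟨φ, hpφ, hφ, -⟩ := H.exists_adaptedChart T hk hp
    exact Set.mem_iUnion₂.2 ⟨φ, hφ, hpφ⟩
  let := H.levelSetChartedSpace hq hk
  have hat : atlas (CSpace (m - n)) (LevelSet Φ α) =
    {c | IsSliceChart (spanFields (fieldZ X Y) (fieldW X Y)) Φ α c} := rfl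
  have hman : IsManifold 𝓘(ℂ, CSpace (m - n)) ∞ (LevelSet Φ α) := isManifold_levelSet hat
  have hcoverN : ∀ p ∈ (Set.univ : Set (LevelSet Φ α)),
      ∃ χ : OpenPartialHomeomorph (LevelSet Φ α) (CSpace (m - 2 * n) × CSpace n),
        IsAdaptedChart (E := CSpace (m - n))
          (restrictDist (E := CSpace (m - n)) (LevelSet.incl Φ α) (spanFields X Y)) χ ∧
        χ.source ⊆ Set.univ ∧ p ∈ χ.source := by
    intro p _
    obtain ⟨χ, hχ, hpχ⟩ := H.exists_adaptedChart_levelSet hat hq hk p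
    exact ⟨χ, hχ, Set.subset_univ _, hpχ⟩
  refine ⟨inferInstance, hman, isSmoothEmbedding_incl hat hq, isCompl_range_rderiv_incl hat hq, ?_,
    rderiv_incl_cJ_sub_mem hat hq, H.spanFields_le_range hat hq,
    ⟨.ofDistribution _ _ _ _ hcoverN, HolFoliationAtlas.ofDistribution_hasTangent hcoverN⟩,
    H.isTransverseKahler_pullback hat hq⟩
  rintro φ ⟨hφ, -⟩ ⟨p, hp⟩
  obtain ⟨c, hc, hpc, -, hcφ⟩ := H.exists_sliceChart hq hφ p hp
  exact hc.isLocalDiffeomorphAt hat hpc fun r hr => (hcφ r hr).symm
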